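/- **Theorem 2.6.** Let $n\ge 2$, and write $\mathbb{R}^n=\mathbb{R}\times\mathbb{R}^{n-1}$ with coordinates $(t,u_1,\dots,u_{n-1})$. Let $U\subseteq\mathbb{R}^n$ be a nonempty open subset such that the projection $p\colon U\to\mathbb{R}^{n-1}$, $(t,u)\mapsto u$, has connected fibers and its image $p(U)$ is star-shaped with respect to $0\in\mathbb{R}^{n-1}$. Let $E=\sum_{i=1}^{n-1}u_i\partial_{u_i}$ and let $\Lambda=\partial_t\wedge E$ be the "book" Poisson structure. For $k\ge 0$ let $H^k_{book}(U)$ be its Poisson cohomology, that is, the $k$-th cohomology of the complex $(\mathfrak{X}^\bullet(U),[\Lambda,\cdot\,])$ of smooth multivector fields on $U$, where $[\cdot,\cdot]$ is the Schouten bracket. For a multi-index $I=(i_1\le\dots\le i_l)$ and a strictly increasing multi-index $J=(j_1<\dots<j_r)$ with entries in $\{1,\dots,n-1\}$, put $|I|=l$, $|J|=r$, $u_I=u_{i_1}\cdots u_{i_l}$ and $\partial_J=\partial_{u_{j_1}}\wedge\dots\wedge\partial_{u_{j_r}}$, and let $J^c=\{1,\dots,n-1\}\setminus J$. The pair $(I,J)$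 is called *admissible* if $\max I\le\max J^c$, with the convention $\max\emptyset=-\infty$. Then for every $k\ge 0$, $$H^k_{book}(U)\cong\mathbb{R}^{b_k},\qquad b_k=\binom{n-1}{k}\binom{n+k-2}{k},$$ as real vector spaces, and a basis of $H^k_{book}(U)$ is given by the classes of the cocycles $$\partial_t\wedge(u_{I'}\partial_{J'}),\qquad u_I\partial_J,$$ where $(I',J')$ and $(I,J)$ run over the admissible pairs with $|I'|=|J'|=k-1$ and $|I|=|J|=k$ (there are no pairs $(I',J')$ if $k=0$). -/

import Mathlib

open scoped ContDiff

noncomputable section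

namespace BookPoisson

open TopologicalSpace

/-! ### Smooth functions on an open subset of `ℝ^d` -/

/-- Extension by zero of a function on an open set `U ⊆ ℝ^d`. -/
def extendZero {d : ℕ} {U : Opens (Fin d → ℝ)} (f : U → ℝ) : (Fin d → ℝ) → ℝ :=
  Function.extend Subtype.val f 0

theorem extendZero_coe {d : ℕ} {U : Opens (Fin d → ℝ)} (f : U → ℝ) (x : U) :
    extendZero f (x : Fin d → ℝ) = f x :=
  Subtype.val_injective.extend_apply f 0 x

/-- A function which agrees on `U` with a function of class `C^∞` on `U` is itself smooth. -/
theorem contDiffOn_extendZero {d : ℕ} {U : Opens (Fin d → ℝ)} {f : U → ℝ}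
    {g : (Fin d → ℝ) → ℝ} (hg : ContDiffOn ℝ ∞ g U) (h : ∀ x : U, f x = g x) :
    ContDiffOn ℝ ∞ (extendZero f) U :=
  hg.congr fun x hx => by rw [← h ⟨x, hx⟩]; exact extendZero_coe f ⟨x, hx⟩

/-- The `ℝ`-algebra `C^∞(U)` of smooth real functions on the open set `U ⊆ ℝ^d`.
Only the values on `U` matter, since `U` is open and smoothness is tested on `U`. -/
def SmoothFun {d : ℕ} (U : Opens (Fin d → ℝ)) : Subalgebra ℝ (U → ℝ) where
  carrier := {f | ContDiffOn ℝ ∞ (extendZero f) U}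
  mul_mem' {f g} hf hg := contDiffOn_extendZero (ContDiffOn.mul hf hg) fun x => by
    simp [extendZero_coe]
  add_mem' {f g} hf hg := contDiffOn_extendZero (ContDiffOn.add hf hg) fun x => by
    simp [extendZero_coe]
  algebraMap_mem' r := contDiffOn_extendZero (g := fun _ => r) contDiffOn_const fun x => rfl

/-- The coordinate function `x_i` on `U`. -/
def coordFun {d : ℕ} (U : Opens (Fin d → ℝ)) (i : Fin d) : SmoothFun U :=
  ⟨fun x => x.1 i, contDiffOn_extendZero (g := fun x => x i)
    (contDiff_apply ℝ ℝ i).contDiffOn fun _ => rfl⟩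

theorem differentiableAt_extendZero {d : ℕ} {U : Opens (Fin d → ℝ)} (f : SmoothFun U) (x : U) :
    DifferentiableAt ℝ (extendZero (f : U → ℝ)) x :=
  (ContDiffOn.contDiffAt f.2 (U.isOpen.mem_nhds x.2)).differentiableAt (by simp)

/-- The partial derivative `∂/∂x_i : C^∞(U) → C^∞(U)`. -/
def partialDeriv {d : ℕ} (U : Opens (Fin d → ℝ)) (i : Fin d) :
    SmoothFun U →ₗ[ℝ] SmoothFun U where
  toFun f := ⟨fun x => fderiv ℝ (extendZero (f : U → ℝ)) x (Pi.single i 1),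
    contDiffOn_extendZero
      (g := fun x => fderiv ℝ (extendZero (f : U → ℝ)) x (Pi.single i 1))
      ((ContDiffOn.fderiv_of_isOpen f.2 U.isOpen (by simp)).clm_apply contDiffOn_const)
      fun _ => rfl⟩
  map_add' f g := by
    ext x
    have h : extendZero ((f + g : SmoothFun U) : U → ℝ) =ᶠ[nhds (x : Fin d → ℝ)]
        extendZero (f : U → ℝ) + extendZero (g : U → ℝ) := by
      filter_upwards [U.isOpen.mem_nhds x.2] with y hy
      have e : ∀ k : U → ℝ, extendZero k y = k ⟨y, hy⟩ := fun k => extendZero_coe k ⟨y, hy⟩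
      simp [e]
    change fderiv ℝ (extendZero ((f + g : SmoothFun U) : U → ℝ)) x (Pi.single i 1) =
      fderiv ℝ (extendZero (f : U → ℝ)) x (Pi.single i 1) +
        fderiv ℝ (extendZero (g : U → ℝ)) x (Pi.single i 1)
    rw [h.fderiv_eq, fderiv_add (differentiableAt_extendZero f x)
      (differentiableAt_extendZero g x)]
    rfl
  map_smul' c f := by
    ext x
    have h : extendZero ((c • f : SmoothFun U) : U → ℝ) =ᶠ[nhds (x : Fin d → ℝ)]
        c • extendZero (f : U → ℝ) := by
      filter_upwards [U.isOpen.mem_nhds x.2] with y hy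
      have e : ∀ k : U → ℝ, extendZero k y = k ⟨y, hy⟩ := fun k => extendZero_coe k ⟨y, hy⟩
      simp [e]
    change fderiv ℝ (extendZero ((c • f : SmoothFun U) : U → ℝ)) x (Pi.single i 1) =
      c * fderiv ℝ (extendZero (f : U → ℝ)) x (Pi.single i 1)
    rw [h.fderiv_eq, fderiv_const_smul (differentiableAt_extendZero f x)]
    rfl

/-! ### Multivector fields and the Schouten bracket -/

/-- Vector fields `𝔛(U)`: the free `C^∞(U)`-module on the coordinate fields `∂/∂x_i`; the family
`X` stands for `∑ i, X i ∂/∂x_i`. -/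
abbrev VectorField {d : ℕ} (U : Opens (Fin d → ℝ)) : Type := Fin d → SmoothFun U

/-- All multivector fields `𝔛^•(U)`: the exterior algebra over `C^∞(U)` of the module of vector
fields. Its product is the wedge product. -/
abbrev Multivector {d : ℕ} (U : Opens (Fin d → ℝ)) : Type :=
  ExteriorAlgebra (SmoothFun U) (VectorField U)

/-- The real vector space `𝔛^k(U)` of `k`-vector fields. -/
def kVectorField {d : ℕ} (U : Opens (Fin d → ℝ)) (k : ℕ) : Submodule ℝ (Multivector U) :=
  (⋀[SmoothFun U]^k (VectorField U)).restrictScalars ℝ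

/-- A vector field, as a multivector field of degree one. -/
def ofVectorField {d : ℕ} {U : Opens (Fin d → ℝ)} (X : VectorField U) : Multivector U :=
  ExteriorAlgebra.ι (SmoothFun U) X

/-- The coordinate vector field `∂/∂x_i`, as a multivector field. -/
def coordField {d : ℕ} (U : Opens (Fin d → ℝ)) (i : Fin d) : Multivector U :=
  ofVectorField (Pi.single i 1)

/-- The `C^∞(U)`-basis of `𝔛^•(U)` given by `∂_{j_1} ∧ ⋯ ∧ ∂_{j_r}` with `j_1 < ⋯ < j_r`. -/
def coordBasis {d : ℕ} (U : Opens (Fin d → ℝ)) :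
    Module.Basis (Finset (Fin d)) (SmoothFun U) (Multivector U) :=
  (Pi.basisFun (SmoothFun U) (Fin d)).ExteriorAlgebra

/-- `∂/∂x_i` applied to the coefficient functions of a multivector field. -/
def coeffDeriv {d : ℕ} (U : Opens (Fin d → ℝ)) (i : Fin d) :
    Multivector U →ₗ[ℝ] Multivector U where
  toFun μ := ∑ J : Finset (Fin d), partialDeriv U i ((coordBasis U).repr μ J) • coordBasis U J
  map_add' μ ν := by simp [add_smul, Finset.sum_add_distrib]
  map_smul' c μ := by
    have h : (coordBasis U).repr (c • μ) = c • (coordBasis U).repr μ :=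
      ((coordBasis U).repr.toLinearMap.restrictScalars ℝ).map_smul c μ
    simp [h, Finset.smul_sum]

/-- The one-form `dx_i`, as a `C^∞(U)`-linear form on vector fields. -/
def coordForm {d : ℕ} (U : Opens (Fin d → ℝ)) (i : Fin d) :
    Module.Dual (SmoothFun U) (VectorField U) :=
  LinearMap.proj i

/-- The Schouten bracket `[P, ·]` of multivector fields in coordinates. With `ζ_i = ∂/∂x_i`,
regarded as odd variables,
`[P, Q] = ∑ i, (P ∂⃖/∂ζ_i) ∧ ∂Q/∂x_i - ∂P/∂x_i ∧ (∂⃗/∂ζ_i Q)`,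
where the derivatives in `ζ_i` from the right and from the left are the contractions with `dx_i`
(`(ζ_{i_1}⋯ζ_{i_p}) ∂⃖/∂ζ_{i_p} = ζ_{i_1}⋯ζ_{i_{p-1}}`, `∂⃗/∂ζ_{i_1} (ζ_{i_1}⋯ζ_{i_p}) =
ζ_{i_2}⋯ζ_{i_p}`). For `P` of degree `p` and `Q` of degree `q` the second term equals
`(-1)^((p-1)(q-1)) (Q ∂⃖/∂ζ_i) ∧ ∂P/∂x_i`. On vector fields this is the Lie bracket, and
`[X ∧ Y, Q] = X ∧ [Y, Q] - Y ∧ [X, Q]` for vector fields `X`, `Y`. -/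
def schouten {d : ℕ} {U : Opens (Fin d → ℝ)} (P : Multivector U) :
    Multivector U →ₗ[ℝ] Multivector U :=
  ∑ i : Fin d,
    (LinearMap.mulLeft ℝ (CliffordAlgebra.contractRight P (coordForm U i)) ∘ₗ coeffDeriv U i -
      LinearMap.mulLeft ℝ (coeffDeriv U i P) ∘ₗ
        (CliffordAlgebra.contractLeft (coordForm U i)).restrictScalars ℝ)

/-! ### Poisson cohomology -/

/-- The kernel of `d_Λ = [Λ, ·]` in `𝔛^k(U)`. -/
def cocycles {d : ℕ} {U : Opens (Fin d → ℝ)} (Λ : Multivector U) (k : ℕ) :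
    Submodule ℝ (Multivector U) :=
  kVectorField U k ⊓ LinearMap.ker (schouten Λ)

/-- The image `d_Λ (𝔛^{k-1}(U))` of `d_Λ = [Λ, ·]`, where `𝔛^{-1}(U) = 0`. -/
def coboundaries {d : ℕ} {U : Opens (Fin d → ℝ)} (Λ : Multivector U) :
    ℕ → Submodule ℝ (Multivector U)
  | 0 => ⊥
  | k + 1 => (kVectorField U k).map (schouten Λ)

/-- The `k`-th Poisson cohomology of `U` with respect to the Poisson bivector field `Λ`: the
`k`-cocycles modulo those which are coboundaries. -/
abbrev PoissonCohomology {d : ℕ} {U : Opens (Fin d → ℝ)} (Λ : Multivector U) (k : ℕ) : Type :=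
  cocycles Λ k ⧸ (coboundaries Λ k).submoduleOf (cocycles Λ k)

/-- The Poisson cohomology class of a cocycle. -/
def cohomologyClass {d : ℕ} {U : Opens (Fin d → ℝ)} {Λ : Multivector U} {k : ℕ}
    {μ : Multivector U} (h : μ ∈ cocycles Λ k) : PoissonCohomology Λ k :=
  Submodule.Quotient.mk ⟨μ, h⟩

/-! ### The book Poisson structure

The coordinates of `ℝ^{m+1} = ℝ × ℝ^m` are `t = x_0` and `u_j = x_{j+1}`, for `j : Fin m`. -/

/-- The Euler vector field `E = ∑ j, u_j ∂/∂u_j`. -/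
def eulerField {m : ℕ} (U : Opens (Fin (m + 1) → ℝ)) : Multivector U :=
  ∑ j : Fin m, coordFun U j.succ • coordField U j.succ

/-- The book Poisson structure `Λ = ∂/∂t ∧ E`. -/
def bookBivector {m : ℕ} (U : Opens (Fin (m + 1) → ℝ)) : Multivector U :=
  coordField U 0 * eulerField U

/-- The projection `(t, u) ↦ u` of `ℝ × ℝ^m` onto `ℝ^m`. -/
def proj (m : ℕ) (x : Fin (m + 1) → ℝ) : Fin m → ℝ := fun j => x j.succ

/-- A multi-index `I` (with repetitions) and an increasing multi-index `J` are admissible if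
`max I ≤ max J^c`, where `max ∅ = -∞` (here `⊥`). -/
def Admissible {m : ℕ} (I : Multiset (Fin m)) (J : Finset (Fin m)) : Prop :=
  I.toFinset.max ≤ Jᶜ.max

/-- Admissible pairs `(I, J)` with `|I| = |J| = l`. -/
abbrev AdmissiblePair (m l : ℕ) : Type :=
  {p : Multiset (Fin m) × Finset (Fin m) //
    p.1.card = l ∧ p.2.card = l ∧ Admissible p.1 p.2}

/-- Admissible pairs `(I, J)` with `|I| = |J| = k - 1`; there are none if `k = 0`. -/
abbrev AdmissiblePairPred (m k : ℕ) : Type :=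
  {p : Multiset (Fin m) × Finset (Fin m) //
    p.1.card + 1 = k ∧ p.2.card + 1 = k ∧ Admissible p.1 p.2}

/-- `u_I ∂_J`, where `u_I` is the product of the `u_i` for `i ∈ I` with multiplicity and
`∂_J = ∂/∂u_{j_1} ∧ ⋯ ∧ ∂/∂u_{j_r}` for `J = {j_1 < ⋯ < j_r}`. -/
def monomialField {m : ℕ} (U : Opens (Fin (m + 1) → ℝ)) (I : Multiset (Fin m))
    (J : Finset (Fin m)) : Multivector U :=
  (I.map fun i => coordFun U i.succ).prod •
    (J.sort.map fun j => coordField U j.succ).prod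

/-- The multivector fields `∂/∂t ∧ (u_{I'} ∂_{J'})` and `u_I ∂_J` for admissible pairs with
`|I'| = |J'| = k - 1` and `|I| = |J| = k`. -/
def basisField {m : ℕ} (U : Opens (Fin (m + 1) → ℝ)) (k : ℕ) :
    AdmissiblePairPred m k ⊕ AdmissiblePair m k → Multivector U
  | .inl p => coordField U 0 * monomialField U p.1.1 p.1.2
  | .inr p => monomialField U p.1.1 p.1.2

end BookPoisson

end

noncomputable section

namespace BookPoisson

open TopologicalSpace

/-! ### Smoothness of parametric integrals -/

section ParametricIntegral

open MeasureTheory Set Topology Interval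

universe v

/-! Write m = n - 1, K for the exterior product with E, and L for the Lie derivative along E. L acts
on f ∂_J by f ↦ E f - r f, where r is the number of factors ∂_{u_j} in ∂_J. The Schouten bracket
with Λ is then d = ∂_t ∧ L - K ∂/∂t (`bracket_bivector`). The computation of the cohomology uses
only these operators and a few solvability properties of C^∞(U), collected in `BookAlgebra`.

The divergence h of multivector fields satisfies dh + hd = -m ∂/∂t (`diff_homotopy`), so ∂/∂t acts
as zero on cohomology. Integrating hμ in t makes a cocycle μ independent of t up to a coboundary.
This integration uses a smooth section of p, which exists because the fibres are intervals. On
t-independent fields d is ∂_t ∧ L. The components without ∂_t are therefore killed by L, and Euler's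
equation makes their coefficients homogeneous polynomials of degree r. Star-shapedness gives
Hadamard's lemma, by which every function of u is a homogeneous polynomial of degree r plus an
element of the image of E - r. The components containing ∂_t are thus polynomial modulo coboundaries
as well (`exists_poly_add_cob`).

Every cocycle is therefore cohomologous to an element of the space `poly` of t-independent fields
killed by L. All of these are cocycles. The coboundaries among them are exactly the image under K of
`poly` one degree lower (`koszul_mem_cob`, `exists_koszul_eq`). Splitting off ∂_t leaves the
cokernel of K on the span of the u_I ∂_J with |I| = |J|.

This cokernel is found by a triangularity argument. For an admissible (I, J), adding i = max J^c to
both entries gives a non-admissible pair, while adding any other element of J^c gives an admissible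
one. So K(u_I ∂_J) is a nonzero multiple of the field of the enlarged pair plus admissible fields
(`exists_koszul_polyField`). Enlarging is a bijection from admissible pairs of size l - 1 onto
non-admissible pairs of size l. With K² = 0, the admissible fields form a basis of the cokernel. The
same bijection counts the basis: admissible pairs of sizes k - 1 and k together are as many as all
pairs of size k. -/

/-- Differentiation under an integral over `[0,1]`, for a smooth integrand. -/
theorem hasFDerivAt_integral_unitInterval {E F : Type v} [NormedAddCommGroup E] [NormedSpace ℝ E]
    [FiniteDimensional ℝ E] [NormedAddCommGroup F] [NormedSpace ℝ F]
    {O : Set (ℝ × E)} (hO : IsOpen O) {g : ℝ × E → F} (hg : ContDiffOn ℝ ∞ g O) {W : Set E}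
    (hW : IsOpen W) (hWO : ∀ θ ∈ Icc (0 : ℝ) 1, ∀ x ∈ W, (θ, x) ∈ O) {x : E} (hx : x ∈ W) :
    HasFDerivAt (fun y => ∫ θ in (0 : ℝ)..1, g (θ, y))
      (∫ θ in (0 : ℝ)..1, (fderiv ℝ g (θ, x)).comp (ContinuousLinearMap.inr ℝ ℝ E)) x := by
  have hproper : ProperSpace E := FiniteDimensional.proper_real E
  obtain ⟨r, hr, hrW⟩ := Metric.nhds_basis_closedBall.mem_iff.1 (hW.mem_nhds hx)
  have hg' : ContDiffOn ℝ ∞ (fun z => (fderiv ℝ g z).comp (ContinuousLinearMap.inr ℝ ℝ E)) O :=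
    (hg.fderiv_of_isOpen hO (by simp)).clm_comp contDiffOn_const
  have hcurve : ∀ y ∈ W, ∀ {G : Type v} [NormedAddCommGroup G] [NormedSpace ℝ G] {h : ℝ × E → G},
      ContDiffOn ℝ ∞ h O → ContinuousOn (fun θ : ℝ => h (θ, y)) (Icc 0 1) := by
    intro y hy G _ _ h hh
    exact hh.continuousOn.comp (by fun_prop) fun θ hθ => hWO θ hθ y hy
  -- A compact neighbourhood of the slice over x bounds the derivative, which supplies the constant
  -- dominating function.
  have hcompact : IsCompact (Icc (0 : ℝ) 1 ×ˢ Metric.closedBall x r) :=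
    isCompact_Icc.prod (isCompact_closedBall x r)
  obtain ⟨C, hC⟩ := hcompact.exists_bound_of_continuousOn
    (hg'.continuousOn.mono fun z hz => hWO z.1 hz.1 z.2 (hrW hz.2))
  have hsub : Ι (0 : ℝ) 1 ⊆ Icc 0 1 := by
    rw [uIoc_of_le zero_le_one]; exact Ioc_subset_Icc_self
  have hmeas : ∀ y ∈ W, ∀ {G : Type v} [NormedAddCommGroup G] [NormedSpace ℝ G] {h : ℝ × E → G},
      ContDiffOn ℝ ∞ h O → AEStronglyMeasurable (fun θ : ℝ => h (θ, y))
        (volume.restrict (Ι (0 : ℝ) 1)) := by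
    intro y hy G _ _ h hh
    exact ((hcurve y hy hh).aestronglyMeasurable measurableSet_Icc).mono_measure
      (Measure.restrict_mono hsub le_rfl)
  refine intervalIntegral.hasFDerivAt_integral_of_dominated_of_fderiv_le (𝕜 := ℝ)
    (F := fun y θ => g (θ, y))
    (F' := fun y θ => (fderiv ℝ g (θ, y)).comp (ContinuousLinearMap.inr ℝ ℝ E))
    (s := Metric.ball x r) (bound := fun _ => C)
    (Metric.ball_mem_nhds x hr) ?_ ?_ (hmeas x hx hg') ?_ ?_ ?_
  · filter_upwards [hW.mem_nhds hx] with y hy using hmeas y hy hg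
  · exact ContinuousOn.intervalIntegrable (by
      rw [uIcc_of_le zero_le_one]; exact hcurve x hx hg)
  · exact Filter.Eventually.of_forall fun θ hθ y hy =>
      hC (θ, y) ⟨hsub hθ, Metric.ball_subset_closedBall hy⟩
  · exact intervalIntegrable_const
  · refine Filter.Eventually.of_forall fun θ hθ y hy => ?_
    have hmem := hWO θ (hsub hθ) y (hrW (Metric.ball_subset_closedBall hy))
    have hd : HasFDerivAt g (fderiv ℝ g (θ, y)) (θ, y) :=
      ((hg.contDiffAt (hO.mem_nhds hmem)).differentiableAt (by simp)).hasFDerivAt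
    exact hd.comp y (hasFDerivAt_prodMk_right θ y)

/-- The derivative is again such an integral, with values in `E →L[ℝ] F`, so smoothness follows by
induction on the order with F varying. E and F share a universe so that the new target is allowed in
the induction. -/
theorem contDiffOn_integral_unitInterval {E F : Type v} [NormedAddCommGroup E] [NormedSpace ℝ E]
    [FiniteDimensional ℝ E] [NormedAddCommGroup F] [NormedSpace ℝ F]
    {O : Set (ℝ × E)} (hO : IsOpen O) {g : ℝ × E → F} (hg : ContDiffOn ℝ ∞ g O) {W : Set E}
    (hW : IsOpen W) (hWO : ∀ θ ∈ Icc (0 : ℝ) 1, ∀ x ∈ W, (θ, x) ∈ O) :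
    ContDiffOn ℝ ∞ (fun y => ∫ θ in (0 : ℝ)..1, g (θ, y)) W := by
  refine contDiffOn_infty.2 fun n => ?_
  induction n generalizing F with
  | zero =>
    exact contDiffOn_zero.2 fun x hx =>
      (hasFDerivAt_integral_unitInterval hO hg hW hWO hx).continuousAt.continuousWithinAt
  | succ n ih =>
    rw [Nat.cast_add, Nat.cast_one, contDiffOn_succ_iff_fderiv_of_isOpen hW]
    refine ⟨fun x hx => (hasFDerivAt_integral_unitInterval hO hg hW hWO
      hx).differentiableAt.differentiableWithinAt, by simp, ?_⟩
    have hg' : ContDiffOn ℝ ∞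
        (fun z => (fderiv ℝ g z).comp (ContinuousLinearMap.inr ℝ ℝ E)) O :=
      (hg.fderiv_of_isOpen hO (by simp)).clm_comp contDiffOn_const
    exact (ih hg').congr fun x hx => (hasFDerivAt_integral_unitInterval hO hg hW hWO hx).fderiv

end ParametricIntegral

/-! ### Calculus of smooth functions on `U` -/

section Calculus

open Set Topology

variable {d : ℕ} {U : Opens (Fin d → ℝ)}

theorem contDiffOn_coe (f : SmoothFun U) : ContDiffOn ℝ ∞ (extendZero (f : U → ℝ)) U := f.2

theorem partialDeriv_apply (f : SmoothFun U) (i : Fin d) (x : U) :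
    (partialDeriv U i f : U → ℝ) x = fderiv ℝ (extendZero (f : U → ℝ)) x (Pi.single i 1) := rfl

/-- The chain rule for a smooth function along a curve. -/
theorem hasDerivAt_extendZero_comp (f : SmoothFun U) {c : ℝ → Fin d → ℝ} {c' : Fin d → ℝ} {r : ℝ}
    (hc : HasDerivAt c c' r) (hr : c r ∈ U) :
    HasDerivAt (fun s => extendZero (f : U → ℝ) (c s))
      (∑ i, c' i * (partialDeriv U i f : U → ℝ) ⟨c r, hr⟩) r := by
  have h := (differentiableAt_extendZero f ⟨c r, hr⟩).hasFDerivAt.comp_hasDerivAt r hc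
  refine h.congr_deriv ?_
  set T := fderiv ℝ (extendZero (f : U → ℝ)) (c r) with hT
  have hsum : T c' = ∑ i, T (c' i • Pi.single i 1) := by
    rw [← map_sum]
    congr 1
    ext i
    simp [Finset.sum_apply, Pi.single_apply]
  change T c' = _
  rw [hsum]
  refine Finset.sum_congr rfl fun i _ => ?_
  rw [map_smul, smul_eq_mul, partialDeriv_apply]

theorem extendZero_eventuallyEq {f : U → ℝ} {g : (Fin d → ℝ) → ℝ} (h : ∀ x : U, f x = g x)
    (x : U) : extendZero f =ᶠ[𝓝 (x : Fin d → ℝ)] g := by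
  filter_upwards [U.isOpen.mem_nhds x.2] with y hy
  rw [← h ⟨y, hy⟩]
  exact extendZero_coe f ⟨y, hy⟩

theorem partialDeriv_mul (i : Fin d) (f g : SmoothFun U) :
    partialDeriv U i (f * g) = partialDeriv U i f * g + f * partialDeriv U i g := by
  ext x
  have h := extendZero_eventuallyEq (f := ((f * g : SmoothFun U) : U → ℝ))
    (g := extendZero (f : U → ℝ) * extendZero (g : U → ℝ)) (fun x => by simp [extendZero_coe]) x
  rw [partialDeriv_apply, h.fderiv_eq, fderiv_mul (differentiableAt_extendZero f x)
    (differentiableAt_extendZero g x)]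
  simp [extendZero_coe, partialDeriv_apply]
  ring

theorem partialDeriv_coordFun (i j : Fin d) :
    partialDeriv U i (coordFun U j) = if i = j then 1 else 0 := by
  ext x
  have h := extendZero_eventuallyEq (f := (coordFun U j : U → ℝ))
    (g := fun x => ContinuousLinearMap.proj (R := ℝ) (φ := fun _ : Fin d => ℝ) j x)
    (fun x => rfl) x
  rw [partialDeriv_apply, h.fderiv_eq, ContinuousLinearMap.fderiv]
  rw [ContinuousLinearMap.proj_apply, Pi.single_apply]
  by_cases hij : i = j <;> simp [hij, eq_comm]

theorem partialDeriv_comm (i j : Fin d) (f : SmoothFun U) :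
    partialDeriv U i (partialDeriv U j f) = partialDeriv U j (partialDeriv U i f) := by
  ext x
  have key : ∀ i j : Fin d, (partialDeriv U i (partialDeriv U j f) : U → ℝ) x =
      fderiv ℝ (fderiv ℝ (extendZero (f : U → ℝ))) x (Pi.single i 1) (Pi.single j 1) := by
    intro i j
    have h := extendZero_eventuallyEq (f := (partialDeriv U j f : U → ℝ))
      (g := fun y => fderiv ℝ (extendZero (f : U → ℝ)) y (Pi.single j 1))
      (fun x => rfl) x
    have hd : DifferentiableAt ℝ (fderiv ℝ (extendZero (f : U → ℝ))) x :=
      (((contDiffOn_coe f).fderiv_of_isOpen U.isOpen (m := ∞) (by simp)).contDiffAt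
        (U.isOpen.mem_nhds x.2)).differentiableAt (by simp)
    rw [partialDeriv_apply, h.fderiv_eq, fderiv_clm_apply hd (by fun_prop)]
    simp
  have hs : IsSymmSndFDerivAt ℝ (extendZero (f : U → ℝ)) x :=
    ((contDiffOn_coe f).contDiffAt (U.isOpen.mem_nhds x.2)).isSymmSndFDerivAt (by
      simpa using WithTop.coe_le_coe.2 (le_top : (2 : ℕ∞) ≤ ⊤))
  rw [key, key, hs.eq]

end Calculus

/-! ### Functions on a domain fibred over a star-shaped set -/

section Fibred

open Set Topology MeasureTheory

variable {m : ℕ} {U : Opens (Fin (m + 1) → ℝ)}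

theorem cons_proj (x : Fin (m + 1) → ℝ) : (Fin.cons (x 0) (proj m x) : Fin (m + 1) → ℝ) = x :=
  Fin.cons_self_tail x

@[simp]
theorem proj_cons (t : ℝ) (u : Fin m → ℝ) : proj m (Fin.cons t u) = u := by
  ext j; simp [proj]

theorem contDiff_proj : ContDiff ℝ ∞ (proj m) :=
  contDiff_pi.2 fun j => contDiff_apply ℝ ℝ j.succ

theorem contDiff_cons {E : Type*} [NormedAddCommGroup E] [NormedSpace ℝ E] {a : E → ℝ}
    {b : E → Fin m → ℝ} {s : Set E} (ha : ContDiffOn ℝ ∞ a s) (hb : ContDiffOn ℝ ∞ b s) :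
    ContDiffOn ℝ ∞ (fun x => (Fin.cons (a x) (b x) : Fin (m + 1) → ℝ)) s := by
  refine contDiffOn_pi.2 fun i => ?_
  refine Fin.cases ?_ (fun j => ?_) i
  · simpa using ha
  · simpa using contDiffOn_pi.1 hb j

theorem hasDerivAt_cons {a : ℝ → ℝ} {b : ℝ → Fin m → ℝ} {a' : ℝ} {b' : Fin m → ℝ} {r : ℝ}
    (ha : HasDerivAt a a' r) (hb : HasDerivAt b b' r) :
    HasDerivAt (fun x => (Fin.cons (a x) (b x) : Fin (m + 1) → ℝ)) (Fin.cons a' b') r := by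
  refine hasDerivAt_pi.2 fun i => ?_
  refine Fin.cases ?_ (fun j => ?_) i
  · simpa using ha
  · simpa using hasDerivAt_pi.1 hb j

/-- The base `p(U)`. -/
def base (U : Opens (Fin (m + 1) → ℝ)) : Opens (Fin m → ℝ) where
  carrier := proj m '' (U : Set (Fin (m + 1) → ℝ))
  is_open' := by
    have : proj m '' (U : Set (Fin (m + 1) → ℝ)) =
        ⋃ t : ℝ, (fun u => (Fin.cons t u : Fin (m + 1) → ℝ)) ⁻¹' U := by
      ext u
      simp only [mem_image, mem_iUnion, mem_preimage]
      constructor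
      · rintro ⟨x, hx, rfl⟩
        exact ⟨x 0, by rwa [cons_proj]⟩
      · rintro ⟨t, ht⟩
        exact ⟨_, ht, proj_cons t u⟩
    rw [this]
    refine isOpen_iUnion fun t => U.isOpen.preimage ?_
    exact continuous_const.finCons continuous_id

theorem proj_mem_base {x : Fin (m + 1) → ℝ} (hx : x ∈ U) : proj m x ∈ base U := ⟨x, hx, rfl⟩

theorem mem_base_of_cons {t : ℝ} {u : Fin m → ℝ} (h : (Fin.cons t u : Fin (m + 1) → ℝ) ∈ U) :
    u ∈ base U := by simpa using proj_mem_base h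

/-- The fibre of `U` over `u`, as a set of real numbers. -/
def fibre (U : Opens (Fin (m + 1) → ℝ)) (u : Fin m → ℝ) : Set ℝ :=
  {t | (Fin.cons t u : Fin (m + 1) → ℝ) ∈ U}

theorem isOpen_fibre (u : Fin m → ℝ) : IsOpen (fibre U u) :=
  U.isOpen.preimage (continuous_id.finCons continuous_const)

/-- The fibres of `p : U → p(U)` are connected. -/
def ConnectedFibres (U : Opens (Fin (m + 1) → ℝ)) : Prop :=
  ∀ u ∈ proj m '' (U : Set (Fin (m + 1) → ℝ)),
    IsConnected ((U : Set (Fin (m + 1) → ℝ)) ∩ proj m ⁻¹' {u})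

theorem ConnectedFibres.ordConnected (h : ConnectedFibres U) (u : Fin m → ℝ) :
    (fibre U u).OrdConnected := by
  by_cases hu : u ∈ base U
  · have himage : fibre U u = (fun x : Fin (m + 1) → ℝ => x 0) ''
        ((U : Set (Fin (m + 1) → ℝ)) ∩ proj m ⁻¹' {u}) := by
      ext t
      constructor
      · exact fun ht => ⟨_, ⟨ht, proj_cons t u⟩, by simp⟩
      · rintro ⟨x, ⟨hx, rfl⟩, rfl⟩
        change Fin.cons (x 0) (proj m x) ∈ U
        rwa [cons_proj]
    rw [himage]
    exact ((h u hu).isPreconnected.image _ (continuous_apply 0).continuousOn).ordConnected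
  · have : fibre U u = ∅ := by
      ext t
      simp only [mem_empty_iff_false, iff_false]
      exact fun ht => hu (mem_base_of_cons ht)
    rw [this]
    exact ordConnected_empty

/-- Fibres are intervals, and a point of a fibre stays in the neighbouring fibres because U is open.
A partition of unity glues these locally constant choices, and convexity keeps the result in the
fibres. -/
theorem ConnectedFibres.exists_section (h : ConnectedFibres U) :
    ∃ s : (Fin m → ℝ) → ℝ, ContDiffOn ℝ ∞ s (base U) ∧
      ∀ u ∈ base U, (Fin.cons (s u) u : Fin (m + 1) → ℝ) ∈ U := by
  have : LocallyCompactSpace (base U) := (base U).isOpen.locallyCompactSpace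
  obtain ⟨g, hg⟩ := exists_contMDiffMap_forall_mem_convex_of_local_const
    (modelWithCornersSelf ℝ (Fin m → ℝ)) (M := base U) (n := ⊤)
    (t := fun u => fibre U u)
    (fun u => (h.ordConnected u).convex) (by
      rintro ⟨u, x, hx, rfl⟩
      refine ⟨x 0, ?_⟩
      have hopen : IsOpen {v : base U | (Fin.cons (x 0) (v : Fin m → ℝ) : Fin (m + 1) → ℝ) ∈ U} :=
        U.isOpen.preimage (continuous_const.finCons continuous_subtype_val)
      refine hopen.mem_nhds ?_
      change Fin.cons (x 0) (proj m x) ∈ U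
      rwa [cons_proj])
  refine ⟨extendZero g, fun u hu => ?_, fun u hu => ?_⟩
  · have hc : ContMDiffAt (modelWithCornersSelf ℝ (Fin m → ℝ)) (modelWithCornersSelf ℝ ℝ) ∞
        (fun v : base U => extendZero (g : base U → ℝ) v) ⟨u, hu⟩ := by
      have := g.contMDiff ⟨u, hu⟩
      convert this using 1
      funext v
      exact extendZero_coe _ v
    exact (contMDiffAt_subtype_iff.1 hc).contDiffAt.contDiffWithinAt
  · have := hg ⟨u, hu⟩
    rwa [extendZero_coe (g : base U → ℝ) ⟨u, hu⟩]

end Fibred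

/-! ### Solving equations in ∂/∂t and in the Euler operator by integration. -/

section Primitives

open Set Topology MeasureTheory

variable {m : ℕ} {U : Opens (Fin (m + 1) → ℝ)}

theorem hasDerivAt_fibre (f : SmoothFun U) {t : ℝ} {u : Fin m → ℝ} (ht : t ∈ fibre U u) :
    HasDerivAt (fun r => extendZero (f : U → ℝ) (Fin.cons r u))
      ((partialDeriv U 0 f : U → ℝ) ⟨Fin.cons t u, ht⟩) t := by
  have h := hasDerivAt_extendZero_comp f
    (hasDerivAt_cons (hasDerivAt_id t) (hasDerivAt_const t u)) ht
  refine h.congr_deriv ?_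
  simp [Fin.sum_univ_succ]

/-- The derivative along the curve `r ↦ (t, r u)`. -/
theorem hasDerivAt_ray (f : SmoothFun U) {t r : ℝ} {u : Fin m → ℝ} (ht : t ∈ fibre U (r • u)) :
    HasDerivAt (fun r => extendZero (f : U → ℝ) (Fin.cons t (r • u)))
      (∑ j, u j * (partialDeriv U j.succ f : U → ℝ) ⟨Fin.cons t (r • u), ht⟩) r := by
  have hu : HasDerivAt (fun r : ℝ => r • u) u r := by
    simpa using (hasDerivAt_id r).smul_const u
  have h := hasDerivAt_extendZero_comp f (hasDerivAt_cons (hasDerivAt_const r t) hu) ht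
  refine h.congr_deriv ?_
  simp [Fin.sum_univ_succ]

/-- `∂/∂t` is surjective on smooth functions. -/
theorem ConnectedFibres.partialDeriv_zero_surjective (h : ConnectedFibres U) :
    Function.Surjective (partialDeriv U 0) := by
  intro f
  obtain ⟨s, hs, hsU⟩ := h.exists_section
  set F := extendZero (f : U → ℝ)
  let seg : ℝ × (Fin (m + 1) → ℝ) → Fin (m + 1) → ℝ := fun z =>
    Fin.cons (s (proj m z.2) + z.1 * (z.2 0 - s (proj m z.2))) (proj m z.2)
  have hsp : ContDiffOn ℝ ∞ (fun x => s (proj m x)) U :=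
    hs.comp contDiff_proj.contDiffOn fun x hx => proj_mem_base hx
  have hsp2 : ContDiffOn ℝ ∞ (fun z : ℝ × (Fin (m + 1) → ℝ) => s (proj m z.2))
      (univ ×ˢ (U : Set (Fin (m + 1) → ℝ))) :=
    hsp.comp contDiff_snd.contDiffOn fun z hz => hz.2
  have hx0 : ContDiff ℝ ∞ fun x : Fin (m + 1) → ℝ => x 0 := contDiff_apply ℝ ℝ 0
  have hseg : ContDiffOn ℝ ∞ seg (univ ×ˢ (U : Set (Fin (m + 1) → ℝ))) := by
    refine contDiff_cons (hsp2.add (contDiff_fst.contDiffOn.mul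
      ((hx0.comp contDiff_snd).contDiffOn.sub hsp2))) ?_
    exact (contDiff_proj.comp contDiff_snd).contDiffOn
  have hO : IsOpen ((univ ×ˢ (U : Set (Fin (m + 1) → ℝ))) ∩ seg ⁻¹' U) :=
    hseg.continuousOn.isOpen_inter_preimage (isOpen_univ.prod U.isOpen) U.isOpen
  have hFseg : ContDiffOn ℝ ∞ (fun z => F (seg z))
      ((univ ×ˢ (U : Set (Fin (m + 1) → ℝ))) ∩ seg ⁻¹' U) :=
    (contDiffOn_coe f).comp (hseg.mono inter_subset_left) fun z hz => hz.2
  have hmem : ∀ u ∈ base U, ∀ t ∈ fibre U u, ∀ r ∈ uIcc (s u) t, r ∈ fibre U u :=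
    fun u hu t ht r hr => (h.ordConnected u).uIcc_subset (hsU u hu) ht hr
  have hsmooth := contDiffOn_integral_unitInterval hO hFseg U.isOpen (by
    intro θ hθ x hx
    refine ⟨⟨mem_univ _, hx⟩, hmem _ (proj_mem_base hx) (x 0) ?_ _ ?_⟩
    · change Fin.cons (x 0) (proj m x) ∈ U
      rwa [cons_proj]
    · rw [← segment_eq_uIcc, segment_eq_image']
      exact ⟨θ, hθ, rfl⟩)
  -- This is the integral of f along the fibre from the section to x, rescaled to [0,1]. The fixed
  -- interval gives joint smoothness; undoing the substitution gives the t-derivative.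
  let G : (Fin (m + 1) → ℝ) → ℝ := fun x =>
    (x 0 - s (proj m x)) * ∫ θ in (0 : ℝ)..1, F (seg (θ, x))
  have hG : ContDiffOn ℝ ∞ G U := (hx0.contDiffOn.sub hsp).mul hsmooth
  let g : SmoothFun U := ⟨fun x => G x, contDiffOn_extendZero hG fun x => rfl⟩
  refine ⟨g, ?_⟩
  ext ⟨x, hx⟩
  obtain ⟨t, u, rfl⟩ : ∃ t u, x = Fin.cons t u := ⟨_, _, (cons_proj x).symm⟩
  have hu : u ∈ base U := mem_base_of_cons hx
  have hGint : ∀ r, G (Fin.cons r u) = ∫ τ in s u..r, F (Fin.cons τ u) := by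
    intro r
    simp only [G, seg, proj_cons, Fin.cons_zero]
    have := intervalIntegral.smul_integral_comp_add_mul
      (fun τ => F (Fin.cons τ u)) (a := 0) (b := 1) (r - s u) (s u)
    simp only [smul_eq_mul, mul_zero, add_zero, mul_one, add_sub_cancel] at this
    rw [← this]
    simp only [mul_comm]
  have hcont : ∀ r ∈ fibre U u, ContinuousAt (fun τ => F (Fin.cons τ u)) r :=
    fun r hr => (hasDerivAt_fibre f hr).continuousAt
  have hder : HasDerivAt (fun r => G (Fin.cons r u)) (F (Fin.cons t u)) t := by
    simp_rw [hGint]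
    refine intervalIntegral.integral_hasDerivAt_right ?_ ?_ (hcont t hx)
    · exact ContinuousOn.intervalIntegrable fun r hr =>
        (hcont r (hmem u hu t hx r hr)).continuousWithinAt
    · exact ContinuousAt.stronglyMeasurableAtFilter (isOpen_fibre u) hcont t hx
  have hder2 := hasDerivAt_fibre g hx
  have heq : (fun r => extendZero (g : U → ℝ) (Fin.cons r u)) =ᶠ[𝓝 t]
      fun r => G (Fin.cons r u) := by
    filter_upwards [(isOpen_fibre u).mem_nhds hx] with r hr
    exact extendZero_coe (g : U → ℝ) ⟨_, hr⟩
  have := (hder.congr_of_eventuallyEq heq).unique hder2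
  rw [← this]
  exact extendZero_coe (f : U → ℝ) ⟨_, hx⟩

/-- A function with vanishing `t`-derivative is constant along the fibres. -/
theorem ConnectedFibres.eq_of_partialDeriv_eq_zero (h : ConnectedFibres U) {f : SmoothFun U}
    (hf : partialDeriv U 0 f = 0) {u : Fin m → ℝ} {t t' : ℝ} (ht : t ∈ fibre U u)
    (ht' : t' ∈ fibre U u) :
    extendZero (f : U → ℝ) (Fin.cons t u) = extendZero (f : U → ℝ) (Fin.cons t' u) := by
  refine (h.ordConnected u).convex.is_const_of_fderivWithin_eq_zero (𝕜 := ℝ)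
    (f := fun r => extendZero (f : U → ℝ) (Fin.cons r u)) ?_ ?_ ht ht'
  · exact fun r hr => (hasDerivAt_fibre f hr).differentiableAt.differentiableWithinAt
  · intro r hr
    rw [fderivWithin_of_isOpen (isOpen_fibre u) hr]
    have := hasDerivAt_fibre f hr
    rw [hf] at this
    ext
    simpa using this.deriv

/-- The Euler operator `∑ j, u_j ∂/∂u_j` on functions. -/
def eulerOp (U : Opens (Fin (m + 1) → ℝ)) : SmoothFun U →ₗ[ℝ] SmoothFun U :=
  ∑ j : Fin m, LinearMap.mulLeft ℝ (coordFun U j.succ) ∘ₗ partialDeriv U j.succ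

theorem eulerOp_apply (f : SmoothFun U) :
    eulerOp U f = ∑ j : Fin m, coordFun U j.succ * partialDeriv U j.succ f := by
  simp [eulerOp]

theorem eulerOp_coe (f : SmoothFun U) (x : U) :
    (eulerOp U f : U → ℝ) x =
      ∑ j : Fin m, x.1 j.succ * (partialDeriv U j.succ f : U → ℝ) x := by
  rw [eulerOp_apply]
  simp [coordFun]

/-- Over a star-shaped base, `∑ j, u_j ∂/∂u_j + 1` is surjective on functions of `u`. -/
theorem ConnectedFibres.exists_eulerOp_add_self (h : ConnectedFibres U)
    (hstar : StarConvex ℝ 0 (base U : Set (Fin m → ℝ))) {f : SmoothFun U}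
    (hf : partialDeriv U 0 f = 0) :
    ∃ g : SmoothFun U, partialDeriv U 0 g = 0 ∧ eulerOp U g + g = f := by
  obtain ⟨s, hs, hsU⟩ := h.exists_section
  -- Since f is constant along fibres, restricting it to the section turns it into a smooth function
  -- on the base.
  let F : (Fin m → ℝ) → ℝ := fun u => extendZero (f : U → ℝ) (Fin.cons (s u) u)
  have hF : ContDiffOn ℝ ∞ F (base U) :=
    (contDiffOn_coe f).comp (contDiff_cons hs contDiffOn_id) hsU
  have hstar' : ∀ θ ∈ Icc (0 : ℝ) 1, ∀ u ∈ base U, θ • u ∈ base U :=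
    fun θ hθ u hu => hstar.smul_mem hu hθ.1 hθ.2
  have hscale : ContDiff ℝ ∞ fun z : ℝ × (Fin m → ℝ) => z.1 • z.2 :=
    contDiff_fst.smul contDiff_snd
  have hsmooth := contDiffOn_integral_unitInterval
    ((base U).isOpen.preimage hscale.continuous)
    (g := fun z : ℝ × (Fin m → ℝ) => F (z.1 • z.2))
    (hF.comp hscale.contDiffOn fun z hz => hz) (base U).isOpen
    (fun θ hθ u hu => hstar' θ hθ u hu)
  let G : (Fin m → ℝ) → ℝ := fun u => ∫ θ in (0 : ℝ)..1, F (θ • u)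
  have hG : ContDiffOn ℝ ∞ (fun x => G (proj m x)) U :=
    ContDiffOn.comp (g := G) hsmooth contDiff_proj.contDiffOn fun x hx => proj_mem_base hx
  let g : SmoothFun U := ⟨fun x => G (proj m x), contDiffOn_extendZero hG fun x => rfl⟩
  have hg : ∀ t u, t ∈ fibre U u → extendZero (g : U → ℝ) (Fin.cons t u) = G u := by
    intro t u ht
    rw [extendZero_coe (g : U → ℝ) ⟨_, ht⟩]
    change G (proj m (Fin.cons t u)) = _
    rw [proj_cons]
  refine ⟨g, ?_, ?_⟩
  · ext ⟨x, hx⟩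
    obtain ⟨t, u, rfl⟩ : ∃ t u, x = Fin.cons t u := ⟨_, _, (cons_proj x).symm⟩
    have heq : (fun r => extendZero (g : U → ℝ) (Fin.cons r u)) =ᶠ[𝓝 t] fun _ => G u := by
      filter_upwards [(isOpen_fibre u).mem_nhds hx] with r hr using hg r u hr
    exact (hasDerivAt_fibre g hx).unique ((hasDerivAt_const t (G u)).congr_of_eventuallyEq heq)
  · ext ⟨x, hx⟩
    obtain ⟨t, u, rfl⟩ : ∃ t u, x = Fin.cons t u := ⟨_, _, (cons_proj x).symm⟩
    have hu : u ∈ base U := mem_base_of_cons hx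
    have hx1 : t ∈ fibre U ((1 : ℝ) • u) := by simpa [fibre] using hx
    -- The derivative of r G(ru) at r = 1 is computed twice: it is F(u) by the fundamental theorem
    -- of calculus and G(u) + (E G)(u) by the product rule.
    have hint : ∀ r : ℝ, r * G (r • u) = ∫ τ in (0 : ℝ)..r, F (τ • u) := by
      intro r
      have := intervalIntegral.smul_integral_comp_mul_left
        (fun τ => F (τ • u)) (a := 0) (b := 1) r
      simp only [smul_eq_mul, mul_zero, mul_one] at this
      rw [← this]
      simp only [G, smul_smul, mul_comm]
    have hopen : IsOpen {τ : ℝ | τ • u ∈ base U} :=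
      (base U).isOpen.preimage (continuous_id.smul continuous_const)
    have hcont : ∀ τ ∈ {τ : ℝ | τ • u ∈ base U}, ContinuousAt (fun τ => F (τ • u)) τ := by
      intro τ hτ
      exact ContinuousAt.comp (f := fun τ : ℝ => τ • u)
        (hF.continuousOn.continuousAt ((base U).isOpen.mem_nhds hτ)) (by fun_prop)
    have h1 : HasDerivAt (fun r : ℝ => r * G (r • u)) (F ((1 : ℝ) • u)) 1 := by
      simp_rw [hint]
      refine intervalIntegral.integral_hasDerivAt_right ?_ ?_ (hcont 1 (by simpa using hu))
      · refine ContinuousOn.intervalIntegrable fun τ hτ => (hcont τ ?_).continuousWithinAt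
        rw [uIcc_of_le zero_le_one] at hτ
        exact hstar' τ hτ u hu
      · exact ContinuousAt.stronglyMeasurableAtFilter hopen hcont 1 (by simpa using hu)
    have h2 := (hasDerivAt_id (1 : ℝ)).mul (hasDerivAt_ray g hx1)
    have heq : (fun r : ℝ => r * G (r • u)) =ᶠ[𝓝 1]
        fun r => id r * extendZero (g : U → ℝ) (Fin.cons t (r • u)) := by
      have : IsOpen {r : ℝ | (Fin.cons t (r • u) : Fin (m + 1) → ℝ) ∈ U} :=
        U.isOpen.preimage (continuous_const.finCons (continuous_id.smul continuous_const))
      filter_upwards [this.mem_nhds hx1] with r hr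
      rw [hg t _ hr, id]
    have h3 := (h2.congr_of_eventuallyEq heq).unique h1
    have hFx : F ((1 : ℝ) • u) = (f : U → ℝ) ⟨_, hx⟩ := by
      rw [one_smul, ← extendZero_coe (f : U → ℝ) ⟨_, hx⟩]
      exact h.eq_of_partialDeriv_eq_zero hf (hsU u hu) hx
    rw [hFx] at h3
    rw [← h3]
    change (eulerOp U g : U → ℝ) _ + (g : U → ℝ) _ = _
    rw [eulerOp_coe, ← extendZero_coe (g : U → ℝ) ⟨_, hx⟩]
    simp [add_comm]

/-- Over a star-shaped base, a function of `u` killed by the Euler operator is constant. -/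
theorem ConnectedFibres.exists_eq_algebraMap (h : ConnectedFibres U)
    (hstar : StarConvex ℝ 0 (base U : Set (Fin m → ℝ))) {f : SmoothFun U}
    (hf : partialDeriv U 0 f = 0) (hE : eulerOp U f = 0) :
    ∃ c : ℝ, f = algebraMap ℝ (SmoothFun U) c := by
  obtain ⟨s, hs, hsU⟩ := h.exists_section
  let F : (Fin m → ℝ) → ℝ := fun u => extendZero (f : U → ℝ) (Fin.cons (s u) u)
  have hF : ContDiffOn ℝ ∞ F (base U) :=
    (contDiffOn_coe f).comp (contDiff_cons hs contDiffOn_id) hsU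
  refine ⟨F 0, ?_⟩
  ext ⟨x, hx⟩
  obtain ⟨t, u, rfl⟩ : ∃ t u, x = Fin.cons t u := ⟨_, _, (cons_proj x).symm⟩
  have hu : u ∈ base U := mem_base_of_cons hx
  have hmem : ∀ θ ∈ Icc (0 : ℝ) 1, θ • u ∈ base U := fun θ hθ => hstar.smul_mem hu hθ.1 hθ.2
  have hder : ∀ θ ∈ Ioo (0 : ℝ) 1, HasDerivAt (fun r : ℝ => F (r • u)) 0 θ := by
    intro θ hθ
    have hθu := hmem θ (Ioo_subset_Icc_self hθ)
    have hmemθ : s (θ • u) ∈ fibre U (θ • u) := hsU _ hθu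
    have hray := hasDerivAt_ray f hmemθ
    have hsum : ∑ j, u j * (partialDeriv U j.succ f : U → ℝ) ⟨_, hmemθ⟩ = 0 := by
      have := congrArg (fun k : SmoothFun U => (k : U → ℝ) ⟨_, hmemθ⟩) hE
      simp only [eulerOp_coe, Fin.cons_succ, Pi.smul_apply, smul_eq_mul, mul_assoc,
        ← Finset.mul_sum] at this
      exact (mul_eq_zero.1 this).resolve_left hθ.1.ne'
    rw [hsum] at hray
    -- Freezing the t-coordinate at s(θu) is allowed because f is constant along fibres; the
    -- derivative of the section never enters.
    refine hray.congr_of_eventuallyEq ?_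
    have hopen : IsOpen {r : ℝ | (Fin.cons (s (θ • u)) (r • u) : Fin (m + 1) → ℝ) ∈ U} :=
      U.isOpen.preimage (continuous_const.finCons (continuous_id.smul continuous_const))
    filter_upwards [hopen.mem_nhds hmemθ] with r hr
    exact h.eq_of_partialDeriv_eq_zero hf (hsU _ (mem_base_of_cons hr)) hr
  have hcont : ContinuousOn (fun r : ℝ => F (r • u)) (Icc 0 1) :=
    hF.continuousOn.comp (by fun_prop) hmem
  obtain ⟨c, hc, hc'⟩ := exists_hasDerivAt_eq_slope (fun r : ℝ => F (r • u)) (fun _ => 0)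
    zero_lt_one hcont hder
  have hF01 : F u = F 0 := by
    simp only [one_smul, zero_smul, sub_zero, div_one] at hc'
    linarith
  change (f : U → ℝ) ⟨_, hx⟩ = F 0
  rw [← hF01, ← extendZero_coe (f : U → ℝ) ⟨_, hx⟩]
  exact h.eq_of_partialDeriv_eq_zero hf hx (hsU u hu)

end Primitives

/-! ### Homogeneous polynomials and the Euler operator -/

/-- An algebra of functions of `(t, u_1, …, u_m)`, with commuting derivations `∂/∂t = der 0` and
`∂/∂u_j = der j.succ`, in which the equations `∂f/∂t = g` and `(E + 1) f = g` can be solved, where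
`E = ∑ j, u_j ∂/∂u_j`. -/
structure BookAlgebra (m : ℕ) (A : Type*) [CommRing A] [Algebra ℝ A] where
  /-- The partial derivatives. -/
  der : Fin (m + 1) → Derivation ℝ A A
  /-- The coordinate functions `u_j`. -/
  coord : Fin m → A
  der_comm : ∀ i j f, der i (der j f) = der j (der i f)
  der_zero_coord : ∀ j, der 0 (coord j) = 0
  der_succ_coord : ∀ i j, der (Fin.succ i) (coord j) = if i = j then 1 else 0
  der_zero_surjective : Function.Surjective (der 0)
  exists_euler_add_self : ∀ f, der 0 f = 0 →
    ∃ g, der 0 g = 0 ∧ (∑ j, coord j * der (Fin.succ j) g) + g = f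
  exists_eq_algebraMap : ∀ f, der 0 f = 0 → ∑ j, coord j * der (Fin.succ j) f = 0 →
    ∃ c : ℝ, f = algebraMap ℝ A c
  eq_zero_of_euler_eq : ∀ f (c : ℝ), ∑ j, coord j * der (Fin.succ j) f = algebraMap ℝ A c → c = 0
  aeval_coord_injective : Function.Injective (MvPolynomial.aeval (R := ℝ) coord)

namespace BookAlgebra

variable {m : ℕ} {A : Type*} [CommRing A] [Algebra ℝ A] (S : BookAlgebra m A)

/-- The monomial `u_I`. -/
def monomial (I : Multiset (Fin m)) : A := (I.map S.coord).prod

@[simp]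
theorem monomial_zero : S.monomial 0 = 1 := by simp [monomial]

@[simp]
theorem monomial_cons (i : Fin m) (I : Multiset (Fin m)) :
    S.monomial (i ::ₘ I) = S.coord i * S.monomial I := by simp [monomial]

/-- The Euler operator `E = ∑ j, u_j ∂/∂u_j`. -/
def euler : Derivation ℝ A A := ∑ j : Fin m, S.coord j • S.der j.succ

theorem euler_apply (f : A) : S.euler f = ∑ j : Fin m, S.coord j * S.der j.succ f := by
  have := map_sum (Derivation.coeFnAddMonoidHom (R := ℝ) (A := A) (M := A))
    (fun j : Fin m => S.coord j • S.der j.succ) Finset.univ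
  refine (congrFun this f).trans ?_
  rw [Finset.sum_apply]
  rfl

/-- Homogeneous polynomials of degree `r` in `u`. -/
def homogeneous (r : ℕ) : Submodule ℝ A :=
  Submodule.span ℝ (S.monomial '' {I | I.card = r})

theorem monomial_mem (I : Multiset (Fin m)) : S.monomial I ∈ S.homogeneous I.card :=
  Submodule.subset_span ⟨I, rfl, rfl⟩

theorem homogeneous_zero : S.homogeneous 0 = Submodule.span ℝ {1} := by
  have : {I : Multiset (Fin m) | I.card = 0} = {0} := by
    ext I; simp
  rw [homogeneous, this, Set.image_singleton, monomial_zero]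

theorem algebraMap_mem_homogeneous (c : ℝ) : algebraMap ℝ A c ∈ S.homogeneous 0 := by
  rw [homogeneous_zero, Algebra.algebraMap_eq_smul_one]
  exact Submodule.smul_mem _ c (Submodule.mem_span_singleton_self 1)

theorem coord_mul_mem_homogeneous (j : Fin m) {r : ℕ} {f : A} (hf : f ∈ S.homogeneous r) :
    S.coord j * f ∈ S.homogeneous (r + 1) := by
  have : S.homogeneous r ≤ (S.homogeneous (r + 1)).comap (LinearMap.mulLeft ℝ (S.coord j)) := by
    refine Submodule.span_le.2 ?_
    rintro _ ⟨I, rfl, rfl⟩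
    change S.coord j * S.monomial I ∈ S.homogeneous (I.card + 1)
    rw [← monomial_cons, ← Multiset.card_cons j I]
    exact S.monomial_mem _
  exact this hf

theorem der_zero_of_mem_homogeneous {r : ℕ} {f : A} (hf : f ∈ S.homogeneous r) :
    S.der 0 f = 0 := by
  have : S.homogeneous r ≤ LinearMap.ker (S.der 0 : A →ₗ[ℝ] A) := by
    refine Submodule.span_le.2 ?_
    rintro _ ⟨I, -, rfl⟩
    change S.der 0 (S.monomial I) = 0
    induction I using Multiset.induction with
    | empty => simp
    | cons i I ih => simp [ih, der_zero_coord]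
  exact this hf

theorem der_succ_mem_homogeneous (j : Fin m) {r : ℕ} {f : A} (hf : f ∈ S.homogeneous (r + 1)) :
    S.der j.succ f ∈ S.homogeneous r := by
  have : S.homogeneous (r + 1) ≤ (S.homogeneous r).comap (S.der j.succ : A →ₗ[ℝ] A) := by
    refine Submodule.span_le.2 ?_
    rintro _ ⟨I, hI, rfl⟩
    change S.der j.succ (S.monomial I) ∈ S.homogeneous r
    clear hf
    induction I using Multiset.induction generalizing r with
    | empty => simp at hI
    | cons i I ih =>
      simp only [Set.mem_ofPred_eq, Multiset.card_cons, add_left_inj] at hI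
      rw [monomial_cons, Derivation.leibniz, der_succ_coord, smul_eq_mul, smul_eq_mul]
      refine Submodule.add_mem _ ?_ ?_
      · cases r with
        | zero => simp [Multiset.card_eq_zero.1 hI]
        | succ r => exact S.coord_mul_mem_homogeneous i (ih hI)
      · split_ifs
        · rw [mul_one, ← hI]; exact S.monomial_mem I
        · simp
  exact this hf

theorem euler_coord (j : Fin m) : S.euler (S.coord j) = S.coord j := by
  simp [euler_apply, der_succ_coord]

theorem euler_of_mem_homogeneous {r : ℕ} {f : A} (hf : f ∈ S.homogeneous r) :
    S.euler f = (r : ℝ) • f := by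
  have : S.homogeneous r ≤ LinearMap.ker ((S.euler : A →ₗ[ℝ] A) - (r : ℝ) • LinearMap.id) := by
    refine Submodule.span_le.2 ?_
    rintro _ ⟨I, rfl, rfl⟩
    clear hf
    change S.euler (S.monomial I) - (I.card : ℝ) • S.monomial I = 0
    rw [sub_eq_zero]
    induction I using Multiset.induction with
    | empty => simp
    | cons i I ih =>
      rw [monomial_cons, Derivation.leibniz, ih, euler_coord, smul_eq_mul, smul_eq_mul,
        mul_smul_comm, Multiset.card_cons, Nat.cast_add, Nat.cast_one, add_smul, one_smul, mul_comm]
  simpa [sub_eq_zero] using this hf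

/-- The Euler operator and `∂/∂u_j` satisfy `∂_j E = E ∂_j + ∂_j`. -/
theorem der_succ_euler (j : Fin m) (f : A) :
    S.der j.succ (S.euler f) = S.euler (S.der j.succ f) + S.der j.succ f := by
  simp only [euler_apply, map_sum, Derivation.leibniz, der_succ_coord, smul_eq_mul,
    Finset.sum_add_distrib, S.der_comm j.succ]
  simp

/-- A function of `u` satisfying Euler's equation of degree `r` is a homogeneous polynomial. -/
theorem mem_homogeneous {r : ℕ} {f : A} (hf : S.der 0 f = 0) (hE : S.euler f = (r : ℝ) • f) :
    f ∈ S.homogeneous r := by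
  induction r generalizing f with
  | zero =>
    obtain ⟨c, rfl⟩ := S.exists_eq_algebraMap f hf (by rw [← euler_apply, hE]; simp)
    exact S.algebraMap_mem_homogeneous c
  | succ r ih =>
    -- Here (r + 1) f = E f = ∑ u_j ∂_j f, and each ∂_j f satisfies Euler's equation of degree r by
    -- `der_succ_euler`. It remains to divide by r + 1.
    have hmem : S.euler f ∈ S.homogeneous (r + 1) := by
      rw [euler_apply]
      refine Submodule.sum_mem _ fun j _ => S.coord_mul_mem_homogeneous j (ih ?_ ?_)
      · rw [S.der_comm, hf, map_zero]
      · have := S.der_succ_euler j f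
        rw [hE, Derivation.map_smul, Nat.cast_add, Nat.cast_one, add_smul, one_smul,
          add_left_inj] at this
        exact this.symm
    rw [hE] at hmem
    exact (Submodule.smul_mem_iff _ (by positivity)).1 hmem

/-- Hadamard's lemma. -/
theorem exists_eq_add_sum (f : A) (hf : S.der 0 f = 0) :
    ∃ c : ℝ, ∃ g : Fin m → A, (∀ j, S.der 0 (g j) = 0) ∧
      f = algebraMap ℝ A c + ∑ j, S.coord j * g j := by
  have hd : ∀ j : Fin m, S.der 0 (S.der j.succ f) = 0 := fun j => by
    rw [S.der_comm, hf, map_zero]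
  -- With (E + 1) g_j = ∂_j f one has E(u_j g_j) = u_j ∂_j f, so E kills f - ∑ u_j g_j, which is
  -- therefore constant.
  choose g hg0 hg using fun j => S.exists_euler_add_self _ (hd j)
  obtain ⟨c, hc⟩ := S.exists_eq_algebraMap (f - ∑ j, S.coord j * g j)
    (by simp [hf, hg0, der_zero_coord]) (by
      rw [← euler_apply, map_sub, map_sum, euler_apply, sub_eq_zero]
      refine Finset.sum_congr rfl fun j _ => ?_
      rw [Derivation.leibniz, euler_coord, ← hg j, ← euler_apply, smul_eq_mul, smul_eq_mul]
      ring)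
  exact ⟨c, g, hg0, by rw [← hc]; ring⟩

/-- A function of `u` is a homogeneous polynomial of degree `r` up to the image of `E - r`. -/
theorem exists_homogeneous_add (r : ℕ) (f : A) (hf : S.der 0 f = 0) :
    ∃ p ∈ S.homogeneous r, ∃ g : A, S.der 0 g = 0 ∧ f = p + (S.euler g - (r : ℝ) • g) := by
  have hD : ∀ g : Fin m → A, (∀ j, S.der 0 (g j) = 0) →
      S.der 0 (∑ j, S.coord j * g j) = 0 := fun g hg => by
    simp [hg, der_zero_coord]
  induction r generalizing f with
  | zero =>
    obtain ⟨c, g, hg0, hg⟩ := S.exists_eq_add_sum f hf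
    choose k hk0 hk using fun j => S.exists_euler_add_self _ (hg0 j)
    refine ⟨_, S.algebraMap_mem_homogeneous c, _, hD k hk0, ?_⟩
    rw [Nat.cast_zero, zero_smul, sub_zero, hg, map_sum]
    congr 1
    refine Finset.sum_congr rfl fun j _ => ?_
    rw [Derivation.leibniz, euler_coord, ← hk j, ← euler_apply, smul_eq_mul, smul_eq_mul]
    ring
  | succ r ih =>
    obtain ⟨c, g, hg0, hg⟩ := S.exists_eq_add_sum f hf
    choose p hp k hk0 hk using fun j => ih (g j) (hg0 j)
    -- The step rests on (E - (r + 1))(u_j k) = u_j (E - r) k. The constant term c is itself in the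
    -- image, being E - (r + 1) applied to -c / (r + 1).
    refine ⟨∑ j, S.coord j * p j,
      Submodule.sum_mem _ fun j _ => S.coord_mul_mem_homogeneous j (hp j),
      algebraMap ℝ A (-c / ((r + 1 : ℕ) : ℝ)) + ∑ j, S.coord j * k j, ?_, ?_⟩
    · rw [map_add, hD k hk0, Derivation.map_algebraMap, add_zero]
    · have hc : ((r + 1 : ℕ) : ℝ) • algebraMap ℝ A (-c / ((r + 1 : ℕ) : ℝ)) =
          - algebraMap ℝ A c := by
        rw [Algebra.smul_def, ← map_mul, ← map_neg]
        congr 1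
        field_simp
      rw [smul_add, hc, map_add, Derivation.map_algebraMap, map_sum, Finset.smul_sum, zero_add,
        sub_add_eq_sub_sub, sub_neg_eq_add, hg]
      have hsum : ∑ j, S.coord j * g j = ∑ j, S.coord j * p j +
          (∑ j, S.euler (S.coord j * k j) - ∑ j, ((r + 1 : ℕ) : ℝ) • (S.coord j * k j)) := by
        rw [← Finset.sum_sub_distrib, ← Finset.sum_add_distrib]
        refine Finset.sum_congr rfl fun j _ => ?_
        rw [hk j, Derivation.leibniz, euler_coord, smul_eq_mul, smul_eq_mul, Nat.cast_add,
          Nat.cast_one, add_smul, one_smul, mul_add, mul_sub, mul_smul_comm, mul_comm (k j)]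
        abel
      rw [hsum]
      abel

/-- The image of `E - r` contains no nonzero homogeneous polynomial of degree `r`. -/
theorem eq_zero_of_euler_sub_eq {r : ℕ} {g q : A} (hq : q ∈ S.homogeneous r)
    (hg : S.euler g - (r : ℝ) • g = q) : q = 0 := by
  induction r generalizing g q with
  | zero =>
    rw [homogeneous_zero] at hq
    obtain ⟨c, rfl⟩ := Submodule.mem_span_singleton.1 hq
    have := S.eq_zero_of_euler_eq g c (by
      rw [← euler_apply, Algebra.algebraMap_eq_smul_one, ← hg]; simp)
    rw [this, zero_smul]
  | succ r ih =>
    -- Applying ∂_j to the equation lowers r + 1 to r, so by induction all ∂_j q vanish. Then (r +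
    -- 1) q = E q = 0.
    have hd : ∀ j : Fin m, S.der j.succ q = 0 := fun j => by
      refine ih (S.der_succ_mem_homogeneous j hq) (g := S.der j.succ g) ?_
      rw [← hg, map_sub, Derivation.map_smul, der_succ_euler, Nat.cast_add, Nat.cast_one, add_smul,
        one_smul]
      abel
    have hE := S.euler_of_mem_homogeneous hq
    simp only [euler_apply, hd, mul_zero, Finset.sum_const_zero] at hE
    exact (smul_eq_zero.1 hE.symm).resolve_left (by positivity)

/-- The u_I are the images of the monomial basis of `MvPolynomial` under an injective map, with
multisets in place of exponent vectors. -/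
theorem linearIndependent_monomial : LinearIndependent ℝ S.monomial := by
  have h := (MvPolynomial.basisMonomials (Fin m) ℝ).linearIndependent.map'
    (MvPolynomial.aeval (R := ℝ) S.coord).toLinearMap
    (LinearMap.ker_eq_bot.2 S.aeval_coord_injective)
  have h2 := h.comp (Multiset.toFinsupp : Multiset (Fin m) ≃+ (Fin m →₀ ℕ))
    Multiset.toFinsupp.injective
  refine (funext fun I => ?_ : _ = S.monomial) ▸ h2
  simp only [Function.comp_apply, MvPolynomial.coe_basisMonomials, AlgHom.toLinearMap_apply,
    MvPolynomial.aeval_monomial, map_one, one_mul, monomial]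
  rw [Finsupp.prod, Multiset.toFinsupp_support, Finset.prod_multiset_map_count]
  simp

end BookAlgebra

/-! ### The exterior algebra of a free module -/

section Basis

variable {d : ℕ} {A : Type*} [CommRing A]

/-- The exterior algebra of the free module with basis `∂_1, …, ∂_d`. -/
abbrev FreeExt (A : Type*) [CommRing A] (d : ℕ) : Type _ := ExteriorAlgebra A (Fin d → A)

/-- The generator `∂_i` of the exterior algebra. -/
def gen (A : Type*) [CommRing A] {d : ℕ} (i : Fin d) : FreeExt A d :=
  ExteriorAlgebra.ι A (Pi.single i 1)

/-- The basis of the exterior algebra given by the products `∂_J`. -/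
def genBasis (A : Type*) [CommRing A] (d : ℕ) : Module.Basis (Finset (Fin d)) A (FreeExt A d) :=
  (Pi.basisFun A (Fin d)).ExteriorAlgebra

theorem genBasis_singleton (i : Fin d) : genBasis A d {i} = gen A i := by
  rw [genBasis, ExteriorAlgebra.basis_apply_ofCard (n := 1) _ (Finset.card_singleton i)]
  simp only [ExteriorAlgebra.ιMulti_family, ExteriorAlgebra.ιMulti_apply, List.ofFn_succ,
    List.ofFn_zero, List.prod_cons, List.prod_nil, mul_one]
  rw [gen]
  congr 1
  simp only [Function.comp_apply, Pi.basisFun_apply]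
  congr 1
  have := (Set.powersetCard.mem_range_ofFinEmbEquiv_symm_iff_mem
    (Set.powersetCard.ofCard (Finset.card_singleton i)) _).1
    ⟨0, rfl⟩
  exact Finset.mem_singleton.1 this

theorem genBasis_empty : genBasis A d ∅ = 1 := by
  rw [genBasis, ExteriorAlgebra.basis_apply_ofCard (n := 0) _ Finset.card_empty]
  simp [ExteriorAlgebra.ιMulti_family, ExteriorAlgebra.ιMulti_apply]

theorem gen_mul_genBasis_of_mem {i : Fin d} {J : Finset (Fin d)} (h : i ∈ J) :
    gen A i * genBasis A d J = 0 := by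
  rw [← genBasis_singleton]
  exact ExteriorAlgebra.basis_mul_of_not_disjoint (Pi.basisFun (A) (Fin d))
    (Set.powersetCard.ofCard (Finset.card_singleton i)) (Set.powersetCard.ofCard (s := J) rfl)
    (by simpa using h)

theorem genBasis_eq_prod (J : Finset (Fin d)) :
    genBasis A d J = (J.sort.map (gen A)).prod := by
  rw [genBasis, ExteriorAlgebra.basis_apply_ofCard (n := J.card) _ rfl,
    ← Finset.listMap_orderEmbOfFin_finRange J rfl, List.map_map]
  rw [ExteriorAlgebra.ιMulti_family, ExteriorAlgebra.ιMulti_apply, List.ofFn_eq_map]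
  congr 1
  refine List.map_congr_left fun i _ => ?_
  simp only [Function.comp_apply, Pi.basisFun_apply, gen]
  rfl

variable [Algebra ℝ A]

/-- The actual sign is never needed, only its invertibility, so it is recorded as a real number of
square one. -/
theorem gen_mul_genBasis {i : Fin d} {J : Finset (Fin d)} (h : i ∉ J) :
    ∃ ε : ℝ, ε * ε = 1 ∧ gen A i * genBasis A d J = ε • genBasis A d (insert i J) := by
  have hd : Disjoint (Set.powersetCard.ofCard (Finset.card_singleton i)).val
      (Set.powersetCard.ofCard (s := J) rfl).val := by simpa using h
  have := ExteriorAlgebra.basis_mul_of_disjoint (Pi.basisFun (A) (Fin d)) _ _ hd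
  have hu : ((Set.powersetCard.disjUnion hd : Set.powersetCard (Fin d) (1 + J.card)) :
      Finset (Fin d)) = insert i J := by
    simp [Set.powersetCard.disjUnion]
  rw [hu] at this
  rw [← genBasis_singleton]
  rcases Int.units_eq_one_or (Equiv.Perm.sign (Set.powersetCard.permOfDisjoint hd)) with hs | hs
  · refine ⟨1, by norm_num, ?_⟩
    rw [hs, one_smul] at this
    rw [one_smul]
    exact this
  · refine ⟨-1, by norm_num, ?_⟩
    rw [hs] at this
    rw [neg_smul, one_smul]
    refine Eq.trans this ?_
    rw [Units.neg_smul, one_smul]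
    rfl

theorem exists_genBasis_insert {i : Fin d} {J : Finset (Fin d)} (h : i ∉ J) :
    ∃ ε : ℝ, ε * ε = 1 ∧ genBasis A d (insert i J) = ε • (gen A i * genBasis A d J) := by
  obtain ⟨ε, hε, he⟩ := gen_mul_genBasis (A := A) h
  exact ⟨ε, hε, by rw [he, smul_smul, hε, one_smul]⟩

end Basis

/-! ### Operators on the exterior algebra -/

section Operators

variable {d : ℕ} {A : Type*} [CommRing A] [Algebra ℝ A]

/-- The elements of degree `k`. -/
def extDegree (A : Type*) [CommRing A] [Algebra ℝ A] (d k : ℕ) : Submodule ℝ (FreeExt A d) :=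
  (⋀[A]^k (Fin d → A)).restrictScalars ℝ

/-- Two `ℝ`-linear maps which agree on the multivector fields `f ∂_J` are equal. -/
theorem linearMap_ext_basis {V : Type*} [AddCommGroup V] [Module ℝ V]
    {φ ψ : FreeExt A d →ₗ[ℝ] V}
    (h : ∀ (f : A) (J : Finset (Fin d)), φ (f • genBasis A d J) =
      ψ (f • genBasis A d J)) : φ = ψ := by
  ext μ
  rw [← (genBasis A d).sum_repr μ, map_sum, map_sum]
  exact Finset.sum_congr rfl fun J _ => h _ J

/-- The exterior product with `∂/∂x_i`. -/
def wedge (A : Type*) [CommRing A] [Algebra ℝ A] {d : ℕ} (i : Fin d) : Module.End ℝ (FreeExt A d) :=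
  LinearMap.mulLeft ℝ (gen A i)

/-- The contraction with `dx_i`. -/
def contr (A : Type*) [CommRing A] [Algebra ℝ A] {d : ℕ} (i : Fin d) : Module.End ℝ (FreeExt A d) :=
  (CliffordAlgebra.contractLeft (LinearMap.proj i : (Fin d → A) →ₗ[A] A)).restrictScalars ℝ

/-- The multiplication by a function. -/
def scale (d : ℕ) (f : A) : Module.End ℝ (FreeExt A d) :=
  (LinearMap.lsmul (A) (FreeExt A d) f).restrictScalars ℝ

/-- A derivation applied to the coefficients with respect to the basis `∂_J`. -/
def coeffD (d : ℕ) (D : Derivation ℝ A A) : Module.End ℝ (FreeExt A d) where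
  toFun μ := ∑ J : Finset (Fin d), D ((genBasis A d).repr μ J) • genBasis A d J
  map_add' μ ν := by simp [add_smul, Finset.sum_add_distrib]
  map_smul' c μ := by
    have h : (genBasis A d).repr (c • μ) = c • (genBasis A d).repr μ :=
      ((genBasis A d).repr.toLinearMap.restrictScalars ℝ).map_smul c μ
    simp [h, Finset.smul_sum]

theorem wedge_apply (i : Fin d) (μ : FreeExt A d) : wedge A i μ = gen A i * μ := rfl

theorem contr_apply (i : Fin d) (μ : FreeExt A d) :
    contr A i μ = CliffordAlgebra.contractLeft (LinearMap.proj i : (Fin d → A) →ₗ[A] A) μ := rfl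

theorem scale_apply (f : A) (μ : FreeExt A d) : scale d f μ = f • μ := rfl

theorem wedge_smul (i : Fin d) (f : A) (μ : FreeExt A d) :
    wedge A i (f • μ) = f • wedge A i μ := mul_smul_comm f _ μ

theorem contr_smul (i : Fin d) (f : A) (μ : FreeExt A d) :
    contr A i (f • μ) = f • contr A i μ :=
  (CliffordAlgebra.contractLeft (LinearMap.proj i : (Fin d → A) →ₗ[A] A)).map_smul f μ

theorem coeffD_smul_basis (D : Derivation ℝ A A) (f : A) (J : Finset (Fin d)) :
    coeffD d D (f • genBasis A d J) = D f • genBasis A d J := by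
  change ∑ K : Finset (Fin d), D ((genBasis A d).repr (f • genBasis A d J) K) •
    genBasis A d K = _
  rw [Finset.sum_eq_single J]
  · rw [map_smul, Module.Basis.repr_self, Finsupp.smul_single, Finsupp.single_eq_same, smul_eq_mul,
      mul_one]
  · intro K _ hK
    rw [map_smul, Module.Basis.repr_self, Finsupp.smul_single, Finsupp.single_eq_of_ne hK, map_zero,
      zero_smul]
  · exact fun h => absurd (Finset.mem_univ J) h

theorem coeffD_basis (D : Derivation ℝ A A) (J : Finset (Fin d)) :
    coeffD d D (genBasis A d J) = 0 := by
  have := coeffD_smul_basis D (1 : A) J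
  rwa [one_smul, Derivation.map_one_eq_zero, zero_smul] at this

theorem coeffD_smul (D : Derivation ℝ A A) (f : A) (μ : FreeExt A d) :
    coeffD d D (f • μ) = D f • μ + f • coeffD d D μ := by
  have : coeffD d D ∘ₗ scale d f = scale d (D f) + scale d f ∘ₗ coeffD d D := by
    refine linearMap_ext_basis fun g J => ?_
    simp only [LinearMap.comp_apply, LinearMap.add_apply, scale_apply, coeffD_smul_basis,
      smul_smul, Derivation.leibniz, add_smul, smul_eq_mul]
    rw [add_comm, mul_comm g]
  exact LinearMap.congr_fun this μ

theorem coeffD_mul_scale (D : Derivation ℝ A A) (f : A) :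
    coeffD d D * scale d f = scale d f * coeffD d D + scale d (D f) := by
  refine LinearMap.ext fun μ => ?_
  simp only [Module.End.mul_apply, LinearMap.add_apply, scale_apply, coeffD_smul]
  exact add_comm _ _

theorem coeffD_comm {D D' : Derivation ℝ A A} (h : ∀ f, D (D' f) = D' (D f)) :
    coeffD d D * coeffD d D' = coeffD d D' * coeffD d D := by
  refine linearMap_ext_basis fun f J => ?_
  simp only [Module.End.mul_apply, coeffD_smul_basis, h]

theorem wedge_mul_scale (i : Fin d) (f : A) :
    wedge A i * scale d f = scale d f * wedge A i :=
  LinearMap.ext fun μ => wedge_smul i f μ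

theorem contr_mul_scale (i : Fin d) (f : A) :
    contr A i * scale d f = scale d f * contr A i :=
  LinearMap.ext fun μ => contr_smul i f μ

theorem scale_mul_scale (f g : A) : scale d f * scale d g = scale d (f * g) :=
  LinearMap.ext fun μ => smul_smul f g μ

theorem scale_comm (f g : A) : scale d f * scale d g = scale d g * scale d f := by
  rw [scale_mul_scale, scale_mul_scale, mul_comm]

theorem wedge_wedge (i j : Fin d) : wedge A i * wedge A j = -(wedge A j * wedge A i) := by
  refine LinearMap.ext fun μ => ?_
  simp only [Module.End.mul_apply, LinearMap.neg_apply, wedge_apply, ← mul_assoc]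
  rw [← neg_mul]
  congr 1
  exact eq_neg_of_add_eq_zero_left (ExteriorAlgebra.ι_add_mul_swap (R := A)
    (Pi.single i 1 : Fin d → A) (Pi.single j 1))

theorem wedge_self (i : Fin d) : wedge A i * wedge A i = 0 := by
  refine LinearMap.ext fun μ => ?_
  simp only [Module.End.mul_apply, wedge_apply, ← mul_assoc]
  have : gen A i * gen A i = 0 := ExteriorAlgebra.ι_sq_zero (R := A) _
  rw [this, zero_mul]
  rfl

theorem contr_contr (i j : Fin d) : contr A i * contr A j = -(contr A j * contr A i) :=
  LinearMap.ext fun μ => CliffordAlgebra.contractLeft_comm (Q := (0 : QuadraticForm A (Fin d → A))) _ _ μ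

theorem contr_self (i : Fin d) : contr A i * contr A i = 0 :=
  LinearMap.ext fun μ => CliffordAlgebra.contractLeft_contractLeft
    (Q := (0 : QuadraticForm A (Fin d → A))) _ μ

theorem contr_wedge (i j : Fin d) :
    contr A i * wedge A j = (if i = j then 1 else 0) - wedge A j * contr A i := by
  refine LinearMap.ext fun μ => ?_
  have h := CliffordAlgebra.contractLeft_ι_mul (Q := (0 : QuadraticForm (A)
    (Fin d → A))) (d := (LinearMap.proj i : (Fin d → A) →ₗ[A] A)) (Pi.single j 1 : Fin d → A) μ
  have hd : (LinearMap.proj i : (Fin d → A) →ₗ[A] A) (Pi.single j 1 : Fin d → A) = if i = j then 1 else 0 := by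
    change (Pi.single j 1 : Fin d → A) i = _
    rw [Pi.single_apply]
  rw [hd] at h
  refine h.trans ?_
  by_cases hij : i = j
  · simp only [if_pos hij, one_smul]; rfl
  · simp only [if_neg hij, zero_smul]; rfl

theorem contr_basis_of_notMem {i : Fin d} {J : Finset (Fin d)} (h : i ∉ J) :
    contr A i (genBasis A d J) = 0 := by
  induction J using Finset.induction with
  | empty =>
    rw [genBasis_empty, contr_apply]
    exact CliffordAlgebra.contractLeft_one (Q := (0 : QuadraticForm A (Fin d → A))) _
  | insert j J hj ih =>
    rw [Finset.mem_insert, not_or] at h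
    obtain ⟨ε, -, he⟩ := exists_genBasis_insert (A := A) hj
    have := LinearMap.congr_fun (contr_wedge (A := A) i j) (genBasis A d J)
    rw [if_neg h.1, zero_sub, LinearMap.neg_apply, Module.End.mul_apply, Module.End.mul_apply,
      ih h.2, map_zero, neg_zero, wedge_apply] at this
    rw [he, map_smul, this, smul_zero]

theorem exists_contr_basis {i : Fin d} {J : Finset (Fin d)} (h : i ∈ J) :
    ∃ ε : ℝ, contr A i (genBasis A d J) = ε • genBasis A d (J.erase i) := by
  obtain ⟨ε, -, he⟩ := exists_genBasis_insert (A := A) (Finset.notMem_erase i J)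
  rw [Finset.insert_erase h] at he
  refine ⟨ε, ?_⟩
  have := LinearMap.congr_fun (contr_wedge (A := A) i i) (genBasis A d (J.erase i))
  rw [if_pos rfl, LinearMap.sub_apply, Module.End.mul_apply, Module.End.mul_apply,
    contr_basis_of_notMem (Finset.notMem_erase i J), map_zero, sub_zero, wedge_apply] at this
  rw [he, map_smul, this]
  rfl

/-- Wedging after contracting is the projection onto the components containing ∂_i. Summed over the
u-directions, these projections count factors. -/
theorem wedge_contr_basis (i : Fin d) (J : Finset (Fin d)) :
    wedge A i (contr A i (genBasis A d J)) = if i ∈ J then genBasis A d J else 0 := by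
  split_ifs with h
  · have := LinearMap.congr_fun (contr_wedge (A := A) i i) (genBasis A d J)
    rw [if_pos rfl, LinearMap.sub_apply, Module.End.mul_apply, Module.End.mul_apply,
      wedge_apply i (genBasis A d J), gen_mul_genBasis_of_mem h, map_zero] at this
    exact (sub_eq_zero.1 this.symm).symm
  · rw [contr_basis_of_notMem h, map_zero]

/-- The wedge with ∂_j has constant coefficients in the basis ∂_J, so differentiating coefficients
commutes with it. -/
theorem coeffD_wedge (D : Derivation ℝ A A) (j : Fin d) : coeffD d D * wedge A j = wedge A j * coeffD d D := by
  refine linearMap_ext_basis fun f J => ?_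
  simp only [Module.End.mul_apply, wedge_smul, coeffD_smul, coeffD_basis, smul_zero, add_zero]
  have : coeffD d D (wedge A j (genBasis A d J)) = 0 := by
    rw [wedge_apply]
    by_cases h : j ∈ J
    · rw [gen_mul_genBasis_of_mem h, map_zero]
    · obtain ⟨ε, -, he⟩ := gen_mul_genBasis (A := A) h
      rw [he, map_smul, coeffD_basis, smul_zero]
  rw [this, smul_zero, add_zero]

theorem coeffD_contr (D : Derivation ℝ A A) (j : Fin d) : coeffD d D * contr A j = contr A j * coeffD d D := by
  refine linearMap_ext_basis fun f J => ?_
  simp only [Module.End.mul_apply, contr_smul, coeffD_smul, coeffD_basis, smul_zero, add_zero]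
  have : coeffD d D (contr A j (genBasis A d J)) = 0 := by
    by_cases h : j ∈ J
    · obtain ⟨ε, he⟩ := exists_contr_basis (A := A) h
      rw [he, map_smul, coeffD_basis, smul_zero]
    · rw [contr_basis_of_notMem h, map_zero]
  rw [this, smul_zero, add_zero]

/-! ### Degrees -/

theorem genBasis_mem (J : Finset (Fin d)) : genBasis A d J ∈ extDegree A d J.card := by
  have := ExteriorAlgebra.basis_eq_coe_basis (Pi.basisFun (A) (Fin d))
    (Set.powersetCard.ofCard (s := J) rfl)
  rw [genBasis]
  refine Eq.subst (motive := fun x => x ∈ extDegree A d J.card) this.symm ?_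
  exact Subtype.property _

theorem smul_mem_extDegree {k : ℕ} (f : A) {μ : FreeExt A d}
    (h : μ ∈ extDegree A d k) : f • μ ∈ extDegree A d k :=
  Submodule.smul_mem (⋀[A]^k (Fin d → A)) f h

theorem mem_span_of_mem_extDegree {k : ℕ} {μ : FreeExt A d} (h : μ ∈ extDegree A d k) :
    μ ∈ Submodule.span (A) (genBasis A d '' {J | J.card = k}) := by
  let b := (Pi.basisFun (A) (Fin d)).exteriorPower k
  have hμ := congrArg (Subtype.val : ⋀[A]^k (Fin d → A) → FreeExt A d)
    (b.sum_repr ⟨μ, h⟩)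
  rw [Submodule.coe_sum] at hμ
  change _ = μ at hμ
  rw [← hμ]
  refine Submodule.sum_mem _ fun s _ => ?_
  rw [Submodule.coe_smul]
  refine Submodule.smul_mem _ _ (Submodule.subset_span ⟨s.1, s.2, ?_⟩)
  exact ExteriorAlgebra.basis_eq_coe_basis (Pi.basisFun (A) (Fin d)) s

/-- A multivector field is of degree `k` if and only if it is a combination of the `∂_J` with
`|J| = k`. -/
theorem mem_extDegree_iff {k : ℕ} {μ : FreeExt A d} :
    μ ∈ extDegree A d k ↔ ∀ J : Finset (Fin d), J.card ≠ k → (genBasis A d).repr μ J = 0 := by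
  constructor
  · intro h J hJ
    have := ((genBasis A d).mem_span_image).1 (mem_span_of_mem_extDegree h)
    by_contra h0
    exact hJ (this (Finsupp.mem_support_iff.2 h0))
  · intro h
    rw [← (genBasis A d).sum_repr μ]
    refine Submodule.sum_mem _ fun J _ => ?_
    by_cases hJ : J.card = k
    · exact smul_mem_extDegree _ (hJ ▸ genBasis_mem J)
    · rw [h J hJ, zero_smul]; exact Submodule.zero_mem _

/-- A linear map sends `𝔛^k(U)` into a subspace if it does so for the fields `f ∂_J`. -/
theorem map_mem_of_basis {k : ℕ} {V : Type*} [AddCommGroup V] [Module ℝ V] {S : Submodule ℝ V}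
    (φ : FreeExt A d →ₗ[ℝ] V)
    (h : ∀ (f : A) (J : Finset (Fin d)), J.card = k → φ (f • genBasis A d J) ∈ S)
    {μ : FreeExt A d} (hμ : μ ∈ extDegree A d k) : φ μ ∈ S := by
  rw [← (genBasis A d).sum_repr μ, map_sum]
  refine Submodule.sum_mem _ fun J _ => ?_
  by_cases hJ : J.card = k
  · exact h _ J hJ
  · rw [mem_extDegree_iff.1 hμ J hJ, zero_smul, map_zero]; exact Submodule.zero_mem _

theorem coeffD_mem {k : ℕ} (D : Derivation ℝ A A) {μ : FreeExt A d} (hμ : μ ∈ extDegree A d k) :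
    coeffD d D μ ∈ extDegree A d k :=
  map_mem_of_basis (coeffD d D) (fun f J hJ => by
    rw [coeffD_smul_basis]
    exact smul_mem_extDegree _ (hJ ▸ genBasis_mem J)) hμ

theorem wedge_mem {k : ℕ} (i : Fin d) {μ : FreeExt A d} (hμ : μ ∈ extDegree A d k) :
    wedge A i μ ∈ extDegree A d (k + 1) :=
  map_mem_of_basis (wedge A i) (fun f J hJ => by
    rw [wedge_smul, wedge_apply]
    refine smul_mem_extDegree _ ?_
    by_cases h : i ∈ J
    · rw [gen_mul_genBasis_of_mem h]; exact Submodule.zero_mem _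
    · obtain ⟨ε, -, he⟩ := gen_mul_genBasis (A := A) h
      rw [he, ← hJ, ← Finset.card_insert_of_notMem h]
      exact Submodule.smul_mem _ _ (genBasis_mem _)) hμ

theorem contr_mem {k : ℕ} (i : Fin d) {μ : FreeExt A d} (hμ : μ ∈ extDegree A d (k + 1)) :
    contr A i μ ∈ extDegree A d k :=
  map_mem_of_basis (contr A i) (fun f J hJ => by
    rw [contr_smul]
    refine smul_mem_extDegree _ ?_
    by_cases h : i ∈ J
    · obtain ⟨ε, he⟩ := exists_contr_basis (A := A) h
      have hk : (J.erase i).card = k := by rw [Finset.card_erase_of_mem h, hJ]; rfl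
      rw [he, ← hk]
      exact Submodule.smul_mem _ _ (genBasis_mem _)
    · rw [contr_basis_of_notMem h]; exact Submodule.zero_mem _) hμ

theorem contr_eq_zero (i : Fin d) {μ : FreeExt A d} (hμ : μ ∈ extDegree A d 0) :
    contr A i μ = 0 := by
  have := map_mem_of_basis (S := (⊥ : Submodule ℝ (FreeExt A d))) (contr A i) (fun f J hJ => by
    rw [Finset.card_eq_zero.1 hJ, contr_smul, contr_basis_of_notMem (Finset.notMem_empty i),
      smul_zero]
    exact Submodule.zero_mem _) hμ
  exact (Submodule.mem_bot ℝ).1 this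

end Operators

/-! ### Canonical commutation relations and the differential -/

/-- Elements `u_j`, `D_i`, `w_i`, `c_i` of a ring which satisfy the relations of the
multiplications by the coordinates `u_j`, the partial derivatives, the exterior multiplications and
the contractions. -/
structure CanonicalRelations (R : Type*) [Ring R] (m : ℕ) where
  u : Fin m → R
  D : Fin (m + 1) → R
  w : Fin (m + 1) → R
  c : Fin (m + 1) → R
  u_u : ∀ i j, u i * u j = u j * u i
  D_D : ∀ i j, D i * D j = D j * D i
  D_zero_u : ∀ j, D 0 * u j = u j * D 0
  D_succ_u : ∀ i j, D (Fin.succ i) * u j = u j * D (Fin.succ i) + if i = j then 1 else 0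
  w_u : ∀ i j, w i * u j = u j * w i
  c_u : ∀ i j, c i * u j = u j * c i
  D_w : ∀ i j, D i * w j = w j * D i
  D_c : ∀ i j, D i * c j = c j * D i
  w_w : ∀ i j, w i * w j = -(w j * w i)
  w_self : ∀ i, w i * w i = 0
  c_c : ∀ i j, c i * c j = -(c j * c i)
  c_w : ∀ i j, c i * w j = (if i = j then 1 else 0) - w j * c i

namespace CanonicalRelations

variable {R : Type*} [Ring R] {m : ℕ} (S : CanonicalRelations R m)

/-- The Euler operator on coefficients. -/
def euler : R := ∑ j : Fin m, S.u j * S.D j.succ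

/-- The operator which counts the factors `∂/∂u_j`. -/
def num : R := ∑ j : Fin m, S.w j.succ * S.c j.succ

/-- The Lie derivative along the Euler field. -/
def lie : R := S.euler - S.num

/-- The exterior product with the Euler field. -/
def koszul : R := ∑ j : Fin m, S.u j * S.w j.succ

/-- The divergence in the variables `u`. -/
def div : R := ∑ j : Fin m, S.D j.succ * S.c j.succ

/-- The differential `[∂_t ∧ E, ·]`. -/
def diff : R := S.w 0 * S.lie - S.koszul * S.D 0

/-- The divergence. -/
def homotopy : R := S.div + S.D 0 * S.c 0

theorem c_succ_w_zero (j : Fin m) : S.c j.succ * S.w 0 = -(S.w 0 * S.c j.succ) := by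
  rw [S.c_w, if_neg (Fin.succ_ne_zero j), zero_sub]

theorem c_zero_w_succ (j : Fin m) : S.c 0 * S.w j.succ = -(S.w j.succ * S.c 0) := by
  rw [S.c_w, if_neg (Fin.succ_ne_zero j).symm, zero_sub]

theorem c_succ_w_succ (i j : Fin m) :
    S.c i.succ * S.w j.succ = (if i = j then 1 else 0) - S.w j.succ * S.c i.succ := by
  rw [S.c_w]; simp only [Fin.succ_inj]

theorem commute_w_zero_lie : Commute (S.w 0) S.lie := by
  refine Commute.sub_right ?_ ?_
  · exact Commute.sum_right _ _ _ fun j _ =>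
      Commute.mul_right (S.w_u 0 j) (S.D_w j.succ 0).symm
  · refine Commute.sum_right _ _ _ fun j _ => ?_
    change _ = _
    rw [← mul_assoc, S.w_w 0 j.succ, neg_mul, mul_assoc, mul_assoc, S.c_succ_w_zero, mul_neg]

theorem commute_c_zero_lie : Commute (S.c 0) S.lie := by
  refine Commute.sub_right ?_ ?_
  · exact Commute.sum_right _ _ _ fun j _ =>
      Commute.mul_right (S.c_u 0 j) (S.D_c j.succ 0).symm
  · refine Commute.sum_right _ _ _ fun j _ => ?_
    change _ = _
    rw [← mul_assoc, S.c_zero_w_succ, neg_mul, mul_assoc, mul_assoc, S.c_c 0 j.succ, mul_neg,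
      neg_neg]

theorem commute_D_zero_lie : Commute (S.D 0) S.lie :=
  Commute.sub_right
    (Commute.sum_right _ _ _ fun j _ => Commute.mul_right (S.D_zero_u j) (S.D_D 0 j.succ))
    (Commute.sum_right _ _ _ fun j _ => Commute.mul_right (S.D_w 0 j.succ) (S.D_c 0 j.succ))

theorem commute_D_zero_koszul : Commute (S.D 0) S.koszul :=
  Commute.sum_right _ _ _ fun j _ => Commute.mul_right (S.D_zero_u j) (S.D_w 0 j.succ)

theorem commute_D_zero_div : Commute (S.D 0) S.div :=
  Commute.sum_right _ _ _ fun j _ => Commute.mul_right (S.D_D 0 j.succ) (S.D_c 0 j.succ)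

theorem div_mul_w_zero : S.div * S.w 0 = -(S.w 0 * S.div) := by
  rw [div, Finset.sum_mul, Finset.mul_sum, ← Finset.sum_neg_distrib]
  refine Finset.sum_congr rfl fun j _ => ?_
  rw [mul_assoc, S.c_succ_w_zero, mul_neg, ← mul_assoc, ← mul_assoc, S.D_w]

theorem c_zero_mul_koszul : S.c 0 * S.koszul = -(S.koszul * S.c 0) := by
  rw [koszul, Finset.sum_mul, Finset.mul_sum, ← Finset.sum_neg_distrib]
  refine Finset.sum_congr rfl fun j _ => ?_
  rw [← mul_assoc, S.c_u, mul_assoc, S.c_zero_w_succ, mul_neg, mul_assoc]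

theorem w_zero_mul_koszul : S.w 0 * S.koszul = -(S.koszul * S.w 0) := by
  rw [koszul, Finset.sum_mul, Finset.mul_sum, ← Finset.sum_neg_distrib]
  refine Finset.sum_congr rfl fun j _ => ?_
  rw [← mul_assoc, S.w_u, mul_assoc, S.w_w, mul_neg, mul_assoc]

theorem koszul_mul_self [Algebra ℝ R] : S.koszul * S.koszul = 0 := by
  have h : ∀ i j, S.u i * S.w (Fin.succ i) * (S.u j * S.w j.succ) =
      S.u i * S.u j * (S.w i.succ * S.w j.succ) := fun i j => by
    rw [mul_assoc, ← mul_assoc (S.w i.succ), S.w_u, mul_assoc, mul_assoc]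
  -- Exchanging the two summation indices changes the sign, since the u_j commute and the w_j
  -- anticommute.
  have h2 : S.koszul * S.koszul = -(S.koszul * S.koszul) := by
    conv_rhs => rw [koszul, Finset.sum_mul_sum, Finset.sum_comm]
    rw [koszul, Finset.sum_mul_sum, ← Finset.sum_neg_distrib]
    refine Finset.sum_congr rfl fun i _ => ?_
    rw [← Finset.sum_neg_distrib]
    refine Finset.sum_congr rfl fun j _ => ?_
    rw [h, h, S.w_w, S.u_u, mul_neg]
  have h3 : (2 : ℝ) • (S.koszul * S.koszul) = 0 := by
    rw [two_smul]
    nth_rewrite 1 [h2]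
    exact neg_add_cancel _
  exact (smul_eq_zero.1 h3).resolve_left two_ne_zero

/-- A Cartan-type formula. The terms with i ≠ j cancel, and each diagonal term gives u_i D_i - w_i
c_i + 1. The m summands 1 are the source of the factor m in `diff_homotopy`. -/
theorem koszul_div_add_div_koszul : S.koszul * S.div + S.div * S.koszul = S.lie + m := by
  have h : ∀ i j : Fin m, S.u i * S.w i.succ * (S.D j.succ * S.c j.succ) +
      S.D j.succ * S.c j.succ * (S.u i * S.w i.succ) =
      if i = j then S.u i * S.D i.succ - S.w i.succ * S.c i.succ + 1 else 0 := by
    intro i j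
    have h1 : S.u i * S.w i.succ * (S.D j.succ * S.c j.succ) =
        S.u i * S.D j.succ * (S.w i.succ * S.c j.succ) := by
      rw [mul_assoc, ← mul_assoc (S.w i.succ), ← S.D_w, mul_assoc, mul_assoc]
    have h2 : S.D j.succ * S.c j.succ * (S.u i * S.w i.succ) =
        (S.u i * S.D j.succ + if j = i then 1 else 0) *
          ((if j = i then 1 else 0) - S.w i.succ * S.c j.succ) := by
      rw [← S.D_succ_u, ← S.c_succ_w_succ, mul_assoc, ← mul_assoc (S.c j.succ), S.c_u, mul_assoc,
        mul_assoc]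
    rw [h1, h2]
    by_cases hij : i = j
    · subst hij
      simp only [if_true]
      noncomm_ring
    · rw [if_neg hij, if_neg (Ne.symm hij)]
      noncomm_ring
  rw [koszul, div, Finset.sum_mul_sum, Finset.sum_mul_sum]
  rw [Finset.sum_comm (f := fun i j => S.D (Fin.succ i) * S.c (Fin.succ i) *
    (S.u j * S.w (Fin.succ j)))]
  rw [← Finset.sum_add_distrib]
  simp only [← Finset.sum_add_distrib, h, Finset.sum_ite_eq, Finset.mem_univ, if_true]
  rw [Finset.sum_add_distrib, Finset.sum_sub_distrib]
  simp [lie, euler, num]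

theorem D_succ_mul_euler (j : Fin m) :
    S.D j.succ * S.euler = S.euler * S.D j.succ + S.D j.succ := by
  have h : ∀ i : Fin m, S.D j.succ * (S.u i * S.D i.succ) =
      S.u i * S.D i.succ * S.D j.succ + if j = i then S.D i.succ else 0 := fun i => by
    rw [← mul_assoc, S.D_succ_u, add_mul, mul_assoc, mul_assoc, S.D_D, ite_mul, one_mul, zero_mul]
  rw [euler, Finset.mul_sum, Finset.sum_mul]
  simp only [h, Finset.sum_add_distrib, Finset.sum_ite_eq, Finset.mem_univ, if_true]

theorem c_succ_mul_num (j : Fin m) :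
    S.c j.succ * S.num = S.num * S.c j.succ + S.c j.succ := by
  have h : ∀ i : Fin m, S.c j.succ * (S.w i.succ * S.c i.succ) =
      S.w i.succ * S.c i.succ * S.c j.succ + if j = i then S.c i.succ else 0 := fun i => by
    rw [← mul_assoc, S.c_succ_w_succ, sub_mul, mul_assoc, mul_assoc, S.c_c j.succ, ite_mul,
      one_mul, zero_mul, mul_neg, sub_neg_eq_add, add_comm]
  rw [num, Finset.mul_sum, Finset.sum_mul]
  simp only [h, Finset.sum_add_distrib, Finset.sum_ite_eq, Finset.mem_univ, if_true]

theorem euler_mul_u (j : Fin m) : S.euler * S.u j = S.u j * S.euler + S.u j := by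
  have h : ∀ i : Fin m, S.u i * S.D i.succ * S.u j =
      S.u j * (S.u i * S.D i.succ) + if i = j then S.u i else 0 := fun i => by
    rw [mul_assoc, S.D_succ_u, mul_add, ← mul_assoc, ← mul_assoc, S.u_u i j, mul_ite, mul_one,
      mul_zero]
  rw [euler, Finset.mul_sum, Finset.sum_mul]
  simp only [h, Finset.sum_add_distrib, Finset.sum_ite_eq', Finset.mem_univ, if_true]

theorem num_mul_w (j : Fin m) : S.num * S.w j.succ = S.w j.succ * S.num + S.w j.succ := by
  have h : ∀ i : Fin m, S.w i.succ * S.c i.succ * S.w j.succ =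
      S.w j.succ * (S.w i.succ * S.c i.succ) + if i = j then S.w i.succ else 0 := fun i => by
    rw [mul_assoc, S.c_succ_w_succ, mul_sub, ← mul_assoc, S.w_w i.succ, neg_mul, mul_ite, mul_one,
      mul_zero, mul_assoc, sub_neg_eq_add, add_comm]
  rw [num, Finset.mul_sum, Finset.sum_mul]
  simp only [h, Finset.sum_add_distrib, Finset.sum_ite_eq', Finset.mem_univ, if_true]

/-- D_j lowers the polynomial degree by one and c_j lowers the number of factors by one, so `lie`,
their difference, is unchanged. -/
theorem commute_lie_div : Commute S.lie S.div := by
  refine Commute.sum_right _ _ _ fun j _ => ?_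
  have hE : Commute (S.c j.succ) S.euler := Commute.sum_right _ _ _ fun i _ =>
    Commute.mul_right (S.c_u j.succ i) (S.D_c i.succ j.succ).symm
  have hN : Commute (S.D j.succ) S.num := Commute.sum_right _ _ _ fun i _ =>
    Commute.mul_right (S.D_w j.succ i.succ) (S.D_c j.succ i.succ)
  change (S.euler - S.num) * (S.D j.succ * S.c j.succ) =
    S.D j.succ * S.c j.succ * (S.euler - S.num)
  have h1 : S.D j.succ * S.c j.succ * S.euler =
      S.euler * (S.D j.succ * S.c j.succ) + S.D j.succ * S.c j.succ := by
    rw [mul_assoc, hE.eq, ← mul_assoc, S.D_succ_mul_euler, add_mul, mul_assoc]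
  have h2 : S.D j.succ * S.c j.succ * S.num =
      S.num * (S.D j.succ * S.c j.succ) + S.D j.succ * S.c j.succ := by
    rw [mul_assoc, S.c_succ_mul_num, mul_add, ← mul_assoc, hN.eq, mul_assoc]
  rw [mul_sub, h1, h2, sub_mul]
  abel

/-- Multiplication by u_j and the wedge with ∂_{u_j} raise degree and number of factors by one each,
which cancels in the difference. -/
theorem commute_lie_koszul : Commute S.lie S.koszul := by
  refine Commute.sum_right _ _ _ fun j _ => ?_
  have hE : Commute S.euler (S.w j.succ) := Commute.sum_left _ _ _ fun i _ =>
    Commute.mul_left (S.w_u j.succ i).symm (S.D_w i.succ j.succ)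
  have hN : Commute S.num (S.u j) := Commute.sum_left _ _ _ fun i _ =>
    Commute.mul_left (S.w_u i.succ j) (S.c_u i.succ j)
  change (S.euler - S.num) * (S.u j * S.w j.succ) = S.u j * S.w j.succ * (S.euler - S.num)
  have h1 : S.euler * (S.u j * S.w j.succ) =
      S.u j * S.w j.succ * S.euler + S.u j * S.w j.succ := by
    rw [← mul_assoc, S.euler_mul_u, add_mul, mul_assoc, hE.eq, mul_assoc]
  have h2 : S.num * (S.u j * S.w j.succ) =
      S.u j * S.w j.succ * S.num + S.u j * S.w j.succ := by
    rw [← mul_assoc, hN.eq, mul_assoc, S.num_mul_w, mul_add, mul_assoc]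
  rw [sub_mul, h1, h2, mul_sub]
  abel

theorem commute_D_zero_diff : Commute (S.D 0) S.diff :=
  Commute.sub_right (Commute.mul_right (S.D_w 0 0) S.commute_D_zero_lie)
    (Commute.mul_right S.commute_D_zero_koszul (Commute.refl _))

/-- Both summands of the differential square to zero, and they anticommute because only w_0 and K
fail to commute, up to sign. -/
theorem diff_mul_diff [Algebra ℝ R] : S.diff * S.diff = 0 := by
  have h1 : S.w 0 * S.lie * (S.w 0 * S.lie) = 0 := by
    rw [mul_assoc, ← mul_assoc S.lie, ← S.commute_w_zero_lie.eq, ← mul_assoc, ← mul_assoc,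
      S.w_self, zero_mul, zero_mul]
  have h2 : S.koszul * S.D 0 * (S.koszul * S.D 0) = 0 := by
    rw [mul_assoc, ← mul_assoc (S.D 0), S.commute_D_zero_koszul.eq, ← mul_assoc, ← mul_assoc,
      S.koszul_mul_self, zero_mul, zero_mul]
  have h3 : S.w 0 * S.lie * (S.koszul * S.D 0) = -(S.koszul * S.D 0 * (S.w 0 * S.lie)) := by
    calc S.w 0 * S.lie * (S.koszul * S.D 0) = S.w 0 * (S.lie * S.koszul) * S.D 0 := by
          simp only [mul_assoc]
      _ = S.w 0 * S.koszul * (S.lie * S.D 0) := by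
          rw [S.commute_lie_koszul.eq]; simp only [mul_assoc]
      _ = -(S.koszul * (S.w 0 * S.D 0) * S.lie) := by
          rw [S.w_zero_mul_koszul, ← S.commute_D_zero_lie.eq]; simp only [mul_assoc, neg_mul]
      _ = _ := by rw [← S.D_w]; simp only [mul_assoc]
  rw [diff, sub_mul, mul_sub, mul_sub, h1, h2, h3]
  abel

/-- The divergence is a homotopy between `-m ∂/∂t` and zero. -/
theorem diff_homotopy :
    S.diff * S.homotopy + S.homotopy * S.diff = -((m : R) * S.D 0) := by
  -- The anticommutator expands into four blocks. The first and last vanish; the middle two are ∂_t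
  -- L and (L + m) ∂_t, whose difference is -m ∂_t.
  have hA : S.w 0 * S.lie * S.div + S.div * (S.w 0 * S.lie) = 0 := by
    rw [mul_assoc, S.commute_lie_div.eq, ← mul_assoc S.div, S.div_mul_w_zero, neg_mul, mul_assoc,
      add_neg_cancel]
  have hB : S.w 0 * S.lie * (S.D 0 * S.c 0) + S.D 0 * S.c 0 * (S.w 0 * S.lie) =
      S.D 0 * S.lie := by
    have h1 : S.w 0 * S.lie * (S.D 0 * S.c 0) = S.D 0 * (S.w 0 * S.c 0) * S.lie := by
      calc _ = S.w 0 * (S.lie * S.D 0) * S.c 0 := by simp only [mul_assoc]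
        _ = S.w 0 * S.D 0 * (S.lie * S.c 0) := by
          rw [← S.commute_D_zero_lie.eq]; simp only [mul_assoc]
        _ = _ := by rw [← S.commute_c_zero_lie.eq, ← S.D_w]; simp only [mul_assoc]
    have h2 : S.D 0 * S.c 0 * (S.w 0 * S.lie) = S.D 0 * (S.c 0 * S.w 0) * S.lie := by
      simp only [mul_assoc]
    rw [h1, h2, S.c_w, if_pos rfl]
    noncomm_ring
  have hC : S.koszul * S.D 0 * S.div + S.div * (S.koszul * S.D 0) =
      (S.lie + m) * S.D 0 := by
    rw [← S.koszul_div_add_div_koszul, mul_assoc, S.commute_D_zero_div.eq, add_mul]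
    simp only [mul_assoc]
  have hD : S.koszul * S.D 0 * (S.D 0 * S.c 0) + S.D 0 * S.c 0 * (S.koszul * S.D 0) = 0 := by
    have : S.D 0 * S.c 0 * (S.koszul * S.D 0) = -(S.koszul * S.D 0 * (S.D 0 * S.c 0)) := by
      calc _ = S.D 0 * (S.c 0 * S.koszul) * S.D 0 := by simp only [mul_assoc]
        _ = -(S.D 0 * S.koszul * (S.c 0 * S.D 0)) := by
          rw [S.c_zero_mul_koszul]; simp only [mul_assoc, neg_mul, mul_neg]
        _ = _ := by rw [S.commute_D_zero_koszul.eq, ← S.D_c]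
    rw [this, add_neg_cancel]
  have hsum : S.diff * S.homotopy + S.homotopy * S.diff =
      (S.w 0 * S.lie * S.div + S.div * (S.w 0 * S.lie)) +
      (S.w 0 * S.lie * (S.D 0 * S.c 0) + S.D 0 * S.c 0 * (S.w 0 * S.lie)) -
      (S.koszul * S.D 0 * S.div + S.div * (S.koszul * S.D 0)) -
      (S.koszul * S.D 0 * (S.D 0 * S.c 0) + S.D 0 * S.c 0 * (S.koszul * S.D 0)) := by
    simp only [diff, homotopy, mul_add, add_mul, sub_mul, mul_sub]
    abel
  rw [hsum, hA, hB, hC, hD, S.commute_D_zero_lie.eq, add_mul]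
  abel

end CanonicalRelations

/-! ### The complex of a book algebra -/

namespace BookAlgebra

variable {m : ℕ} {A : Type*} [CommRing A] [Algebra ℝ A] (S : BookAlgebra m A)

/-- The operators on the exterior algebra attached to a book algebra. -/
def operators : CanonicalRelations (Module.End ℝ (FreeExt A (m + 1))) m where
  u j := scale (m + 1) (S.coord j)
  D i := coeffD (m + 1) (S.der i)
  w := wedge A
  c := contr A
  u_u _ _ := scale_comm _ _
  D_D i j := coeffD_comm (S.der_comm i j)
  D_zero_u j := by
    rw [coeffD_mul_scale, der_zero_coord]
    exact LinearMap.ext fun μ => by simp [scale_apply]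
  D_succ_u i j := by
    rw [coeffD_mul_scale, der_succ_coord]
    refine LinearMap.ext fun μ => ?_
    split_ifs <;> simp [scale_apply]
  w_u _ _ := wedge_mul_scale _ _
  c_u _ _ := contr_mul_scale _ _
  D_w _ _ := coeffD_wedge _ _
  D_c _ _ := coeffD_contr _ _
  w_w := wedge_wedge
  w_self := wedge_self
  c_c := contr_contr
  c_w := contr_wedge

/-- The differential. -/
def d : Module.End ℝ (FreeExt A (m + 1)) := S.operators.diff

/-- The derivative with respect to `t`. -/
def dt : Module.End ℝ (FreeExt A (m + 1)) := coeffD (m + 1) (S.der 0)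

/-- The Lie derivative along the Euler field. -/
def lie : Module.End ℝ (FreeExt A (m + 1)) := S.operators.lie

/-- The exterior product with the Euler field. -/
def koszul : Module.End ℝ (FreeExt A (m + 1)) := S.operators.koszul

theorem d_apply (μ : FreeExt A (m + 1)) :
    S.d μ = wedge A 0 (S.lie μ) - S.koszul (S.dt μ) := rfl

theorem dt_lie (μ : FreeExt A (m + 1)) : S.dt (S.lie μ) = S.lie (S.dt μ) :=
  LinearMap.congr_fun S.operators.commute_D_zero_lie.eq μ

theorem dt_koszul (μ : FreeExt A (m + 1)) : S.dt (S.koszul μ) = S.koszul (S.dt μ) :=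
  LinearMap.congr_fun S.operators.commute_D_zero_koszul.eq μ

theorem dt_d (μ : FreeExt A (m + 1)) : S.dt (S.d μ) = S.d (S.dt μ) :=
  LinearMap.congr_fun S.operators.commute_D_zero_diff.eq μ

theorem dt_wedge (i : Fin (m + 1)) (μ : FreeExt A (m + 1)) :
    S.dt (wedge A i μ) = wedge A i (S.dt μ) :=
  LinearMap.congr_fun (coeffD_wedge (S.der 0) i) μ

theorem dt_contr (i : Fin (m + 1)) (μ : FreeExt A (m + 1)) :
    S.dt (contr A i μ) = contr A i (S.dt μ) :=
  LinearMap.congr_fun (coeffD_contr (S.der 0) i) μ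

theorem lie_wedge_zero (μ : FreeExt A (m + 1)) : S.lie (wedge A 0 μ) = wedge A 0 (S.lie μ) :=
  (LinearMap.congr_fun S.operators.commute_w_zero_lie.eq μ).symm

theorem lie_contr_zero (μ : FreeExt A (m + 1)) : S.lie (contr A 0 μ) = contr A 0 (S.lie μ) :=
  (LinearMap.congr_fun S.operators.commute_c_zero_lie.eq μ).symm

theorem lie_koszul (μ : FreeExt A (m + 1)) : S.lie (S.koszul μ) = S.koszul (S.lie μ) :=
  LinearMap.congr_fun S.operators.commute_lie_koszul.eq μ

theorem contr_zero_koszul (μ : FreeExt A (m + 1)) :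
    contr A 0 (S.koszul μ) = -S.koszul (contr A 0 μ) :=
  LinearMap.congr_fun S.operators.c_zero_mul_koszul μ

theorem wedge_zero_koszul (μ : FreeExt A (m + 1)) :
    wedge A 0 (S.koszul μ) = -S.koszul (wedge A 0 μ) :=
  LinearMap.congr_fun S.operators.w_zero_mul_koszul μ

theorem koszul_koszul (μ : FreeExt A (m + 1)) : S.koszul (S.koszul μ) = 0 :=
  LinearMap.congr_fun S.operators.koszul_mul_self μ

theorem d_d (μ : FreeExt A (m + 1)) : S.d (S.d μ) = 0 :=
  LinearMap.congr_fun S.operators.diff_mul_diff μ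

theorem contr_wedge_zero (μ : FreeExt A (m + 1)) :
    contr A 0 (wedge A 0 μ) = μ - wedge A 0 (contr A 0 μ) := by
  have := LinearMap.congr_fun (contr_wedge (A := A) (0 : Fin (m + 1)) 0) μ
  rwa [if_pos rfl] at this

theorem d_homotopy (μ : FreeExt A (m + 1)) :
    S.d (S.operators.homotopy μ) + S.operators.homotopy (S.d μ) = -((m : ℝ) • S.dt μ) := by
  have h := LinearMap.congr_fun S.operators.diff_homotopy μ
  refine Eq.trans h ?_
  rw [← nsmul_eq_mul, LinearMap.neg_apply, LinearMap.smul_apply, ← Nat.cast_smul_eq_nsmul ℝ]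
  rfl

/-! #### Coefficients -/

theorem eq_of_repr {B : Type*} [CommRing B] {n : ℕ} {μ ν : FreeExt B n}
    (h : ∀ J : Finset (Fin n), (genBasis B n).repr μ J = (genBasis B n).repr ν J) : μ = ν :=
  (genBasis B n).repr.injective (Finsupp.ext h)

theorem repr_dt (μ : FreeExt A (m + 1)) (J : Finset (Fin (m + 1))) :
    (genBasis A (m + 1)).repr (S.dt μ) J = S.der 0 ((genBasis A (m + 1)).repr μ J) := by
  change (genBasis A (m + 1)).repr (∑ K : Finset (Fin (m + 1)),
    S.der 0 ((genBasis A (m + 1)).repr μ K) • genBasis A (m + 1) K) J = _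
  rw [Module.Basis.repr_sum_self]

/-- L is diagonal in the basis ∂_J, which reduces equations in L to scalar equations in E - r. The
index 0 is erased because ∂_t does not count towards r. -/
theorem lie_smul_basis (f : A) (J : Finset (Fin (m + 1))) :
    S.lie (f • genBasis A (m + 1) J) =
      (S.euler f - ((J.erase 0).card : ℝ) • f) • genBasis A (m + 1) J := by
  have hE : S.operators.euler (f • genBasis A (m + 1) J) =
      S.euler f • genBasis A (m + 1) J := by
    rw [CanonicalRelations.euler, LinearMap.sum_apply, euler_apply, Finset.sum_smul]
    refine Finset.sum_congr rfl fun j _ => ?_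
    change S.coord j • coeffD (m + 1) (S.der j.succ) (f • genBasis A (m + 1) J) = _
    rw [coeffD_smul_basis, smul_smul]
  have hN : S.operators.num (f • genBasis A (m + 1) J) =
      (((J.erase 0).card : ℝ) • f) • genBasis A (m + 1) J := by
    rw [CanonicalRelations.num, LinearMap.sum_apply]
    have h : ∀ j : Fin m, (S.operators.w j.succ * S.operators.c j.succ)
        (f • genBasis A (m + 1) J) = if j.succ ∈ J then f • genBasis A (m + 1) J else 0 := by
      intro j
      change wedge A j.succ (contr A j.succ (f • genBasis A (m + 1) J)) = _
      rw [contr_smul, wedge_smul, wedge_contr_basis, smul_ite, smul_zero]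
    rw [Finset.sum_congr rfl fun j _ => h j, ← Finset.sum_filter, Finset.sum_const]
    have hcard : (Finset.univ.filter fun j : Fin m => j.succ ∈ J).card = (J.erase 0).card := by
      rw [← Finset.card_map (Fin.succEmb m)]
      congr 1
      ext i
      refine Fin.cases ?_ (fun j => ?_) i
      · simp [Fin.succ_ne_zero]
      · simp
    rw [hcard, smul_assoc, Nat.cast_smul_eq_nsmul]
  change S.operators.euler _ - S.operators.num _ = _
  rw [hE, hN, sub_smul]

theorem repr_lie (μ : FreeExt A (m + 1)) (J : Finset (Fin (m + 1))) :
    (genBasis A (m + 1)).repr (S.lie μ) J = S.euler ((genBasis A (m + 1)).repr μ J) -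
      ((J.erase 0).card : ℝ) • (genBasis A (m + 1)).repr μ J := by
  conv_lhs => rw [← (genBasis A (m + 1)).sum_repr μ, map_sum]
  rw [Finset.sum_congr rfl fun K _ => S.lie_smul_basis _ K, Module.Basis.repr_sum_self]

theorem repr_wedge_contr (μ : FreeExt A (m + 1)) (J : Finset (Fin (m + 1))) :
    (genBasis A (m + 1)).repr (wedge A 0 (contr A 0 μ)) J =
      if 0 ∈ J then (genBasis A (m + 1)).repr μ J else 0 := by
  have h : wedge A 0 (contr A 0 μ) = ∑ K : Finset (Fin (m + 1)),
      (if 0 ∈ K then (genBasis A (m + 1)).repr μ K else 0) • genBasis A (m + 1) K := by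
    conv_lhs => rw [← (genBasis A (m + 1)).sum_repr μ, map_sum, map_sum]
    refine Finset.sum_congr rfl fun K _ => ?_
    rw [contr_smul, wedge_smul, wedge_contr_basis]
    split_ifs
    · rfl
    · rw [smul_zero, zero_smul]
  rw [h, Module.Basis.repr_sum_self]

theorem exists_repr (k : ℕ) (f : Finset (Fin (m + 1)) → A) :
    ∃ μ ∈ extDegree A (m + 1) k, ∀ J : Finset (Fin (m + 1)),
      (genBasis A (m + 1)).repr μ J = if J.card = k then f J else 0 := by
  refine ⟨∑ J : Finset (Fin (m + 1)), (if J.card = k then f J else 0) • genBasis A (m + 1) J,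
    ?_, fun J => by rw [Module.Basis.repr_sum_self]⟩
  rw [mem_extDegree_iff]
  intro J hJ
  rw [Module.Basis.repr_sum_self, if_neg hJ]

theorem exists_dt_eq {k : ℕ} {μ : FreeExt A (m + 1)} (hμ : μ ∈ extDegree A (m + 1) k) :
    ∃ ν ∈ extDegree A (m + 1) k, S.dt ν = μ := by
  choose f hf using fun J => S.der_zero_surjective ((genBasis A (m + 1)).repr μ J)
  obtain ⟨ν, hν, h⟩ := exists_repr k f
  refine ⟨ν, hν, eq_of_repr fun J => ?_⟩
  rw [repr_dt, h]
  split_ifs with hJ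
  · exact hf J
  · rw [map_zero, mem_extDegree_iff.1 hμ J hJ]

/-! #### Degrees of the operators -/

theorem dt_mem {k : ℕ} {μ : FreeExt A (m + 1)} (h : μ ∈ extDegree A (m + 1) k) :
    S.dt μ ∈ extDegree A (m + 1) k := coeffD_mem _ h

theorem lie_mem {k : ℕ} {μ : FreeExt A (m + 1)} (h : μ ∈ extDegree A (m + 1) k) :
    S.lie μ ∈ extDegree A (m + 1) k := by
  rw [mem_extDegree_iff] at h ⊢
  intro J hJ
  rw [repr_lie, h J hJ, map_zero, smul_zero, sub_zero]

theorem koszul_mem {k : ℕ} {μ : FreeExt A (m + 1)} (h : μ ∈ extDegree A (m + 1) k) :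
    S.koszul μ ∈ extDegree A (m + 1) (k + 1) := by
  rw [koszul, CanonicalRelations.koszul, LinearMap.sum_apply]
  exact Submodule.sum_mem _ fun j _ => smul_mem_extDegree _ (wedge_mem j.succ h)

theorem d_mem {k : ℕ} {μ : FreeExt A (m + 1)} (h : μ ∈ extDegree A (m + 1) k) :
    S.d μ ∈ extDegree A (m + 1) (k + 1) := by
  rw [d_apply]
  exact Submodule.sub_mem _ (wedge_mem 0 (S.lie_mem h)) (S.koszul_mem (S.dt_mem h))

theorem homotopy_apply (μ : FreeExt A (m + 1)) : S.operators.homotopy μ =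
    ∑ j : Fin m, coeffD (m + 1) (S.der j.succ) (contr A j.succ μ) + S.dt (contr A 0 μ) := by
  rw [CanonicalRelations.homotopy, CanonicalRelations.div, LinearMap.add_apply,
    LinearMap.sum_apply]
  rfl

theorem homotopy_mem {k : ℕ} {μ : FreeExt A (m + 1)} (h : μ ∈ extDegree A (m + 1) (k + 1)) :
    S.operators.homotopy μ ∈ extDegree A (m + 1) k := by
  rw [homotopy_apply]
  exact Submodule.add_mem _ (Submodule.sum_mem _ fun j _ => coeffD_mem _ (contr_mem _ h))
    (S.dt_mem (contr_mem _ h))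

theorem homotopy_eq_zero {μ : FreeExt A (m + 1)} (h : μ ∈ extDegree A (m + 1) 0) :
    S.operators.homotopy μ = 0 := by
  rw [homotopy_apply]
  simp only [contr_eq_zero _ h, map_zero, Finset.sum_const_zero, add_zero]

/-! #### Reduction to polynomial multivector fields -/

/-- The coboundaries of degree `k`. -/
def cob : ℕ → Submodule ℝ (FreeExt A (m + 1))
  | 0 => ⊥
  | k + 1 => (extDegree A (m + 1) k).map S.d

/-- The combinations of the `u_I ∂_J` and `∂_t ∧ u_I ∂_J` with `|I| = |J|`, of degree `k`. -/
def poly (k : ℕ) : Submodule ℝ (FreeExt A (m + 1)) :=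
  extDegree A (m + 1) k ⊓ LinearMap.ker S.dt ⊓ LinearMap.ker S.lie

theorem mem_poly {k : ℕ} {μ : FreeExt A (m + 1)} :
    μ ∈ S.poly k ↔ μ ∈ extDegree A (m + 1) k ∧ S.dt μ = 0 ∧ S.lie μ = 0 := by
  rw [poly, Submodule.mem_inf, Submodule.mem_inf, LinearMap.mem_ker, LinearMap.mem_ker, and_assoc]

theorem mem_poly_iff_repr {k : ℕ} {μ : FreeExt A (m + 1)} :
    μ ∈ S.poly k ↔ μ ∈ extDegree A (m + 1) k ∧ ∀ J : Finset (Fin (m + 1)),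
      (genBasis A (m + 1)).repr μ J ∈ S.homogeneous (J.erase 0).card := by
  rw [mem_poly]
  refine and_congr_right fun _ => ⟨fun h J => S.mem_homogeneous ?_ ?_, fun h => ⟨?_, ?_⟩⟩
  · rw [← repr_dt, h.1, map_zero, Finsupp.zero_apply]
  · rw [← sub_eq_zero, ← repr_lie, h.2, map_zero, Finsupp.zero_apply]
  · refine eq_of_repr fun J => ?_
    rw [repr_dt, S.der_zero_of_mem_homogeneous (h J), map_zero, Finsupp.zero_apply]
  · refine eq_of_repr fun J => ?_
    rw [repr_lie, S.euler_of_mem_homogeneous (h J), sub_self, map_zero, Finsupp.zero_apply]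

theorem d_eq_zero_of_mem_poly {k : ℕ} {μ : FreeExt A (m + 1)} (h : μ ∈ S.poly k) : S.d μ = 0 := by
  rw [mem_poly] at h
  rw [d_apply, h.2.1, h.2.2, map_zero, map_zero, sub_zero]

theorem koszul_mem_poly {k : ℕ} {μ : FreeExt A (m + 1)} (h : μ ∈ S.poly k) :
    S.koszul μ ∈ S.poly (k + 1) := by
  rw [mem_poly] at h ⊢
  exact ⟨S.koszul_mem h.1, by rw [dt_koszul, h.2.1, map_zero], by rw [lie_koszul, h.2.2, map_zero]⟩

theorem wedge_zero_mem_poly {k : ℕ} {μ : FreeExt A (m + 1)} (h : μ ∈ S.poly k) :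
    wedge A 0 μ ∈ S.poly (k + 1) := by
  rw [mem_poly] at h ⊢
  exact ⟨wedge_mem 0 h.1, by rw [dt_wedge, h.2.1, map_zero],
    by rw [lie_wedge_zero, h.2.2, map_zero]⟩

theorem contr_zero_mem_poly {k : ℕ} {μ : FreeExt A (m + 1)} (h : μ ∈ S.poly (k + 1)) :
    contr A 0 μ ∈ S.poly k := by
  rw [mem_poly] at h ⊢
  exact ⟨contr_mem 0 h.1, by rw [dt_contr, h.2.1, map_zero],
    by rw [lie_contr_zero, h.2.2, map_zero]⟩

/-- The image of the Lie derivative meets the polynomial fields trivially. -/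
theorem lie_eq_zero_of_mem_poly {k : ℕ} {μ : FreeExt A (m + 1)} (h : S.lie μ ∈ S.poly k) :
    S.lie μ = 0 := by
  refine eq_of_repr fun J => ?_
  rw [map_zero, Finsupp.zero_apply]
  exact S.eq_zero_of_euler_sub_eq ((S.mem_poly_iff_repr.1 h).2 J) (S.repr_lie μ J).symm

/-- If μ = ∂_t ∧ ι with ι the contraction of μ, then L μ = ∂_t ∧ L ι = d ι, as ι is t-independent.
In degree 0 such a μ is zero. -/
theorem lie_mem_cob {k : ℕ} {μ : FreeExt A (m + 1)} (hμ : μ ∈ extDegree A (m + 1) k)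
    (ht : S.dt μ = 0) (h0 : wedge A 0 (contr A 0 μ) = μ) : S.lie μ ∈ S.cob k := by
  cases k with
  | zero =>
    rw [contr_eq_zero 0 hμ, map_zero] at h0
    rw [← h0, map_zero]
    exact Submodule.zero_mem _
  | succ k =>
    refine ⟨contr A 0 μ, contr_mem 0 hμ, ?_⟩
    rw [d_apply, dt_contr, ht, map_zero, map_zero, sub_zero, ← lie_wedge_zero, h0]

/-- A cocycle is cohomologous to a `t`-independent one. -/
theorem exists_dt_sub_eq_zero (hm : 1 ≤ m) {k : ℕ} {μ : FreeExt A (m + 1)}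
    (hμ : μ ∈ extDegree A (m + 1) k) (hd : S.d μ = 0) :
    ∃ ν ∈ S.cob k, S.dt (μ - ν) = 0 := by
  have hm0 : (m : ℝ) ≠ 0 := by positivity
  have h := S.d_homotopy μ
  rw [hd, map_zero, add_zero] at h
  cases k with
  | zero =>
    refine ⟨0, Submodule.zero_mem _, ?_⟩
    rw [S.homotopy_eq_zero hμ, map_zero, eq_comm, neg_eq_zero] at h
    rw [sub_zero]
    exact (smul_eq_zero.1 h).resolve_left hm0
  | succ k =>
    -- For ∂_t R = hμ, the homotopy formula gives ∂_t dR = d hμ = -m ∂_t μ; hence the factor -1/m.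
    obtain ⟨R, hR, hRt⟩ := S.exists_dt_eq (S.homotopy_mem hμ)
    refine ⟨S.d (-(m : ℝ)⁻¹ • R), ⟨_, Submodule.smul_mem _ _ hR, rfl⟩, ?_⟩
    rw [map_sub, dt_d, map_smul, hRt, map_smul, h, neg_smul, smul_neg, neg_neg, smul_smul,
      inv_mul_cancel₀ hm0, one_smul, sub_self]

theorem d_mem_cob {k : ℕ} {μ : FreeExt A (m + 1)} (hμ : μ ∈ extDegree A (m + 1) k) :
    S.d μ ∈ S.cob (k + 1) := ⟨μ, hμ, rfl⟩

theorem mem_extDegree_of_mem_cob {k : ℕ} {μ : FreeExt A (m + 1)} (h : μ ∈ S.cob k) :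
    μ ∈ extDegree A (m + 1) k := by
  cases k with
  | zero => rw [(Submodule.mem_bot ℝ).1 h]; exact Submodule.zero_mem _
  | succ k => obtain ⟨ν, hν, rfl⟩ := h; exact S.d_mem hν

theorem d_eq_zero_of_mem_cob {k : ℕ} {μ : FreeExt A (m + 1)} (h : μ ∈ S.cob k) : S.d μ = 0 := by
  cases k with
  | zero => rw [(Submodule.mem_bot ℝ).1 h, map_zero]
  | succ k => obtain ⟨ν, hν, rfl⟩ := h; exact S.d_d ν

/-- Every cocycle is cohomologous to a polynomial one. -/
theorem exists_poly_add_cob (hm : 1 ≤ m) {k : ℕ} {μ : FreeExt A (m + 1)}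
    (hμ : μ ∈ extDegree A (m + 1) k) (hd : S.d μ = 0) :
    ∃ τ ∈ S.poly k, ∃ ν ∈ S.cob k, μ = τ + ν := by
  obtain ⟨ν₁, hν₁, ht⟩ := S.exists_dt_sub_eq_zero hm hμ hd
  set ρ := μ - ν₁ with hρ
  have hρk : ρ ∈ extDegree A (m + 1) k :=
    Submodule.sub_mem _ hμ (S.mem_extDegree_of_mem_cob hν₁)
  have hρd : wedge A 0 (S.lie ρ) = 0 := by
    have : S.d ρ = 0 := by rw [hρ, map_sub, hd, S.d_eq_zero_of_mem_cob hν₁, sub_zero]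
    rwa [d_apply, ht, map_zero, sub_zero] at this
  -- The cocycle condition ∂_t ∧ Lρ = 0 says that Lρ has only components containing ∂_t.
  have hlie : S.lie ρ = wedge A 0 (contr A 0 (S.lie ρ)) := by
    have := contr_wedge_zero (S.lie ρ)
    rw [hρd, map_zero] at this
    exact sub_eq_zero.1 this.symm
  have hder : ∀ J, S.der 0 ((genBasis A (m + 1)).repr ρ J) = 0 := fun J => by
    rw [← repr_dt, ht, map_zero, Finsupp.zero_apply]
  choose p hp g hg hpg using fun J : Finset (Fin (m + 1)) =>
    S.exists_homogeneous_add (J.erase 0).card _ (hder J)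
  -- Only components containing ∂_t are corrected, so that L G is a coboundary. The others are
  -- already killed by L and hence polynomial.
  obtain ⟨G, hG, hGr⟩ := exists_repr k fun J : Finset (Fin (m + 1)) => if 0 ∈ J then g J else 0
  have hGt : S.dt G = 0 := by
    refine eq_of_repr fun J => ?_
    rw [repr_dt, hGr, map_zero, Finsupp.zero_apply]
    split_ifs
    · exact hg J
    · exact map_zero _
    · exact map_zero _
  have hG0 : wedge A 0 (contr A 0 G) = G := by
    refine eq_of_repr fun J => ?_
    rw [repr_wedge_contr, hGr]
    split_ifs <;> rfl
  refine ⟨ρ - S.lie G, ?_, ν₁ + S.lie G, Submodule.add_mem _ hν₁ (S.lie_mem_cob hG hGt hG0),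
    by rw [hρ]; abel⟩
  rw [mem_poly_iff_repr]
  refine ⟨Submodule.sub_mem _ hρk (S.lie_mem hG), fun J => ?_⟩
  rw [map_sub, Finsupp.sub_apply, repr_lie, hGr]
  by_cases hJ : J.card = k
  · rw [if_pos hJ]
    by_cases h0 : 0 ∈ J
    · rw [if_pos h0, hpg J, add_sub_cancel_right]
      exact hp J
    · rw [if_neg h0, map_zero, smul_zero, sub_zero, sub_zero]
      refine S.mem_homogeneous (hder J) (sub_eq_zero.1 ?_)
      rw [← repr_lie, hlie, repr_wedge_contr, if_neg h0]
  · rw [if_neg hJ, map_zero, smul_zero, sub_zero, sub_zero, mem_extDegree_iff.1 hρk J hJ]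
    exact Submodule.zero_mem _

/-- Let ν be any t-primitive of τ. Then Lν is t-independent, because ∂_t Lν = Lτ = 0. Subtracting a
suitable t-independent field makes Lν polynomial, hence zero by `lie_eq_zero_of_mem_poly`. -/
theorem exists_dt_eq_of_mem_poly {k : ℕ} {τ : FreeExt A (m + 1)} (hτ : τ ∈ S.poly k) :
    ∃ ν ∈ extDegree A (m + 1) k, S.dt ν = τ ∧ S.lie ν = 0 := by
  rw [mem_poly] at hτ
  obtain ⟨ν, hν, hνt⟩ := S.exists_dt_eq hτ.1
  have hder : ∀ J, S.der 0 ((genBasis A (m + 1)).repr (S.lie ν) J) = 0 := fun J => by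
    rw [← repr_dt, dt_lie, hνt, hτ.2.2, map_zero, Finsupp.zero_apply]
  choose p hp g hg hpg using fun J : Finset (Fin (m + 1)) =>
    S.exists_homogeneous_add (J.erase 0).card _ (hder J)
  obtain ⟨G, hG, hGr⟩ := exists_repr k g
  have hlie : S.lie (ν - G) ∈ S.poly k := by
    rw [mem_poly_iff_repr]
    refine ⟨S.lie_mem (Submodule.sub_mem _ hν hG), fun J => ?_⟩
    rw [map_sub, map_sub, Finsupp.sub_apply, S.repr_lie G, hGr]
    by_cases hJ : J.card = k
    · rw [if_pos hJ, hpg J, add_sub_cancel_right]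
      exact hp J
    · rw [if_neg hJ, map_zero, smul_zero, sub_zero, sub_zero,
        mem_extDegree_iff.1 (S.lie_mem hν) J hJ]
      exact Submodule.zero_mem _
  refine ⟨ν - G, Submodule.sub_mem _ hν hG, ?_, S.lie_eq_zero_of_mem_poly hlie⟩
  have hGt : S.dt G = 0 := by
    refine eq_of_repr fun J => ?_
    rw [repr_dt, hGr, map_zero, Finsupp.zero_apply]
    split_ifs
    · exact hg J
    · exact map_zero _
  rw [map_sub, hνt, hGt, sub_zero]

/-- A t-primitive ν of τ with Lν = 0 satisfies dν = -Kτ. -/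
theorem koszul_mem_cob {k : ℕ} {τ : FreeExt A (m + 1)} (hτ : τ ∈ S.poly k) :
    S.koszul τ ∈ S.cob (k + 1) := by
  obtain ⟨ν, hν, hνt, hνl⟩ := S.exists_dt_eq_of_mem_poly hτ
  refine ⟨-ν, Submodule.neg_mem _ hν, ?_⟩
  rw [map_neg, d_apply, hνt, hνl, map_zero, zero_sub, neg_neg]

/-- A polynomial coboundary is in the image of the Koszul operator. -/
theorem exists_koszul_eq (hm : 1 ≤ m) {k : ℕ} {τ : FreeExt A (m + 1)} (hτ : τ ∈ S.poly (k + 1))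
    (h : τ ∈ S.cob (k + 1)) : ∃ σ ∈ S.poly k, S.koszul σ = τ := by
  obtain ⟨R, hR, rfl⟩ := h
  -- The derivative ∂_t R is a cocycle, so it is a polynomial field σ plus a coboundary. Both have
  -- t-primitives, C with dC = -Kσ and T with dT = 0, and removing them makes R independent of t.
  have hdt : S.d (S.dt R) = 0 := by rw [← dt_d]; exact (S.mem_poly.1 hτ).2.1
  obtain ⟨σ, hσ, ν, hν, hsum⟩ := S.exists_poly_add_cob hm (S.dt_mem hR) hdt
  obtain ⟨T, hT, hTt⟩ : ∃ T ∈ S.cob k, S.dt T = ν := by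
    cases k with
    | zero => exact ⟨0, Submodule.zero_mem _, by rw [(Submodule.mem_bot ℝ).1 hν, map_zero]⟩
    | succ k =>
      obtain ⟨N, hN, rfl⟩ := hν
      obtain ⟨T, hT, hTt⟩ := S.exists_dt_eq hN
      exact ⟨S.d T, S.d_mem_cob hT, by rw [dt_d, hTt]⟩
  obtain ⟨C, hC, hCt, hCl⟩ := S.exists_dt_eq_of_mem_poly hσ
  have hdC : S.d C = -S.koszul σ := by rw [d_apply, hCl, hCt, map_zero, zero_sub]
  have hR't : S.dt (R - T - C) = 0 := by rw [map_sub, map_sub, hsum, hTt, hCt]; abel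
  have hdR' : S.d (R - T - C) = S.d R + S.koszul σ := by
    rw [map_sub, map_sub, S.d_eq_zero_of_mem_cob hT, hdC]; abel
  have hlie : S.lie (wedge A 0 (R - T - C)) = S.d R + S.koszul σ := by
    rw [← hdR', d_apply S (R - T - C), hR't, map_zero, sub_zero, lie_wedge_zero]
  -- The field dR + Kσ is polynomial and also equals L(∂_t ∧ (R - T - C)), so it vanishes.
  have hzero := S.lie_eq_zero_of_mem_poly (μ := wedge A 0 (R - T - C)) (k := k + 1)
    (by rw [hlie]; exact Submodule.add_mem _ hτ (S.koszul_mem_poly hσ))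
  refine ⟨-σ, Submodule.neg_mem _ hσ, ?_⟩
  rw [hzero] at hlie
  rw [map_neg]
  exact (eq_neg_of_add_eq_zero_left hlie.symm).symm

end BookAlgebra

/-! ### Combinatorics of admissible pairs -/

section Pairs

variable {m : ℕ}

/-- The pairs `(I, J)` with `|I| = |J| = l`. -/
def pairs (m l : ℕ) : Set (Multiset (Fin m) × Finset (Fin m)) :=
  {p | p.1.card = l ∧ p.2.card = l}

/-- The admissible pairs `(I, J)` with `|I| = |J| = l`. -/
def admissiblePairs (m l : ℕ) : Set (Multiset (Fin m) × Finset (Fin m)) :=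
  {p | p.1.card = l ∧ p.2.card = l ∧ Admissible p.1 p.2}

/-- The admissible pairs `(I, J)` with `|I| = |J| = l - 1`. -/
def admissiblePairsPred (m l : ℕ) : Set (Multiset (Fin m) × Finset (Fin m)) :=
  {p | p.1.card + 1 = l ∧ p.2.card + 1 = l ∧ Admissible p.1 p.2}

theorem admissiblePairsPred_zero : admissiblePairsPred m 0 = ∅ := by
  ext p; simp [admissiblePairsPred]

theorem admissiblePairsPred_succ (l : ℕ) :
    admissiblePairsPred m (l + 1) = admissiblePairs m l := by
  ext p; simp [admissiblePairsPred, admissiblePairs]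

theorem admissible_iff_of_isMax {I : Multiset (Fin m)} {J : Finset (Fin m)} {i : Fin m}
    (hi : i ∉ J) (hmax : ∀ j, j ∉ J → j ≤ i) : Admissible I J ↔ ∀ j ∈ I, j ≤ i := by
  have h : Jᶜ.max = (i : WithBot (Fin m)) := by
    refine le_antisymm (Finset.max_le fun j hj => ?_) (Finset.le_max (by simpa using hi))
    exact WithBot.coe_le_coe.2 (hmax j (by simpa using hj))
  rw [Admissible, h]
  constructor
  · intro h j hj
    exact WithBot.coe_le_coe.1 ((Finset.le_max (by simpa using hj)).trans h)
  · intro h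
    exact Finset.max_le fun j hj => WithBot.coe_le_coe.2 (h j (by simpa using hj))

theorem exists_isMax_compl {J : Finset (Fin m)} (h : J ≠ Finset.univ) :
    ∃ i, i ∉ J ∧ ∀ j, j ∉ J → j ≤ i := by
  have hne : Jᶜ.Nonempty := by
    rw [Finset.nonempty_iff_ne_empty]
    simpa using h
  exact ⟨Jᶜ.max' hne, by simpa using Jᶜ.max'_mem hne, fun j hj => Jᶜ.le_max' j (by simpa using hj)⟩

/-- For full J the complement has maximum -∞, which forces I to be empty against |I| = |J| = m ≥ 1.
So `enlarge` never takes its default value on admissible pairs. -/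
theorem ne_univ_of_admissible (hm : 1 ≤ m) {I : Multiset (Fin m)} {J : Finset (Fin m)}
    (hcard : I.card = J.card) (h : Admissible I J) : J ≠ Finset.univ := by
  rintro rfl
  rw [Admissible, Finset.compl_univ, Finset.max_empty, le_bot_iff, Finset.max_eq_bot,
    Multiset.toFinset_eq_empty] at h
  rw [h, Finset.card_univ, Fintype.card_fin, Multiset.card_zero] at hcard
  omega

open Classical in
/-- The pair obtained from `(I, J)` by adding the largest element of `Jᶜ` to both entries. -/
def enlarge (p : Multiset (Fin m) × Finset (Fin m)) : Multiset (Fin m) × Finset (Fin m) :=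
  if h : p.2 ≠ Finset.univ then
    ((exists_isMax_compl h).choose ::ₘ p.1, insert (exists_isMax_compl h).choose p.2)
  else p

theorem enlarge_eq {I : Multiset (Fin m)} {J : Finset (Fin m)} {i : Fin m}
    (hi : i ∉ J) (hmax : ∀ j, j ∉ J → j ≤ i) : enlarge (I, J) = (i ::ₘ I, insert i J) := by
  have h : J ≠ Finset.univ := by rintro rfl; exact hi (Finset.mem_univ i)
  have hc := (exists_isMax_compl h).choose_spec
  have : (exists_isMax_compl h).choose = i := le_antisymm (hmax _ hc.1) (hc.2 i hi)
  rw [enlarge, dif_pos h, this]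

/-- After i = max J^c has moved into J, every remaining element of the complement is below i, while
i now lies in the multiset. -/
theorem enlarge_mem (hm : 1 ≤ m) {l : ℕ} {p : Multiset (Fin m) × Finset (Fin m)}
    (hp : p ∈ admissiblePairsPred m l) : enlarge p ∈ pairs m l \ admissiblePairs m l := by
  obtain ⟨I, J⟩ := p
  obtain ⟨h1, h2, hadm⟩ := hp
  obtain ⟨i, hi, hmax⟩ := exists_isMax_compl
    (ne_univ_of_admissible hm (Nat.succ_injective (h1.trans h2.symm)) hadm)
  rw [enlarge_eq hi hmax]
  refine ⟨⟨?_, ?_⟩, ?_⟩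
  · rw [Multiset.card_cons]; exact h1
  · rw [Finset.card_insert_of_notMem hi]; exact h2
  · rintro ⟨h1', h2', hadm'⟩
    have hne := ne_univ_of_admissible hm (h1'.trans h2'.symm) hadm'
    obtain ⟨i', hi', hmax'⟩ := exists_isMax_compl hne
    have h3 := (admissible_iff_of_isMax hi' hmax').1 hadm' i (Multiset.mem_cons_self i I)
    rw [Finset.mem_insert, not_or] at hi'
    exact hi'.1 (le_antisymm (hmax i' hi'.2) h3)

/-- Admissibility bounds I by the added element, which is therefore recovered as the maximum of the
enlarged multiset. -/
theorem enlarge_injOn (hm : 1 ≤ m) (l : ℕ) : Set.InjOn enlarge (admissiblePairsPred m l) := by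
  rintro ⟨I, J⟩ ⟨h1, h2, hadm⟩ ⟨I', J'⟩ ⟨h1', h2', hadm'⟩ h
  obtain ⟨i, hi, hmax⟩ := exists_isMax_compl
    (ne_univ_of_admissible hm (Nat.succ_injective (h1.trans h2.symm)) hadm)
  obtain ⟨i', hi', hmax'⟩ := exists_isMax_compl
    (ne_univ_of_admissible hm (Nat.succ_injective (h1'.trans h2'.symm)) hadm')
  rw [enlarge_eq hi hmax, enlarge_eq hi' hmax', Prod.mk.injEq] at h
  rw [admissible_iff_of_isMax hi hmax] at hadm
  rw [admissible_iff_of_isMax hi' hmax'] at hadm'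
  have hii : i = i' := by
    refine le_antisymm ?_ ?_
    · have : i ∈ i' ::ₘ I' := h.1 ▸ Multiset.mem_cons_self i I
      rcases Multiset.mem_cons.1 this with h | h
      · exact h.le
      · exact hadm' i h
    · have : i' ∈ i ::ₘ I := h.1 ▸ Multiset.mem_cons_self i' I'
      rcases Multiset.mem_cons.1 this with h | h
      · exact h.le
      · exact hadm i' h
  subst hii
  have hJ : J = J' := (Finset.erase_insert hi).symm.trans
    ((congrArg (fun K => Finset.erase K i) h.2).trans (Finset.erase_insert hi'))
  rw [(Multiset.cons_inj_right i).1 h.1, hJ]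

/-- In a non-admissible pair i = max I exceeds every element of J^c, so i lies in J. Removing it
from both entries gives the preimage. -/
theorem exists_enlarge_eq {l : ℕ} {p : Multiset (Fin m) × Finset (Fin m)}
    (hp : p ∈ pairs m l) (hadm : p ∉ admissiblePairs m l) :
    ∃ q ∈ admissiblePairsPred m l, enlarge q = p := by
  obtain ⟨I, J⟩ := p
  obtain ⟨h1, h2⟩ := hp
  have hnot : ¬ I.toFinset.max ≤ Jᶜ.max := fun h => hadm ⟨h1, h2, h⟩
  have hne : I.toFinset.Nonempty := by
    rw [Finset.nonempty_iff_ne_empty]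
    intro h
    rw [h, Finset.max_empty] at hnot
    exact hnot bot_le
  obtain ⟨i, hi⟩ := Finset.max_of_nonempty hne
  have hiI : i ∈ I := by simpa using Finset.mem_of_max hi
  have hImax : ∀ j ∈ I, j ≤ i := fun j hj =>
    WithBot.coe_le_coe.1 (hi ▸ Finset.le_max (by simpa using hj))
  have hJ : ∀ j, j ∉ J → j < i := fun j hj => by
    rw [hi, not_le] at hnot
    exact WithBot.coe_lt_coe.1 ((Finset.le_max (by simpa using hj)).trans_lt hnot)
  have hiJ : i ∈ J := by
    by_contra h
    exact lt_irrefl i (hJ i h)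
  have hi' : i ∉ J.erase i := Finset.notMem_erase i J
  have hmax : ∀ j, j ∉ J.erase i → j ≤ i := fun j hj => by
    rw [Finset.mem_erase, not_and_or, not_not] at hj
    rcases hj with rfl | hj
    · exact le_rfl
    · exact (hJ j hj).le
  obtain ⟨I', rfl⟩ := Multiset.exists_cons_of_mem hiI
  have h1' : I'.card + 1 = l := by rw [← h1]; exact (Multiset.card_cons i I').symm
  refine ⟨(I', J.erase i), ⟨h1', ?_, ?_⟩, ?_⟩
  · exact (Finset.card_erase_add_one hiJ).trans h2
  · exact (admissible_iff_of_isMax hi' hmax).2 fun j hj => hImax j (Multiset.mem_cons_of_mem hj)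
  · rw [enlarge_eq hi' hmax, Finset.insert_erase hiJ]

/-- Adding an element of `Jᶜ` other than the largest preserves admissibility. -/
theorem cons_insert_mem {l : ℕ} {I : Multiset (Fin m)} {J : Finset (Fin m)} {i j : Fin m}
    (h : (I, J) ∈ admissiblePairsPred m l) (hi : i ∉ J) (hmax : ∀ j, j ∉ J → j ≤ i) (hj : j ∉ J)
    (hij : j ≠ i) : (j ::ₘ I, insert j J) ∈ admissiblePairs m l := by
  obtain ⟨h1, h2, hadm⟩ := h
  refine ⟨?_, ?_, ?_⟩
  · rw [Multiset.card_cons]; exact h1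
  · rw [Finset.card_insert_of_notMem hj]; exact h2
  · rw [admissible_iff_of_isMax hi hmax] at hadm
    have hi' : i ∉ insert j J := by
      rw [Finset.mem_insert, not_or]; exact ⟨hij.symm, hi⟩
    refine (admissible_iff_of_isMax hi' fun j' hj' => hmax j' ?_).2 fun j' hj' => ?_
    · exact fun h => hj' (Finset.mem_insert_of_mem h)
    · rcases Multiset.mem_cons.1 hj' with rfl | h
      · exact hmax j' hj
      · exact hadm j' h

/-- Admissible pairs of sizes `k - 1` and `k` together correspond to all pairs of size `k`. -/
theorem nonempty_equiv_pairs (hm : 1 ≤ m) (k : ℕ) :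
    Nonempty (AdmissiblePairPred m k ⊕ AdmissiblePair m k ≃ pairs m k) := by
  have hpred : ∀ p : AdmissiblePairPred m k, enlarge p.1 ∈ pairs m k \ admissiblePairs m k :=
    fun p => enlarge_mem hm p.2
  let φ : AdmissiblePairPred m k ⊕ AdmissiblePair m k → pairs m k :=
    Sum.elim (fun p => ⟨enlarge p.1, (hpred p).1⟩) fun p => ⟨p.1, p.2.1, p.2.2.1⟩
  refine ⟨Equiv.ofBijective φ ⟨?_, ?_⟩⟩
  · refine Function.Injective.sumElim ?_ ?_ ?_
    · exact fun p q h => Subtype.ext (enlarge_injOn hm k p.2 q.2 (congrArg Subtype.val h))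
    · exact fun p q h => Subtype.ext (congrArg (fun x : pairs m k => x.1) h)
    · intro p q h
      refine (hpred p).2 ?_
      have : enlarge p.1 = q.1 := congrArg Subtype.val h
      rw [this]
      exact q.2
  · rintro ⟨p, hp⟩
    by_cases hadm : p ∈ admissiblePairs m k
    · exact ⟨.inr ⟨p, hadm⟩, rfl⟩
    · obtain ⟨q, hq, rfl⟩ := exists_enlarge_eq hp hadm
      exact ⟨.inl ⟨q, hq⟩, rfl⟩

/-- Pairs of size k are a multiset and a subset of an m-element set, chosen independently. The
natural subtraction m + k - 1 is not truncated, since m ≥ 1. -/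
theorem nonempty_fin_equiv (hm : 1 ≤ m) (k : ℕ) :
    Nonempty (Fin (m.choose k * (m + k - 1).choose k) ≃
      AdmissiblePairPred m k ⊕ AdmissiblePair m k) := by
  obtain ⟨e⟩ := nonempty_equiv_pairs hm k
  let e' : pairs m k ≃ Sym (Fin m) k × {J : Finset (Fin m) // J.card = k} :=
    Equiv.subtypeProdEquivProd (p := fun I : Multiset (Fin m) => I.card = k)
      (q := fun J : Finset (Fin m) => J.card = k)
  have hcard : Fintype.card (Sym (Fin m) k × {J : Finset (Fin m) // J.card = k}) =
      m.choose k * (m + k - 1).choose k := by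
    rw [Fintype.card_prod, Sym.card_sym_eq_choose, Fintype.card_finset_len, Fintype.card_fin,
      mul_comm]
  exact ⟨((finCongr hcard.symm).trans (Fintype.equivFin _).symm).trans (e.trans e').symm⟩

end Pairs

theorem linearIndependent_smul_of_tower {A M ι ι' : Type*} [CommRing A] [Algebra ℝ A]
    [AddCommGroup M] [Module A M] [Module ℝ M] [IsScalarTower ℝ A M] {b : ι → A} {c : ι' → M}
    (hb : LinearIndependent ℝ b) (hc : LinearIndependent A c) :
    LinearIndependent ℝ fun p : ι × ι' => b p.1 • c p.2 :=
  linearIndependent_smul hb hc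

/-! ### Polynomial fields modulo the image of the Koszul operator -/

namespace BookAlgebra

variable {m : ℕ} {A : Type*} [CommRing A] [Algebra ℝ A] (S : BookAlgebra m A)

/-- The multivector field `u_I ∂_J`. -/
def polyField (p : Multiset (Fin m) × Finset (Fin m)) : FreeExt A (m + 1) :=
  S.monomial p.1 • genBasis A (m + 1) (p.2.map (Fin.succEmb m))

theorem zero_notMem_map_succ (J : Finset (Fin m)) : 0 ∉ J.map (Fin.succEmb m) := by
  simp [Fin.succ_ne_zero]

theorem linearIndependent_polyField : LinearIndependent ℝ S.polyField := by
  have hb : LinearIndependent A fun J : Finset (Fin m) =>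
      genBasis A (m + 1) (J.map (Fin.succEmb m)) :=
    (genBasis A (m + 1)).linearIndependent.comp _ (Finset.map_injective (Fin.succEmb m))
  have h := linearIndependent_smul_of_tower S.linearIndependent_monomial hb
  exact h

theorem contr_zero_polyField (p : Multiset (Fin m) × Finset (Fin m)) :
    contr A 0 (S.polyField p) = 0 := by
  rw [polyField, contr_smul, contr_basis_of_notMem (zero_notMem_map_succ _), smul_zero]

theorem polyField_mem_poly {l : ℕ} {p : Multiset (Fin m) × Finset (Fin m)} (hp : p ∈ pairs m l) :
    S.polyField p ∈ S.poly l := by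
  have hcard : (p.2.map (Fin.succEmb m)).card = l := (Finset.card_map _).trans hp.2
  rw [mem_poly]
  refine ⟨smul_mem_extDegree _ (hcard ▸ genBasis_mem _), ?_, ?_⟩
  · rw [polyField, dt, coeffD_smul_basis, S.der_zero_of_mem_homogeneous (S.monomial_mem _),
      zero_smul]
  · rw [polyField, lie_smul_basis, S.euler_of_mem_homogeneous (S.monomial_mem _),
      Finset.erase_eq_of_notMem (zero_notMem_map_succ _), hcard, hp.1, sub_self, zero_smul]

/-- The span of the `u_I ∂_J` with `(I, J)` in a given set. -/
def polySpan (s : Set (Multiset (Fin m) × Finset (Fin m))) : Submodule ℝ (FreeExt A (m + 1)) :=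
  Submodule.span ℝ (S.polyField '' s)

theorem polySpan_empty : S.polySpan ∅ = ⊥ := by
  rw [polySpan, Set.image_empty, Submodule.span_empty]

theorem polyField_mem_polySpan {s : Set (Multiset (Fin m) × Finset (Fin m))}
    {p : Multiset (Fin m) × Finset (Fin m)} (hp : p ∈ s) : S.polyField p ∈ S.polySpan s :=
  Submodule.subset_span ⟨p, hp, rfl⟩

theorem polySpan_mono {s t : Set (Multiset (Fin m) × Finset (Fin m))} (h : s ⊆ t) :
    S.polySpan s ≤ S.polySpan t := Submodule.span_mono (Set.image_mono h)

theorem admissiblePairs_subset (l : ℕ) : admissiblePairs m l ⊆ pairs m l :=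
  fun _ hp => ⟨hp.1, hp.2.1⟩

theorem polySpan_pairs_le (l : ℕ) : S.polySpan (pairs m l) ≤ S.poly l := by
  refine Submodule.span_le.2 ?_
  rintro _ ⟨p, hp, rfl⟩
  exact S.polyField_mem_poly hp

theorem contr_zero_of_mem_polySpan {s : Set (Multiset (Fin m) × Finset (Fin m))}
    {μ : FreeExt A (m + 1)} (h : μ ∈ S.polySpan s) : contr A 0 μ = 0 := by
  have : S.polySpan s ≤ LinearMap.ker (contr A (0 : Fin (m + 1))) := by
    refine Submodule.span_le.2 ?_
    rintro _ ⟨p, -, rfl⟩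
    exact S.contr_zero_polyField p
  exact this h

/-- Vanishing contraction with dt kills the coefficients with 0 in J. Each remaining coefficient is
homogeneous of degree |J|, hence a combination of monomials u_I with |I| = |J|. -/
theorem mem_polySpan_pairs {l : ℕ} {μ : FreeExt A (m + 1)} (h : μ ∈ S.poly l)
    (h0 : contr A 0 μ = 0) : μ ∈ S.polySpan (pairs m l) := by
  obtain ⟨hdeg, hhom⟩ := S.mem_poly_iff_repr.1 h
  rw [← (genBasis A (m + 1)).sum_repr μ]
  refine Submodule.sum_mem _ fun J _ => ?_
  by_cases hJ : J.card = l
  swap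
  · rw [mem_extDegree_iff.1 hdeg J hJ, zero_smul]; exact Submodule.zero_mem _
  by_cases hJ0 : 0 ∈ J
  · have := repr_wedge_contr μ J
    rw [h0, map_zero, map_zero, if_pos hJ0, Finsupp.zero_apply] at this
    rw [← this, zero_smul]; exact Submodule.zero_mem _
  · obtain ⟨K, rfl⟩ : ∃ K : Finset (Fin m), K.map (Fin.succEmb m) = J := by
      refine ⟨Finset.univ.filter fun j => j.succ ∈ J, ?_⟩
      ext i
      refine Fin.cases ?_ (fun j => ?_) i
      · simp [Fin.succ_ne_zero, hJ0]
      · simp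
    have hf := hhom (K.map (Fin.succEmb m))
    rw [Finset.erase_eq_of_notMem hJ0, hJ] at hf
    have hle : S.homogeneous l ≤ (S.polySpan (pairs m l)).comap
        ((LinearMap.toSpanSingleton A _
          (genBasis A (m + 1) (K.map (Fin.succEmb m)))).restrictScalars ℝ) := by
      refine Submodule.span_le.2 ?_
      rintro _ ⟨I, hI, rfl⟩
      exact S.polyField_mem_polySpan (p := (I, K))
        ⟨hI, (Finset.card_map (Fin.succEmb m)).symm.trans hJ⟩
    exact hle hf

theorem exists_coord_wedge_polyField {I : Multiset (Fin m)} {J : Finset (Fin m)} {j : Fin m}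
    (hj : j ∉ J) : ∃ ε : ℝ, ε ≠ 0 ∧ S.coord j • wedge A j.succ (S.polyField (I, J)) =
      ε • S.polyField (j ::ₘ I, insert j J) := by
  have hj' : j.succ ∉ J.map (Fin.succEmb m) := by simpa using hj
  obtain ⟨ε, hε, h⟩ := gen_mul_genBasis (A := A) hj'
  refine ⟨ε, fun h0 => by simp [h0] at hε, ?_⟩
  rw [polyField, polyField, wedge_smul, wedge_apply, h, Finset.map_insert, monomial_cons,
    smul_smul, smul_comm ε]
  rfl

theorem coord_wedge_polyField_of_mem {I : Multiset (Fin m)} {J : Finset (Fin m)} {j : Fin m}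
    (hj : j ∈ J) : S.coord j • wedge A j.succ (S.polyField (I, J)) = 0 := by
  have hj' : j.succ ∈ J.map (Fin.succEmb m) := by simpa using hj
  rw [polyField, wedge_smul, wedge_apply, gen_mul_genBasis_of_mem hj', smul_zero, smul_zero]

theorem koszul_apply (μ : FreeExt A (m + 1)) :
    S.koszul μ = ∑ j : Fin m, S.coord j • wedge A j.succ μ := by
  rw [koszul, CanonicalRelations.koszul, LinearMap.sum_apply]
  rfl

/-- Up to admissible fields, the Koszul operator acts on admissible fields by enlarging the
pairs. -/
theorem exists_koszul_polyField (hm : 1 ≤ m) {l : ℕ} {p : Multiset (Fin m) × Finset (Fin m)}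
    (hp : p ∈ admissiblePairsPred m l) :
    ∃ ε : ℝ, ε ≠ 0 ∧ ∃ r ∈ S.polySpan (admissiblePairs m l),
      S.koszul (S.polyField p) = ε • S.polyField (enlarge p) + r := by
  obtain ⟨I, J⟩ := p
  obtain ⟨i, hi, hmax⟩ := exists_isMax_compl
    (ne_univ_of_admissible hm (Nat.succ_injective (hp.1.trans hp.2.1.symm)) hp.2.2)
  change i ∉ J at hi
  change ∀ j, j ∉ J → j ≤ i at hmax
  obtain ⟨ε, hε, h⟩ := S.exists_coord_wedge_polyField (I := I) hi
  refine ⟨ε, hε, ∑ j ∈ Finset.univ.erase i, S.coord j • wedge A j.succ (S.polyField (I, J)),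
    Submodule.sum_mem _ fun j hj => ?_, ?_⟩
  · by_cases hjJ : j ∈ J
    · rw [S.coord_wedge_polyField_of_mem hjJ]; exact Submodule.zero_mem _
    · obtain ⟨ε', -, h'⟩ := S.exists_coord_wedge_polyField (I := I) hjJ
      rw [h']
      exact Submodule.smul_mem _ _ (S.polyField_mem_polySpan
        (cons_insert_mem hp hi hmax hjJ (Finset.ne_of_mem_erase hj)))
  · rw [koszul_apply, enlarge_eq hi hmax, ← h]
    exact (Finset.add_sum_erase _ (fun j => S.coord j • wedge A j.succ (S.polyField (I, J)))
      (Finset.mem_univ i)).symm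

/-- A non-admissible pair is an enlarged one, and the relation in `exists_koszul_polyField` can be
solved for its field. -/
theorem polySpan_pairs_le_sup (hm : 1 ≤ m) (l : ℕ) : S.polySpan (pairs m l) ≤
    S.polySpan (admissiblePairs m l) ⊔ (S.polySpan (admissiblePairsPred m l)).map S.koszul := by
  refine Submodule.span_le.2 ?_
  rintro _ ⟨p, hp, rfl⟩
  by_cases hadm : p ∈ admissiblePairs m l
  · exact Submodule.mem_sup_left (S.polyField_mem_polySpan hadm)
  · obtain ⟨q, hq, rfl⟩ := exists_enlarge_eq hp hadm
    obtain ⟨ε, hε, r, hr, h⟩ := S.exists_koszul_polyField hm hq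
    have : S.polyField (enlarge q) = ε⁻¹ • (S.koszul (S.polyField q) - r) := by
      rw [h, add_sub_cancel_right, smul_smul, inv_mul_cancel₀ hε, one_smul]
    rw [this]
    exact Submodule.smul_mem _ _ (Submodule.sub_mem _
      (Submodule.mem_sup_right ⟨_, S.polyField_mem_polySpan hq, rfl⟩) (Submodule.mem_sup_left hr))

theorem exists_add_koszul (hm : 1 ≤ m) {l : ℕ} {μ : FreeExt A (m + 1)}
    (h : μ ∈ S.polySpan (pairs m l)) : ∃ a ∈ S.polySpan (admissiblePairs m l),
      ∃ y ∈ S.polySpan (admissiblePairsPred m l), μ = a + S.koszul y := by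
  obtain ⟨a, ha, _, ⟨y, hy, rfl⟩, hsum⟩ := Submodule.mem_sup.1 (S.polySpan_pairs_le_sup hm l h)
  exact ⟨a, ha, y, hy, hsum.symm⟩

/-- Modulo admissible fields, K y has the coefficients of y, up to nonzero factors, on the distinct
enlarged pairs. These are non-admissible, so the coefficients must all vanish. -/
theorem eq_zero_of_koszul_mem (hm : 1 ≤ m) {l : ℕ} {y : FreeExt A (m + 1)}
    (hy : y ∈ S.polySpan (admissiblePairsPred m l))
    (h : S.koszul y ∈ S.polySpan (admissiblePairs m l)) : y = 0 := by
  choose ε hε r hr hk using fun p : admissiblePairsPred m l => S.exists_koszul_polyField hm p.2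
  have hli : LinearIndependent ℝ
      (fun p : admissiblePairsPred m l => ε p • S.polyField (enlarge p.1)) :=
    (S.linearIndependent_polyField.comp (fun p : admissiblePairsPred m l => enlarge p.1)
      fun p q hpq => Subtype.ext (enlarge_injOn hm l p.2 q.2 hpq)).units_smul
      fun p => Units.mk0 (ε p) (hε p)
  rw [polySpan, Set.image_eq_range, Finsupp.mem_span_range_iff_exists_finsupp] at hy
  obtain ⟨c, rfl⟩ := hy
  have hz : (c.sum fun p a => a • ε p • S.polyField (enlarge p.1)) ∈
      S.polySpan (admissiblePairs m l) := by
    have heq : (c.sum fun p a => a • ε p • S.polyField (enlarge p.1)) =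
        S.koszul (c.sum fun p a => a • S.polyField p.1) - c.sum fun p a => a • r p := by
      rw [Finsupp.sum, Finsupp.sum, Finsupp.sum, map_sum, ← Finset.sum_sub_distrib]
      refine Finset.sum_congr rfl fun p _ => ?_
      rw [map_smul, hk p, smul_add, add_sub_cancel_right]
    rw [heq]
    exact Submodule.sub_mem _ h (Submodule.sum_mem _ fun p _ => Submodule.smul_mem _ _ (hr p))
  have hz' : (c.sum fun p a => a • ε p • S.polyField (enlarge p.1)) ∈
      S.polySpan (pairs m l \ admissiblePairs m l) :=
    Submodule.sum_mem _ fun p _ => Submodule.smul_mem _ _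
      (Submodule.smul_mem _ _ (S.polyField_mem_polySpan (enlarge_mem hm p.2)))
  have hdisj := S.linearIndependent_polyField.disjoint_span_image
    (s := admissiblePairs m l) (t := pairs m l \ admissiblePairs m l) Set.disjoint_sdiff_right
  have hzero := Submodule.disjoint_def.1 hdisj _ hz hz'
  have hc : c = 0 := linearIndependent_iff.1 hli c hzero
  rw [hc, Finsupp.sum_zero_index]

/-- Since K² = 0, y may be replaced by its admissible part, to which `eq_zero_of_koszul_mem`
applies. -/
theorem koszul_eq_zero_of_mem (hm : 1 ≤ m) {l : ℕ} {y : FreeExt A (m + 1)}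
    (hy : y ∈ S.polySpan (pairs m l))
    (h : S.koszul y ∈ S.polySpan (admissiblePairs m (l + 1))) : S.koszul y = 0 := by
  obtain ⟨a, ha, z, -, rfl⟩ := S.exists_add_koszul hm hy
  rw [map_add, koszul_koszul, add_zero] at h ⊢
  rw [S.eq_zero_of_koszul_mem hm (l := l + 1) (by rwa [admissiblePairsPred_succ]) h, map_zero]

/-! #### The cohomology -/

theorem mem_of_mem_polySpan_pred {k : ℕ} {a : FreeExt A (m + 1)}
    (ha : a ∈ S.polySpan (admissiblePairsPred m k)) :
    wedge A 0 a ∈ S.poly k ∧ S.koszul a ∈ S.cob k ∧ S.koszul (wedge A 0 a) ∈ S.cob (k + 1) := by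
  cases k with
  | zero =>
    rw [admissiblePairsPred_zero, polySpan_empty, Submodule.mem_bot] at ha
    rw [ha, map_zero, map_zero]
    exact ⟨Submodule.zero_mem _, Submodule.zero_mem _, Submodule.zero_mem _⟩
  | succ k =>
    rw [admissiblePairsPred_succ] at ha
    have ha' := S.polySpan_pairs_le k (S.polySpan_mono (admissiblePairs_subset k) ha)
    exact ⟨S.wedge_zero_mem_poly ha', S.koszul_mem_cob ha',
      S.koszul_mem_cob (S.wedge_zero_mem_poly ha')⟩

theorem contr_contr_zero (μ : FreeExt A (m + 1)) : contr A 0 (contr A 0 μ) = 0 :=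
  LinearMap.congr_fun (contr_self (A := A) (0 : Fin (m + 1))) μ

theorem contr_zero_add {a b : FreeExt A (m + 1)} (ha : contr A 0 a = 0) (hb : contr A 0 b = 0) :
    contr A 0 (wedge A 0 a + b) = a := by
  rw [map_add, contr_wedge_zero, ha, hb, map_zero, sub_zero, add_zero]

/-- The admissible fields are independent modulo coboundaries. -/
theorem eq_zero_of_mem_cob (hm : 1 ≤ m) {k : ℕ} {a b : FreeExt A (m + 1)}
    (ha : a ∈ S.polySpan (admissiblePairsPred m k)) (hb : b ∈ S.polySpan (admissiblePairs m k))
    (h : wedge A 0 a + b ∈ S.cob k) : a = 0 ∧ b = 0 := by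
  have hsplit := contr_zero_add (S.contr_zero_of_mem_polySpan ha)
    (S.contr_zero_of_mem_polySpan hb)
  cases k with
  | zero =>
    rw [cob, Submodule.mem_bot] at h
    rw [h, map_zero] at hsplit
    rw [← hsplit, map_zero, zero_add] at h
    exact ⟨hsplit.symm, h⟩
  | succ k =>
    have hpoly : wedge A 0 a + b ∈ S.poly (k + 1) := Submodule.add_mem _
      (S.mem_of_mem_polySpan_pred ha).1
      (S.polySpan_pairs_le _ (S.polySpan_mono (admissiblePairs_subset _) hb))
    obtain ⟨σ, hσ, hσk⟩ := S.exists_koszul_eq hm hpoly h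
    -- Comparing the components of Kσ with and without ∂_t shows that a and b are separately in the
    -- image of K.
    have ha' : a = S.koszul (-contr A 0 σ) := by
      rw [map_neg, ← contr_zero_koszul, hσk, hsplit]
    have hb' : b = S.koszul (contr A 0 (wedge A 0 σ)) := by
      have : S.koszul (contr A 0 (wedge A 0 σ)) =
          contr A 0 (wedge A 0 (wedge A 0 a + b)) := by
        rw [← hσk, wedge_zero_koszul, map_neg, contr_zero_koszul, neg_neg]
      rw [this, contr_wedge_zero, hsplit, add_sub_cancel_left]
    constructor
    · rw [admissiblePairsPred_succ] at ha
      cases k with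
      | zero => rw [ha', contr_eq_zero 0 (S.mem_poly.1 hσ).1, neg_zero, map_zero]
      | succ k =>
        rw [ha'] at ha ⊢
        exact S.koszul_eq_zero_of_mem hm (Submodule.neg_mem _
          (S.mem_polySpan_pairs (S.contr_zero_mem_poly hσ) (contr_contr_zero σ))) ha
    · rw [hb'] at hb ⊢
      exact S.koszul_eq_zero_of_mem hm (S.mem_polySpan_pairs
        (S.contr_zero_mem_poly (S.wedge_zero_mem_poly hσ)) (contr_contr_zero _)) hb

/-- The admissible fields span the cocycles modulo coboundaries. -/
theorem exists_admissible_add_cob (hm : 1 ≤ m) {k : ℕ} {μ : FreeExt A (m + 1)}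
    (hμ : μ ∈ extDegree A (m + 1) k) (hd : S.d μ = 0) :
    ∃ a ∈ S.polySpan (admissiblePairsPred m k), ∃ b ∈ S.polySpan (admissiblePairs m k),
      μ - (wedge A 0 a + b) ∈ S.cob k := by
  obtain ⟨τ, hτ, ν, hν, rfl⟩ := S.exists_poly_add_cob hm hμ hd
  -- Contracting ∂_t ∧ τ with dt isolates the part of τ free of ∂_t. The rest is ∂_t wedged with the
  -- contraction of τ, and both parts are reduced modulo the image of K.
  obtain ⟨b, hb, y, hy, hby⟩ := S.exists_add_koszul hm (S.mem_polySpan_pairs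
    (S.contr_zero_mem_poly (S.wedge_zero_mem_poly hτ)) (contr_contr_zero _))
  obtain ⟨a, ha, hac⟩ : ∃ a ∈ S.polySpan (admissiblePairsPred m k),
      wedge A 0 (contr A 0 τ) - wedge A 0 a ∈ S.cob k := by
    cases k with
    | zero =>
      refine ⟨0, Submodule.zero_mem _, ?_⟩
      rw [contr_eq_zero 0 (S.mem_poly.1 hτ).1, sub_self]
      exact Submodule.zero_mem _
    | succ k =>
      obtain ⟨a, ha, z, hz, haz⟩ := S.exists_add_koszul hm
        (S.mem_polySpan_pairs (S.contr_zero_mem_poly hτ) (contr_contr_zero τ))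
      refine ⟨a, by rwa [admissiblePairsPred_succ], ?_⟩
      rw [haz, map_add, add_sub_cancel_left, wedge_zero_koszul]
      exact Submodule.neg_mem _ (S.mem_of_mem_polySpan_pred hz).2.2
  refine ⟨a, ha, b, hb, ?_⟩
  have : τ + ν - (wedge A 0 a + b) =
      (wedge A 0 (contr A 0 τ) - wedge A 0 a) + S.koszul y + ν := by
    have h1 : τ = wedge A 0 (contr A 0 τ) + (b + S.koszul y) := by
      rw [← hby, contr_wedge_zero, add_sub_cancel]
    conv_lhs => rw [h1]
    abel
  rw [this]
  exact Submodule.add_mem _ (Submodule.add_mem _ hac (S.mem_of_mem_polySpan_pred hy).2.1) hν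

end BookAlgebra

/-! ### The Schouten bracket with the book bivector -/

namespace BookAlgebra

variable {m : ℕ} {A : Type*} [CommRing A] [Algebra ℝ A] (S : BookAlgebra m A)

/-- The bivector `∂/∂t ∧ E`. -/
def bivector : FreeExt A (m + 1) := gen A 0 * ∑ j : Fin m, S.coord j • gen A j.succ

/-- The Schouten bracket `[P, ·]` in coordinates. -/
def bracket (P : FreeExt A (m + 1)) : Module.End ℝ (FreeExt A (m + 1)) :=
  ∑ i : Fin (m + 1),
    (LinearMap.mulLeft ℝ (CliffordAlgebra.contractRight P
        (LinearMap.proj i : (Fin (m + 1) → A) →ₗ[A] A)) ∘ₗ coeffD (m + 1) (S.der i) -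
      LinearMap.mulLeft ℝ (coeffD (m + 1) (S.der i) P) ∘ₗ contr A i)

theorem contractRight_gen_mul_gen {A : Type*} [CommRing A] (i j k : Fin (m + 1)) :
    CliffordAlgebra.contractRight (gen A j * gen A k)
        (LinearMap.proj i : (Fin (m + 1) → A) →ₗ[A] A) =
      (if k = i then (1 : A) else 0) • gen A j - (if j = i then (1 : A) else 0) • gen A k := by
  have h1 := CliffordAlgebra.contractRight_mul_ι (Q := (0 : QuadraticForm A (Fin (m + 1) → A)))
    (LinearMap.proj i : (Fin (m + 1) → A) →ₗ[A] A) (Pi.single k 1) (gen A j)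
  have h2 := CliffordAlgebra.contractRight_ι (Q := (0 : QuadraticForm A (Fin (m + 1) → A)))
    (LinearMap.proj i : (Fin (m + 1) → A) →ₗ[A] A) (Pi.single j 1)
  have hp : ∀ l : Fin (m + 1), (LinearMap.proj i : (Fin (m + 1) → A) →ₗ[A] A) (Pi.single l 1) =
      if l = i then (1 : A) else 0 := fun l => by
    rw [LinearMap.proj_apply, Pi.single_apply]
    exact if_congr eq_comm rfl rfl
  rw [hp] at h1 h2
  refine h1.trans ?_
  congr 1
  rw [Algebra.smul_def]
  exact congrArg (· * gen A k) h2

theorem coeffD_gen (D : Derivation ℝ A A) (i : Fin (m + 1)) : coeffD (m + 1) D (gen A i) = 0 := by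
  rw [← genBasis_singleton, coeffD_basis]

theorem bivector_eq_sum : S.bivector = ∑ j : Fin m, S.coord j • (gen A 0 * gen A j.succ) := by
  rw [bivector, Finset.mul_sum]
  exact Finset.sum_congr rfl fun j _ => mul_smul_comm _ _ _

theorem contractRight_bivector (i : Fin (m + 1)) :
    CliffordAlgebra.contractRight S.bivector (LinearMap.proj i : (Fin (m + 1) → A) →ₗ[A] A) =
      ∑ j : Fin m, S.coord j • ((if j.succ = i then (1 : A) else 0) • gen A 0 -
        (if 0 = i then (1 : A) else 0) • gen A j.succ) := by
  rw [bivector_eq_sum]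
  have := map_sum ((CliffordAlgebra.contractRight
    (Q := (0 : QuadraticForm A (Fin (m + 1) → A)))).flip
    (LinearMap.proj i : (Fin (m + 1) → A) →ₗ[A] A))
    (fun j : Fin m => S.coord j • (gen A 0 * gen A j.succ)) Finset.univ
  refine this.trans (Finset.sum_congr rfl fun j _ => ?_)
  rw [map_smul]
  exact congrArg (S.coord j • ·) (contractRight_gen_mul_gen i 0 j.succ)

theorem coeffD_bivector (i : Fin (m + 1)) : coeffD (m + 1) (S.der i) S.bivector =
    ∑ j : Fin m, S.der i (S.coord j) • (gen A 0 * gen A j.succ) := by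
  rw [bivector_eq_sum, map_sum]
  refine Finset.sum_congr rfl fun j _ => ?_
  have h : coeffD (m + 1) (S.der i) (wedge A 0 (gen A j.succ)) = 0 := by
    rw [← Module.End.mul_apply, coeffD_wedge, Module.End.mul_apply, coeffD_gen, map_zero]
  rw [coeffD_smul]
  rw [wedge_apply] at h
  rw [h, smul_zero, add_zero]

/-- The right contraction of Λ is -E for dt and u_i ∂_t for du_i. The only nonzero coefficient
derivatives of Λ are ∂Λ/∂u_i = ∂_t ∧ ∂_{u_i}. These give -K ∂/∂t and the two halves of ∂_t ∧ L. -/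
theorem bracket_bivector : S.bracket S.bivector = S.d := by
  refine LinearMap.ext fun μ => ?_
  have hlie : S.lie μ = (∑ j : Fin m, S.coord j • coeffD (m + 1) (S.der j.succ) μ) -
      ∑ j : Fin m, gen A j.succ * contr A j.succ μ := by
    rw [lie, CanonicalRelations.lie, LinearMap.sub_apply, CanonicalRelations.euler,
      CanonicalRelations.num, LinearMap.sum_apply, LinearMap.sum_apply]
    rfl
  have h0 : CliffordAlgebra.contractRight S.bivector
      (LinearMap.proj 0 : (Fin (m + 1) → A) →ₗ[A] A) = -∑ j : Fin m, S.coord j • gen A j.succ := by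
    rw [contractRight_bivector, ← Finset.sum_neg_distrib]
    refine Finset.sum_congr rfl fun j _ => ?_
    rw [if_neg (Fin.succ_ne_zero j), if_pos rfl, zero_smul, one_smul, zero_sub, smul_neg]
  have h1 : ∀ i : Fin m, CliffordAlgebra.contractRight S.bivector
      (LinearMap.proj i.succ : (Fin (m + 1) → A) →ₗ[A] A) = S.coord i • gen A 0 := fun i => by
    rw [contractRight_bivector, Finset.sum_eq_single i]
    · rw [if_pos rfl, if_neg (Fin.succ_ne_zero i).symm, zero_smul, one_smul, sub_zero]
    · intro j _ hj
      rw [if_neg fun h => hj (Fin.succ_injective _ h), if_neg (Fin.succ_ne_zero i).symm, zero_smul,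
        zero_smul, sub_zero, smul_zero]
    · exact fun h => absurd (Finset.mem_univ i) h
  have h2 : coeffD (m + 1) (S.der 0) S.bivector = 0 := by
    rw [coeffD_bivector]
    exact Finset.sum_eq_zero fun j _ => by rw [der_zero_coord, zero_smul]
  have h3 : ∀ i : Fin m, coeffD (m + 1) (S.der i.succ) S.bivector = gen A 0 * gen A i.succ :=
    fun i => by
      rw [coeffD_bivector, Finset.sum_eq_single i]
      · rw [der_succ_coord, if_pos rfl, one_smul]
      · intro j _ hj
        rw [der_succ_coord, if_neg hj.symm, zero_smul]
      · exact fun h => absurd (Finset.mem_univ i) h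
  rw [bracket, LinearMap.sum_apply, Fin.sum_univ_succ, d_apply, hlie, koszul_apply, wedge_apply,
    mul_sub, Finset.mul_sum, Finset.mul_sum]
  simp only [LinearMap.sub_apply, LinearMap.comp_apply, LinearMap.mulLeft_apply, h0, h1, h2, h3,
    Finset.sum_sub_distrib, zero_mul, sub_zero, neg_mul, Finset.sum_mul, wedge_apply]
  rw [neg_add_eq_sub, dt]
  congr 1
  · congr 1
    · exact Finset.sum_congr rfl fun j _ => by rw [smul_mul_assoc, mul_smul_comm]
    · exact Finset.sum_congr rfl fun j _ => mul_assoc _ _ _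
  · exact Finset.sum_congr rfl fun j _ => smul_mul_assoc _ _ _

end BookAlgebra

/-! ### Bases of quotients -/

/-- Reduces a basis of a subquotient to statements about representatives in the ambient space. -/
theorem exists_basis_quotient {V ι : Type*} [AddCommGroup V] [Module ℝ V] [Fintype ι]
    {Z B : Submodule ℝ V} {v : ι → V} (hv : ∀ i, v i ∈ Z)
    (hli : ∀ c : ι → ℝ, ∑ i, c i • v i ∈ B → c = 0)
    (hspan : ∀ z ∈ Z, ∃ c : ι → ℝ, z - ∑ i, c i • v i ∈ B) :
    ∃ b : Module.Basis ι ℝ (Z ⧸ B.submoduleOf Z),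
      ∀ i, b i = Submodule.Quotient.mk ⟨v i, hv i⟩ := by
  let w : ι → Z ⧸ B.submoduleOf Z := fun i => Submodule.Quotient.mk ⟨v i, hv i⟩
  have hw : ∀ c : ι → ℝ, ∑ i, c i • w i =
      Submodule.Quotient.mk (∑ i, c i • (⟨v i, hv i⟩ : Z)) := fun c => by
    rw [← Submodule.mkQ_apply, map_sum]
    exact Finset.sum_congr rfl fun i _ => (map_smul (B.submoduleOf Z).mkQ _ _).symm
  have hcoe : ∀ c : ι → ℝ, ((∑ i, c i • (⟨v i, hv i⟩ : Z) : Z) : V) = ∑ i, c i • v i :=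
    fun c => by
      rw [← Submodule.subtype_apply, map_sum]
      rfl
  have h1 : LinearIndependent ℝ w := by
    rw [Fintype.linearIndependent_iff]
    intro c hc
    rw [hw, Submodule.Quotient.mk_eq_zero, Submodule.submoduleOf, Submodule.mem_comap,
      Submodule.subtype_apply, hcoe] at hc
    exact congrFun (hli c hc)
  have h2 : ⊤ ≤ Submodule.span ℝ (Set.range w) := by
    rintro x -
    obtain ⟨z, rfl⟩ := Submodule.Quotient.mk_surjective _ x
    obtain ⟨c, hc⟩ := hspan z z.2
    rw [Submodule.mem_span_range_iff_exists_fun]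
    refine ⟨c, ?_⟩
    rw [hw]
    refine ((Submodule.Quotient.eq _).2 ?_).symm
    rw [Submodule.submoduleOf, Submodule.mem_comap, Submodule.subtype_apply, Submodule.coe_sub,
      hcoe]
    exact hc
  exact ⟨Module.Basis.mk h1 h2, fun i => Module.Basis.mk_apply h1 h2 i⟩

/-! ### A basis of the cohomology of a book algebra. -/

namespace BookAlgebra

variable {m : ℕ} {A : Type*} [CommRing A] [Algebra ℝ A] (S : BookAlgebra m A)

/-- The fields `∂/∂t ∧ u_{I'} ∂_{J'}` and `u_I ∂_J` of admissible pairs. -/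
def admissibleField (k : ℕ) : AdmissiblePairPred m k ⊕ AdmissiblePair m k → FreeExt A (m + 1) :=
  Sum.elim (fun p => wedge A 0 (S.polyField p.1)) fun p => S.polyField p.1

theorem admissibleField_mem {k : ℕ} (i : AdmissiblePairPred m k ⊕ AdmissiblePair m k) :
    S.admissibleField k i ∈ extDegree A (m + 1) k ⊓ LinearMap.ker S.d := by
  have h : S.admissibleField k i ∈ S.poly k := by
    rcases i with p | p
    · exact (S.mem_of_mem_polySpan_pred
        (S.polyField_mem_polySpan (s := admissiblePairsPred m k) p.2)).1
    · exact S.polyField_mem_poly (admissiblePairs_subset k p.2)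
  exact ⟨(S.mem_poly.1 h).1, S.d_eq_zero_of_mem_poly h⟩

theorem exists_basis_cohomology (hm : 1 ≤ m) (k : ℕ) :
    ∃ b : Module.Basis (AdmissiblePairPred m k ⊕ AdmissiblePair m k) ℝ
        (((extDegree A (m + 1) k ⊓ LinearMap.ker S.d : Submodule ℝ (FreeExt A (m + 1)))) ⧸
          (S.cob k).submoduleOf (extDegree A (m + 1) k ⊓ LinearMap.ker S.d)),
      ∀ i, b i = Submodule.Quotient.mk ⟨S.admissibleField k i, S.admissibleField_mem i⟩ := by
  obtain ⟨e⟩ := nonempty_fin_equiv hm k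
  -- Finiteness of both index types is read off from the counting bijection, as multisets of bounded
  -- size are not visibly finite.
  have : Fintype (AdmissiblePairPred m k) := 
    Fintype.ofInjective 
      (fun p => e.symm (.inl p)) (e.symm.injective.comp Sum.inl_injective)
  have : Fintype (AdmissiblePair m k) := 
    Fintype.ofInjective 
      (fun p => e.symm (.inr p)) (e.symm.injective.comp Sum.inr_injective)
  have hsum : ∀ c : AdmissiblePairPred m k ⊕ AdmissiblePair m k → ℝ,
      ∑ i, c i • S.admissibleField k i =
        wedge A 0 (∑ p : AdmissiblePairPred m k, c (.inl p) • S.polyField p.1) +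
          ∑ p : AdmissiblePair m k, c (.inr p) • S.polyField p.1 := fun c => by
    rw [Fintype.sum_sum_type, map_sum]
    congr 1
    exact Finset.sum_congr rfl fun p _ => (map_smul (wedge A (0 : Fin (m + 1))) _ _).symm
  refine exists_basis_quotient S.admissibleField_mem (fun c hc => ?_) fun z hz => ?_
  · rw [hsum] at hc
    obtain ⟨ha, hb⟩ := S.eq_zero_of_mem_cob hm
      (Submodule.sum_mem _ fun p _ => Submodule.smul_mem _ _ (S.polyField_mem_polySpan p.2))
      (Submodule.sum_mem _ fun p _ => Submodule.smul_mem _ _ (S.polyField_mem_polySpan p.2)) hc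
    have h1 := Fintype.linearIndependent_iff.1 (S.linearIndependent_polyField.comp
      (fun p : AdmissiblePairPred m k => p.1) Subtype.val_injective) _ ha
    have h2 := Fintype.linearIndependent_iff.1 (S.linearIndependent_polyField.comp
      (fun p : AdmissiblePair m k => p.1) Subtype.val_injective) _ hb
    funext i
    rcases i with p | p
    · exact h1 p
    · exact h2 p
  · obtain ⟨a, ha, b, hb, h⟩ := S.exists_admissible_add_cob hm hz.1 hz.2
    rw [polySpan, Set.image_eq_range] at ha hb
    replace ha := (Submodule.mem_span_range_iff_exists_fun ℝ
      (v := fun p : AdmissiblePairPred m k => S.polyField p.1)).1 ha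
    replace hb := (Submodule.mem_span_range_iff_exists_fun ℝ
      (v := fun p : AdmissiblePair m k => S.polyField p.1)).1 hb
    obtain ⟨c, rfl⟩ := ha
    obtain ⟨c', rfl⟩ := hb
    refine ⟨Sum.elim c c', ?_⟩
    rw [hsum]
    exact h

end BookAlgebra

/-! ### The book algebra of smooth functions -/

section Concrete

variable {m : ℕ} {U : Opens (Fin (m + 1) → ℝ)}

theorem exists_proj_eq_zero (hne : (U : Set (Fin (m + 1) → ℝ)).Nonempty)
    (hstar : StarConvex ℝ 0 (base U : Set (Fin m → ℝ))) : ∃ x : U, proj m x = 0 := by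
  obtain ⟨x, hx, h0⟩ : (0 : Fin m → ℝ) ∈ base U :=
    hstar.mem (hne.image (proj m))
  exact ⟨⟨x, hx⟩, h0⟩

/-- The partial derivative as a derivation of `C^∞(U)`. -/
def partialDerivation {d : ℕ} (U : Opens (Fin d → ℝ)) (i : Fin d) :
    Derivation ℝ (SmoothFun U) (SmoothFun U) :=
  Derivation.mk' (partialDeriv U i) fun f g => by
    rw [partialDeriv_mul, smul_eq_mul, smul_eq_mul, add_comm, mul_comm g]

theorem aeval_coordFun_coe (p : MvPolynomial (Fin m) ℝ) (x : U) :
    ((MvPolynomial.aeval (fun j : Fin m => coordFun U j.succ) p : SmoothFun U) : U → ℝ) x =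
      MvPolynomial.eval (proj m x) p := by
  have h : ((Pi.evalAlgHom ℝ (fun _ : U => ℝ) x).comp (SmoothFun U).val).comp
      (MvPolynomial.aeval (R := ℝ) fun j : Fin m => coordFun U j.succ) =
      MvPolynomial.aeval (proj m x) := by
    ext j
    simp only [AlgHom.comp_apply, MvPolynomial.aeval_X]
    rfl
  refine (AlgHom.congr_fun h p).trans ?_
  rw [MvPolynomial.aeval_eq_eval]

/-- The base is open, so it contains a ball of the sup norm, a product of infinite sets. A
polynomial is determined by its values there. -/
theorem aeval_coordFun_injective (hne : (U : Set (Fin (m + 1) → ℝ)).Nonempty) :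
    Function.Injective (MvPolynomial.aeval (R := ℝ) fun j : Fin m => coordFun U j.succ) := by
  intro p q h
  obtain ⟨x, hx⟩ := hne
  obtain ⟨ε, hε, hball⟩ := Metric.isOpen_iff.1 (base U).isOpen _ (proj_mem_base hx)
  refine MvPolynomial.funext_set (fun j => Metric.ball (proj m x j) ε) (fun j => ?_)
    fun u hu => ?_
  · rw [Real.ball_eq_Ioo]
    exact Set.Ioo_infinite (by linarith)
  · rw [← ball_pi _ hε] at hu
    obtain ⟨y, hy, rfl⟩ := hball hu
    rw [← aeval_coordFun_coe p ⟨y, hy⟩, ← aeval_coordFun_coe q ⟨y, hy⟩, h]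

/-- The smooth functions on `U` form a book algebra. -/
def smoothBookAlgebra (h : ConnectedFibres U) (hne : (U : Set (Fin (m + 1) → ℝ)).Nonempty)
    (hstar : StarConvex ℝ 0 (base U : Set (Fin m → ℝ))) : BookAlgebra m (SmoothFun U) where
  der := partialDerivation U
  coord j := coordFun U j.succ
  der_comm i j f := partialDeriv_comm i j f
  der_zero_coord j := (partialDeriv_coordFun 0 j.succ).trans (if_neg (Fin.succ_ne_zero j).symm)
  der_succ_coord i j := (partialDeriv_coordFun i.succ j.succ).trans
    (if_congr (Fin.succ_injective m).eq_iff rfl rfl)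
  der_zero_surjective := h.partialDeriv_zero_surjective
  exists_euler_add_self f hf := by
    obtain ⟨g, hg, hgf⟩ := h.exists_eulerOp_add_self hstar hf
    exact ⟨g, hg, by rw [← hgf, eulerOp_apply]; rfl⟩
  exists_eq_algebraMap f hf hE :=
    h.exists_eq_algebraMap hstar hf (by rw [eulerOp_apply]; exact hE)
  eq_zero_of_euler_eq f c hf := by
    -- The Euler operator vanishes over u = 0, a point of the base because the base is nonempty and
    -- star-shaped about it.
    obtain ⟨x, hx⟩ := exists_proj_eq_zero hne hstar
    have hf' : eulerOp U f = algebraMap ℝ (SmoothFun U) c := by rw [eulerOp_apply]; exact hf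
    have h := congrArg (fun k : SmoothFun U => (k : U → ℝ) x) hf'
    have hx' : ∀ j : Fin m, x.1 j.succ = 0 := fun j => congrFun hx j
    simp only [eulerOp_coe, hx', zero_mul, Finset.sum_const_zero] at h
    exact h.symm
  aeval_coord_injective := aeval_coordFun_injective hne

variable (h : ConnectedFibres U) (hne : (U : Set (Fin (m + 1) → ℝ)).Nonempty)
    (hstar : StarConvex ℝ 0 (base U : Set (Fin m → ℝ)))

/-- The concrete bracket and bivector unfold to the abstract ones of the book algebra of smooth
functions. -/
theorem schouten_bookBivector :
    schouten (bookBivector U) = (smoothBookAlgebra h hne hstar).d :=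
  (smoothBookAlgebra h hne hstar).bracket_bivector

theorem coboundaries_bookBivector (k : ℕ) :
    coboundaries (bookBivector U) k = (smoothBookAlgebra h hne hstar).cob k := by
  cases k with
  | zero => rfl
  | succ k => rw [coboundaries, schouten_bookBivector h hne hstar]; rfl

theorem cocycles_bookBivector (k : ℕ) : cocycles (bookBivector U) k =
    extDegree (SmoothFun U) (m + 1) k ⊓ LinearMap.ker (smoothBookAlgebra h hne hstar).d := by
  rw [cocycles, schouten_bookBivector h hne hstar]; rfl

theorem monomialField_eq_polyField (p : Multiset (Fin m) × Finset (Fin m)) :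
    monomialField U p.1 p.2 = (smoothBookAlgebra h hne hstar).polyField p := by
  have : genBasis (SmoothFun U) (m + 1) (p.2.map (Fin.succEmb m)) =
      (p.2.sort.map fun j => coordField U j.succ).prod := by
    have hs : (p.2.map (Fin.succEmb m)).sort = p.2.sort.map (Fin.succEmb m) :=
      (StrictMonoOn.map_finsetSort (Fin.succEmb m) p.2
        ((Fin.strictMono_succ (n := m)).strictMonoOn _)).symm
    rw [genBasis_eq_prod, hs, List.map_map]
    rfl
  rw [BookAlgebra.polyField, this]
  rfl

theorem basisField_eq_admissibleField (k : ℕ) (i : AdmissiblePairPred m k ⊕ AdmissiblePair m k) :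
    basisField U k i = (smoothBookAlgebra h hne hstar).admissibleField k i := by
  rcases i with p | p
  · exact congrArg (coordField U 0 * ·) (monomialField_eq_polyField h hne hstar p.1)
  · exact monomialField_eq_polyField h hne hstar p.1

theorem ConnectedFibres.exists_basis_poissonCohomology (h : ConnectedFibres U)
    (hne : (U : Set (Fin (m + 1) → ℝ)).Nonempty)
    (hstar : StarConvex ℝ 0 (base U : Set (Fin m → ℝ))) (hm : 1 ≤ m) (k : ℕ) :
    ∃ b : Module.Basis (AdmissiblePairPred m k ⊕ AdmissiblePair m k) ℝ
        (PoissonCohomology (bookBivector U) k),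
      ∀ i, ∃ hi : basisField U k i ∈ cocycles (bookBivector U) k, b i = cohomologyClass hi := by
  -- The quotient type depends on the two submodules, so the identifications are made by
  -- substitution, with submodules and representatives as variables.
  have key : ∀ (Z B : Submodule ℝ (Multivector U))
      (v : AdmissiblePairPred m k ⊕ AdmissiblePair m k → Multivector U),
      Z = cocycles (bookBivector U) k → B = coboundaries (bookBivector U) k →
      v = basisField U k → ∀ hv : ∀ i, v i ∈ Z,
      (∃ b : Module.Basis (AdmissiblePairPred m k ⊕ AdmissiblePair m k) ℝ (Z ⧸ B.submoduleOf Z),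
        ∀ i, b i = Submodule.Quotient.mk ⟨v i, hv i⟩) →
      ∃ b : Module.Basis (AdmissiblePairPred m k ⊕ AdmissiblePair m k) ℝ
          (PoissonCohomology (bookBivector U) k),
        ∀ i, ∃ hi : basisField U k i ∈ cocycles (bookBivector U) k, b i = cohomologyClass hi := by
    rintro _ _ _ rfl rfl rfl hv ⟨b, hb⟩
    exact ⟨b, fun i => ⟨hv i, hb i⟩⟩
  exact key _ _ _ (cocycles_bookBivector h hne hstar k).symm
    (coboundaries_bookBivector h hne hstar k).symm
    (funext fun i => (basisField_eq_admissibleField h hne hstar k i).symm)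
    _ ((smoothBookAlgebra h hne hstar).exists_basis_cohomology hm k)

theorem nonempty_linearEquiv_fin {V ι : Type*} [AddCommGroup V] [Module ℝ V] {N : ℕ}
    (b : Module.Basis ι ℝ V) (e : Fin N ≃ ι) : Nonempty (V ≃ₗ[ℝ] (Fin N → ℝ)) :=
  ⟨(b.reindex e.symm).equivFun⟩

end Concrete

end BookPoisson

end

theorem theorem2p6 (m : ℕ) (hm : 1 ≤ m)
    (U : TopologicalSpace.Opens (Fin (m + 1) → ℝ)) (hne : (U : Set (Fin (m + 1) → ℝ)).Nonempty)
    (hfib : ∀ u ∈ BookPoisson.proj m '' (U : Set (Fin (m + 1) → ℝ)),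
      IsConnected ((U : Set (Fin (m + 1) → ℝ)) ∩ BookPoisson.proj m ⁻¹' {u}))
    (hstar : StarConvex ℝ 0 (BookPoisson.proj m '' (U : Set (Fin (m + 1) → ℝ)))) (k : ℕ) :
    Nonempty (BookPoisson.PoissonCohomology (BookPoisson.bookBivector U) k ≃ₗ[ℝ]
        (Fin (m.choose k * (m + k - 1).choose k) → ℝ)) ∧
      ∃ b : Module.Basis (BookPoisson.AdmissiblePairPred m k ⊕ BookPoisson.AdmissiblePair m k) ℝ
          (BookPoisson.PoissonCohomology (BookPoisson.bookBivector U) k),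
        ∀ i, ∃ h : BookPoisson.basisField U k i ∈
            BookPoisson.cocycles (BookPoisson.bookBivector U) k,
          b i = BookPoisson.cohomologyClass h := by
  have hbas := BookPoisson.ConnectedFibres.exists_basis_poissonCohomology (U := U) hfib hne hstar hm k
  have he := BookPoisson.nonempty_fin_equiv hm k
  refine ⟨?_, hbas⟩
  obtain ⟨b, -⟩ := hbas
  obtain ⟨e⟩ := he
  exact BookPoisson.nonempty_linearEquiv_fin b e
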